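/- Let $\sigma,L>0$ and let $g\in C[0,\infty)\cap C^{2}(0,\infty)$ satisfy $g(0)=0$, $(\sigma-u)g(u)>0$ for all $u>0$, $u\neq\sigma$, and $g''(u)<0$ on $(0,\sigma)$. For $\lambda,\mu>0$ consider $$-\Bigl(\frac{u'}{\sqrt{1-u'^2}}\Bigr)'=\lambda g(u)-\mu \ \text{ in } (-L,L),\qquad u(-L)=u(L)=0. \tag{1}$$ A positive solution is a function $u\in C^2(-L,L)\cap C[-L,L]$ satisfying (1) with $u>0$ and $|u'|<1$ in $(-L,L)$. Let $$S_\mu=\{(\lambda,\|u\|_\infty): \lambda>0,\ u \text{ is a positive solution of (1)}\}.$$ Put $G(u)=\int_0^u g(t)\,dt$, $f_{\mu,\lambda}(u)=\lambda g(u)-\mu$ and $F_{\mu,\lambda}(u)=\lambda G(u)-\mu u$. Let $\kappa=\frac{\pi^2}{4g'(0^+)L^2}$ if $g'(0^+)\in(0,\infty)$ and $\kappa=0$ if $g'(0^+)=\infty$. Let $c^*\in(0,\sigma)$ be the unique number such that $(G(u)/u)'$ is positive on $(0,c^*)$, zero at $c^*$ and negative on $(c^*,\sigma)$; then $G(c^*)/c^*=g(c^*)$.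 Put $\lambda_\mu=\mu/g(c^*)$. For $\lambda>\lambda_\mu$, the function $f_{\mu,\lambda}$ has exactly two zeros $\varsigma<\beta$ in $(0,\sigma)$; it is negative on $(0,\varsigma)\cup(\beta,\sigma)$ and positive on $(\varsigma,\beta)$. Let $\theta_{\mu,\lambda}$ be the unique zero of $F_{\mu,\lambda}$ in $(\varsigma,\beta)$. **Theorem.** All of these numbers exist, and for every $\mu>0$ there are $\bar\lambda=\bar\lambda(\mu)>\lambda_\mu$, $\lambda^*=\lambda^*(\mu)$ and $\alpha^*=\alpha^*(\mu)$ such that, with $\bar\alpha=\bar\alpha(\mu)=\theta_{\mu,\bar\lambda}$, the bifurcation curve $S_\mu$ is continuous, starts from the point $(\bar\lambda,\bar\alpha)$ (which belongs to it), goes to $(\infty,\min\{\sigma,L\})$, and is $\subset$-shaped with exactly one turning point $(\lambda^*,\alpha^*)$. That is, $\bar\alpha<\alpha^*<\min\{\sigma,L\}$ and $$S_\mu=\{(\Lambda(\alpha),\alpha):\bar\alpha\le\alpha<\min\{\sigma,L\}\}$$ for a continuous function $\Lambda$ with $\Lambda(\bar\alpha)=\bar\lambda$ and $\Lambda(\alpha^*)=\lambda^*$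 that is strictly decreasing on $[\bar\alpha,\alpha^*]$, strictly increasing on $[\alpha^*,\min\{\sigma,L\})$, and satisfies $\Lambda(\alpha)\to\infty$ as $\alpha\to\min\{\sigma,L\}^-$. Moreover: (i) $\bar\lambda$ and $\bar\alpha$ are strictly increasing and continuous functions of $\mu\in(0,\infty)$, with $(\bar\lambda,\bar\alpha)\to(4\kappa,0)$ as $\mu\to0^+$ and $(\bar\lambda,\bar\alpha)\to(\infty,\min\{c^*,L\})$ as $\mu\to\infty$. (ii) $\lambda^*$ and $\alpha^*$ are strictly increasing and continuous functions of $\mu\in(0,\infty)$, with $(\lambda^*,\alpha^*)\to(\kappa,0)$ as $\mu\to0^+$ and $(\lambda^*,\alpha^*)\to(\infty,\min\{c^*,L\})$ as $\mu\to\infty$. -/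

import Mathlib

open Set Filter Topology

noncomputable section

/-- Standing assumptions on the growth term `g` (only its values on `[0, ∞)` matter):
`g ∈ C[0,∞) ∩ C²(0,∞)`, `g(0) = 0`, `(σ - u) g(u) > 0` for `0 < u ≠ σ`, and
`g'' < 0` on `(0, σ)`. -/
structure IsLogisticGrowth (g : ℝ → ℝ) (σ : ℝ) : Prop where
  sigma_pos : 0 < σ
  continuousOn : ContinuousOn g (Ici 0)
  contDiffOn : ContDiffOn ℝ 2 g (Ioi 0)
  map_zero : g 0 = 0
  sign : ∀ u, 0 < u → u ≠ σ → 0 < (σ - u) * g u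
  concave : ∀ u ∈ Ioo 0 σ, iteratedDeriv 2 g u < 0

/-- The primitive `G(u) = ∫₀ᵘ g(t) dt`. -/
def primG (g : ℝ → ℝ) (u : ℝ) : ℝ := ∫ t in (0 : ℝ)..u, g t

/-- The reaction term `f_{μ,λ}(u) = λ g(u) - μ`. -/
def reaction (g : ℝ → ℝ) (μ lam u : ℝ) : ℝ := lam * g u - μ

/-- Its primitive `F_{μ,λ}(u) = λ G(u) - μ u`. -/
def primF (g : ℝ → ℝ) (μ lam u : ℝ) : ℝ := lam * primG g u - μ * u

/-- `u` is a positive solution of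
`-(u' / √(1 - u'²))' = λ g(u) - μ` in `(-L, L)`, `u(-L) = u(L) = 0`,
with `u ∈ C²(-L, L) ∩ C[-L, L]` and `|u'| < 1` in `(-L, L)`. -/
structure IsPositiveSolution (g : ℝ → ℝ) (L lam μ : ℝ) (u : ℝ → ℝ) : Prop where
  continuousOn : ContinuousOn u (Icc (-L) L)
  contDiffOn : ContDiffOn ℝ 2 u (Ioo (-L) L)
  pos : ∀ x ∈ Ioo (-L) L, 0 < u x
  slope_lt_one : ∀ x ∈ Ioo (-L) L, |deriv u x| < 1
  equation : ∀ x ∈ Ioo (-L) L,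
    HasDerivAt (fun y => -(deriv u y / √(1 - (deriv u y) ^ 2))) (lam * g (u x) - μ) x
  left_bc : u (-L) = 0
  right_bc : u L = 0

/-- The supremum norm of `u` on `[-L, L]`. -/
def supNorm (L : ℝ) (u : ℝ → ℝ) : ℝ := sSup ((fun x => |u x|) '' Icc (-L) L)

/-- The bifurcation curve `S_μ` in the `(λ, ‖u‖∞)`-plane. -/
def bifurcationCurve (g : ℝ → ℝ) (L μ : ℝ) : Set (ℝ × ℝ) :=
  {p | 0 < p.1 ∧ ∃ u : ℝ → ℝ, IsPositiveSolution g L p.1 μ u ∧ p.2 = supNorm L u}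

/-- The number `c*`: the point of `(0, σ)` with `(G(u)/u)' > 0` on `(0, c*)`, `= 0` at `c*`
and `< 0` on `(c*, σ)`; there `G(c*)/c* = g(c*)`. -/
structure IsCStar (g : ℝ → ℝ) (σ c : ℝ) : Prop where
  mem : c ∈ Ioo 0 σ
  deriv_pos : ∀ u ∈ Ioo 0 c, 0 < deriv (fun v => primG g v / v) u
  deriv_eq_zero : deriv (fun v => primG g v / v) c = 0
  deriv_neg : ∀ u ∈ Ioo c σ, deriv (fun v => primG g v / v) u < 0
  value : primG g c / c = g c

/-- `κ = π² / (4 g'(0⁺) L²)` if `g'(0⁺) ∈ (0, ∞)`, and `κ = 0` if `g'(0⁺) = ∞`. -/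
def IsKappa (g : ℝ → ℝ) (L κ : ℝ) : Prop :=
  (∃ d : ℝ, 0 < d ∧ Tendsto (deriv g) (𝓝[>] 0) (𝓝 d) ∧ κ = Real.pi ^ 2 / (4 * d * L ^ 2)) ∨
    (Tendsto (deriv g) (𝓝[>] 0) atTop ∧ κ = 0)

/-- `z` and `b` are the zeros of `f_{μ,λ}` in `(0, σ)`: it is negative on
`(0, z) ∪ (b, σ)` and positive on `(z, b)`. -/
structure IsZeroPair (g : ℝ → ℝ) (σ μ lam z b : ℝ) : Prop where
  z_pos : 0 < z
  z_lt_b : z < b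
  b_lt : b < σ
  neg_left : ∀ u ∈ Ioo 0 z, reaction g μ lam u < 0
  zero_z : reaction g μ lam z = 0
  pos_mid : ∀ u ∈ Ioo z b, 0 < reaction g μ lam u
  zero_b : reaction g μ lam b = 0
  neg_right : ∀ u ∈ Ioo b σ, reaction g μ lam u < 0

/-- `θ = θ_{μ,λ}` is the zero of `F_{μ,λ}` strictly between the two zeros of `f_{μ,λ}`
(there is at most one, as `F_{μ,λ}' = f_{μ,λ} > 0` there). -/
def IsTheta (g : ℝ → ℝ) (σ μ lam θ : ℝ) : Prop :=
  ∃ z b : ℝ, IsZeroPair g σ μ lam z b ∧ θ ∈ Ioo z b ∧ primF g μ lam θ = 0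

/-- `S` is a continuous `⊂`-shaped curve in the `(λ, α)`-plane which starts from the point
`start` (included), goes to `(∞, m)`, and has exactly one turning point, `turn`: `S` is the
graph `λ = Λ(α)`, `start.2 ≤ α < m`, of a continuous function `Λ` which strictly decreases up
to `turn`, strictly increases afterwards, and tends to `∞` as `α → m⁻`. -/
def IsSubsetShaped (S : Set (ℝ × ℝ)) (start turn : ℝ × ℝ) (m : ℝ) : Prop :=
  ∃ Λ : ℝ → ℝ,
    start.2 < turn.2 ∧ turn.2 < m ∧
    S = (fun α => (Λ α, α)) '' Ico start.2 m ∧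
    ContinuousOn Λ (Ico start.2 m) ∧
    Λ start.2 = start.1 ∧ Λ turn.2 = turn.1 ∧
    StrictAntiOn Λ (Icc start.2 turn.2) ∧
    StrictMonoOn Λ (Ico turn.2 m) ∧
    Tendsto Λ (𝓝[<] m) atTop

end

/-! The energy `1/√(1 - u'²) + F(u)` is constant along a solution. Hence a positive solution with
maximum `a` exists on `(-L, L)` exactly when `timeMap λ μ a = ∫₀¹ a kern(F(a) - F(as)) ds` equals
`L`, where `a` must satisfy `F(a) ≥ 0` and `f(a) > 0` (`Adm`). So the bifurcation curve is a level
set of the time map (`mem_bifurcationCurve_iff`). The time map strictly decreases in `λ`, so each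
height `a` carries at most one `λ = Λ(a)`.

Shape. With `z = 1/a` and `w = (F(a) - F(as))/a²` the integrand is `kern(w/z²)/z`. This is convex in
`(w, z)` and decreasing in `w`, while `w` is a concave function of `z`, being built from
perspectives of the concave `g` and a linear term. Thus the time map is strictly convex in `1/a`,
hence strictly quasiconvex in `a` (`Adm.timeMap_lt_max`), and monotonicity in `λ` transfers this to
`Λ` (`OnCurve.lt_max`). `Λ` blows up at `min σ L`, and it takes smaller values just above its left
end, because `F` vanishes there and the time map has slope `-∞` (`Adm.exists_timeMap_lt`). This
gives the `⊂` shape.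

Starting point. Where `F(a) = 0` one has `μ = λ M(a)` with the concave mean `M(u) = G(u)/u`, and the
gap `F(a) - F(as)` is governed by secant slopes of `M`. Along this branch the time map increases in
`a` and decreases in `λ` (`IsCStar.branch_lt`), which yields existence, uniqueness and monotonicity
in `μ`.

Turning point. `λ*` is monotone because the time map increases with `μ`. For `α*`, fix a height `a`
and follow the point of the curve at that height as `μ` varies. Wherever the `a`-derivative of the
time map vanishes along this family, its `μ`-derivative is negative
(`LevelFamily.integral_integrand_neg`), so after a zero it remains negative. The sign is found by
subtracting two expressions with zero integral, after which the integrand is negative pointwise;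
this reduces to the polynomial inequality `cubic_neg`.

Continuity in `μ` follows from compactness and uniqueness. As `μ → 0` the gap is compared with
multiples of `s(1 - s)` on the branch `F = 0` and of `1 - s²` for the turn; the resulting integrals
`π` and `π/2` account for `4κ` against `κ`. -/

namespace IsLogisticGrowth

/-! ### The growth term, its primitive and its mean value. -/

variable {g : ℝ → ℝ} {σ : ℝ}

theorem contDiffAt (hg : IsLogisticGrowth g σ) {u : ℝ} (hu : 0 < u) : ContDiffAt ℝ 2 g u :=
  hg.contDiffOn.contDiffAt (Ioi_mem_nhds hu)

theorem hasDerivAt (hg : IsLogisticGrowth g σ) {u : ℝ} (hu : 0 < u) :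
    HasDerivAt g (deriv g u) u :=
  ((hg.contDiffAt hu).differentiableAt (by norm_num)).hasDerivAt

theorem continuousAt (hg : IsLogisticGrowth g σ) {u : ℝ} (hu : 0 < u) : ContinuousAt g u :=
  (hg.hasDerivAt hu).continuousAt

theorem continuousOn_deriv (hg : IsLogisticGrowth g σ) : ContinuousOn (deriv g) (Ioi 0) :=
  hg.contDiffOn.continuousOn_deriv_of_isOpen isOpen_Ioi (by norm_num)

theorem strictConcaveOn (hg : IsLogisticGrowth g σ) : StrictConcaveOn ℝ (Icc 0 σ) g := by
  apply strictConcaveOn_of_deriv2_neg (convex_Icc 0 σ) (hg.continuousOn.mono Icc_subset_Ici_self)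
  intro x hx
  rw [interior_Icc] at hx
  have := hg.concave x hx
  rwa [iteratedDeriv_eq_iterate] at this

theorem concaveOn (hg : IsLogisticGrowth g σ) : ConcaveOn ℝ (Icc 0 σ) g := hg.strictConcaveOn.concaveOn

theorem deriv_strictAntiOn (hg : IsLogisticGrowth g σ) : StrictAntiOn (deriv g) (Ioo 0 σ) := by
  apply strictAntiOn_of_deriv_neg (convex_Ioo 0 σ)
    (hg.continuousOn_deriv.mono fun x hx => hx.1)
  intro x hx
  rw [interior_Ioo] at hx
  have := hg.concave x hx
  rwa [iteratedDeriv_succ, iteratedDeriv_one] at this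

theorem pos (hg : IsLogisticGrowth g σ) {u : ℝ} (h0 : 0 < u) (h1 : u < σ) : 0 < g u :=
  (pos_iff_pos_of_mul_pos (hg.sign u h0 h1.ne)).1 (by linarith)

theorem neg (hg : IsLogisticGrowth g σ) {u : ℝ} (h1 : σ < u) : g u < 0 := by
  have h := hg.sign u (hg.sigma_pos.trans h1) h1.ne'
  by_contra hc
  push Not at hc
  nlinarith

theorem map_sigma (hg : IsLogisticGrowth g σ) : g σ = 0 := by
  have hc := hg.continuousAt hg.sigma_pos
  apply le_antisymm
  · refine le_of_tendsto (hc.tendsto.mono_left nhdsWithin_le_nhds : Tendsto g (𝓝[>] σ) _) ?_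
    filter_upwards [self_mem_nhdsWithin] with x hx using (hg.neg hx).le
  · refine ge_of_tendsto (hc.tendsto.mono_left nhdsWithin_le_nhds : Tendsto g (𝓝[<] σ) _) ?_
    filter_upwards [Ioo_mem_nhdsLT hg.sigma_pos] with x hx using (hg.pos hx.1 hx.2).le

theorem nonneg (hg : IsLogisticGrowth g σ) {u : ℝ} (hu : u ∈ Icc 0 σ) : 0 ≤ g u := by
  rcases eq_or_lt_of_le hu.1 with h | h
  · rw [← h, hg.map_zero]
  rcases eq_or_lt_of_le hu.2 with h' | h'
  · rw [h', hg.map_sigma]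
  · exact (hg.pos h h').le

theorem tangent (hg : IsLogisticGrowth g σ) {u t : ℝ} (hu : u ∈ Ioo 0 σ) (ht : t ∈ Icc 0 σ) :
    g t ≤ g u + deriv g u * (t - u) := by
  have hu' : u ∈ Icc 0 σ := ⟨hu.1.le, hu.2.le⟩
  have hd := hg.hasDerivAt hu.1
  rcases lt_trichotomy t u with h | h | h
  · have := hg.concaveOn.le_slope_of_hasDerivAt ht hu' h hd
    rw [slope_def_field, le_div_iff₀ (by linarith)] at this
    linarith
  · simp [h]
  · have := hg.concaveOn.slope_le_of_hasDerivAt hu' ht h hd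
    rw [slope_def_field, div_le_iff₀ (by linarith)] at this
    linarith

theorem mul_le (hg : IsLogisticGrowth g σ) {a t : ℝ} (ha : a ∈ Icc 0 σ) (ht : t ∈ Icc (0:ℝ) 1) :
    t * g a ≤ g (a * t) := by
  have := hg.concaveOn.2 (left_mem_Icc.2 hg.sigma_pos.le) ha (sub_nonneg.2 ht.2) ht.1 (by ring)
  simp only [smul_eq_mul, mul_zero, zero_add, hg.map_zero] at this
  rwa [mul_comm t a] at this

theorem intervalIntegrable (hg : IsLogisticGrowth g σ) {a b : ℝ} (ha : 0 ≤ a) (hb : 0 ≤ b) :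
    IntervalIntegrable g MeasureTheory.volume a b := by
  apply ContinuousOn.intervalIntegrable
  apply hg.continuousOn.mono
  intro x hx
  rcases le_total a b with h | h
  · rw [uIcc_of_le h] at hx; exact ha.trans hx.1
  · rw [uIcc_of_ge h] at hx; exact hb.trans hx.1

theorem primG_zero : primG g 0 = 0 := by simp [primG]

theorem primG_sub (hg : IsLogisticGrowth g σ) {a b : ℝ} (ha : 0 ≤ a) (hb : 0 ≤ b) :
    primG g b - primG g a = ∫ t in a..b, g t := by
  unfold primG
  rw [intervalIntegral.integral_interval_sub_left (hg.intervalIntegrable le_rfl hb)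
    (hg.intervalIntegrable le_rfl ha)]

theorem hasDerivAt_primG (hg : IsLogisticGrowth g σ) {u : ℝ} (hu : 0 < u) :
    HasDerivAt (primG g) (g u) u := by
  apply intervalIntegral.integral_hasDerivAt_right (hg.intervalIntegrable le_rfl hu.le) _
    (hg.continuousAt hu)
  exact (hg.continuousOn.mono Ioi_subset_Ici_self).stronglyMeasurableAtFilter isOpen_Ioi u hu

theorem continuousOn_primG (hg : IsLogisticGrowth g σ) : ContinuousOn (primG g) (Ici 0) := by
  intro u hu
  have h : ContinuousOn (primG g) (Icc 0 (u + 1)) := by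
    have := intervalIntegral.continuousOn_primitive_interval (μ := MeasureTheory.volume)
      (f := g) (a := 0) (b := u + 1)
    rw [uIcc_of_le (by linarith [mem_Ici.1 hu])] at this
    apply this
    exact (hg.continuousOn.mono Icc_subset_Ici_self).integrableOn_Icc
  have h2 := h u ⟨hu, by linarith⟩
  apply h2.mono_of_mem_nhdsWithin
  rw [mem_nhdsWithin]
  exact ⟨Iio (u + 1), isOpen_Iio, by simp, fun x hx => ⟨hx.2, (mem_Iio.1 hx.1).le⟩⟩

theorem primG_sub_affine (b c : ℝ) (hg : IsLogisticGrowth g σ) (hb : 0 ≤ b) (hc : 0 ≤ c) :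
    primG g b - primG g c = (b - c) * ∫ t in (0:ℝ)..1, g (c + (b - c) * t) := by
  rw [hg.primG_sub hc hb]
  have := intervalIntegral.smul_integral_comp_add_mul (a := 0) (b := 1) g (b - c) c
  rw [smul_eq_mul] at this
  rw [this]; simp

theorem primG_sub_mul (hg : IsLogisticGrowth g σ) {a s : ℝ} (ha : 0 ≤ a) (hs : 0 ≤ s) :
    primG g a - primG g (a * s) = a * ∫ t in s..1, g (a * t) := by
  rw [hg.primG_sub (mul_nonneg ha hs) ha]
  have := intervalIntegral.smul_integral_comp_mul_left (a := s) (b := 1) g a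
  rw [smul_eq_mul] at this
  rw [this]; simp

theorem continuousOn_comp {a b : ℝ} (hg : IsLogisticGrowth g σ) {φ : ℝ → ℝ}
    (hφ : ContinuousOn φ (uIcc a b)) (h0 : ∀ x ∈ uIcc a b, 0 ≤ φ x) :
    ContinuousOn (fun x => g (φ x)) (uIcc a b) :=
  hg.continuousOn.comp hφ h0

theorem intervalIntegrable_comp {a b : ℝ} (hg : IsLogisticGrowth g σ) {φ : ℝ → ℝ}
    (hφ : ContinuousOn φ (uIcc a b)) (h0 : ∀ x ∈ uIcc a b, 0 ≤ φ x) :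
    IntervalIntegrable (fun x => g (φ x)) MeasureTheory.volume a b :=
  (hg.continuousOn_comp hφ h0).intervalIntegrable

theorem primG_eq_mul_integral (hg : IsLogisticGrowth g σ) {a : ℝ} (ha : 0 ≤ a) :
    primG g a = a * ∫ t in (0:ℝ)..1, g (a * t) := by
  have := hg.primG_sub_mul ha le_rfl
  simpa [primG_zero] using this

theorem integrable_mul {a s : ℝ} (hg : IsLogisticGrowth g σ) (ha : 0 ≤ a) (hs : s ∈ Icc (0:ℝ) 1) :
    IntervalIntegrable (fun t => g (a * t)) MeasureTheory.volume s 1 := by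
  apply hg.intervalIntegrable_comp (by fun_prop)
  intro x hx
  rw [uIcc_of_le hs.2] at hx
  exact mul_nonneg ha (hs.1.trans hx.1)

/-- The affine map `t ↦ (1 - s) a t + s a` carries `[0, 1]` onto `[as, a]`; concavity is applied
between `at` and `a` for each `t` and integrated. The terms `G(a)` and `a g(a)` are kept apart
because they later become `F(a)` and `a f(a)`. -/
theorem primG_sub_lower (hg : IsLogisticGrowth g σ) {a s : ℝ} (ha : a ∈ Ioc 0 σ)
    (hs : s ∈ Icc (0:ℝ) 1) :
    (1 - s) * ((1 - s) * primG g a + s * (a * g a)) ≤ primG g a - primG g (a * s) := by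
  rw [hg.primG_sub_affine a (a * s) ha.1.le (mul_nonneg ha.1.le hs.1)]
  have h1 : ∫ t in (0:ℝ)..1, ((1 - s) * g (a * t) + s * g a) ≤
      ∫ t in (0:ℝ)..1, g (a * s + (a - a * s) * t) := by
    apply intervalIntegral.integral_mono_on zero_le_one
    · exact ((hg.integrable_mul ha.1.le (left_mem_Icc.2 zero_le_one)).const_mul _).add (by simp)
    · apply hg.intervalIntegrable_comp (by fun_prop)
      intro x hx
      rw [uIcc_of_le zero_le_one] at hx
      have := mul_nonneg ha.1.le hs.1
      have := mul_nonneg ha.1.le (mul_nonneg (sub_nonneg.2 hs.2) hx.1)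
      nlinarith
    · intro t ht
      have hat : a * t ∈ Icc 0 σ :=
        ⟨mul_nonneg ha.1.le ht.1, (mul_le_of_le_one_right ha.1.le ht.2).trans ha.2⟩
      have := hg.concaveOn.2 hat ⟨ha.1.le, ha.2⟩ (sub_nonneg.2 hs.2) hs.1 (by ring)
      simp only [smul_eq_mul] at this
      have he : a * s + (a - a * s) * t = (1 - s) * (a * t) + s * a := by ring
      rw [he]; exact this
  rw [intervalIntegral.integral_add ((hg.integrable_mul ha.1.le (left_mem_Icc.2
    zero_le_one)).const_mul _) (by simp), intervalIntegral.integral_const_mul,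
    intervalIntegral.integral_const] at h1
  have h2 := hg.primG_eq_mul_integral ha.1.le
  rw [h2]
  have h3 : 0 ≤ a * (1 - s) := mul_nonneg ha.1.le (sub_nonneg.2 hs.2)
  have := mul_le_mul_of_nonneg_left h1 h3
  simp only [sub_zero, one_smul] at this
  linarith

/-- The tangent line at `a` bounds `g`. The correction is quadratic in `1 - s`, so a gap whose
reaction vanishes at `a` is of second order. -/
theorem primG_sub_upper (hg : IsLogisticGrowth g σ) {a s : ℝ} (ha : a ∈ Ioo 0 σ)
    (hs : s ∈ Icc (0:ℝ) 1) :
    primG g a - primG g (a * s) ≤ a * (1 - s) * (g a + |deriv g a| * (a * (1 - s))) := by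
  have has : 0 ≤ a * s := mul_nonneg ha.1.le hs.1
  have has' : a * s ≤ a := mul_le_of_le_one_right ha.1.le hs.2
  rw [hg.primG_sub has ha.1.le]
  have h1 : ∫ t in (a * s)..a, g t ≤ ∫ _t in (a * s)..a, (g a + |deriv g a| * (a * (1 - s))) := by
    apply intervalIntegral.integral_mono_on has' (hg.intervalIntegrable has ha.1.le) (by simp)
    intro t ht
    have h := hg.tangent ha ⟨has.trans ht.1, ht.2.trans ha.2.le⟩
    have h2 : deriv g a * (t - a) ≤ |deriv g a| * (a * (1 - s)) := by
      have : deriv g a * (t - a) ≤ |deriv g a| * (a - t) := by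
        have := neg_abs_le (deriv g a)
        nlinarith [ht.2]
      refine this.trans (mul_le_mul_of_nonneg_left ?_ (abs_nonneg _))
      nlinarith [ht.1]
    linarith
  rw [intervalIntegral.integral_const, smul_eq_mul] at h1
  calc _ ≤ _ := h1
    _ = _ := by ring

theorem primG_pos (hg : IsLogisticGrowth g σ) {a : ℝ} (ha : a ∈ Ioc 0 σ) : 0 < primG g a := by
  unfold primG
  apply intervalIntegral.intervalIntegral_pos_of_pos_on (hg.intervalIntegrable le_rfl ha.1.le) _ ha.1
  intro x hx
  exact hg.pos hx.1 (hx.2.trans_le ha.2)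

theorem primG_sub_pos (hg : IsLogisticGrowth g σ) {a s : ℝ} (ha : a ∈ Ioc 0 σ)
    (hs : s ∈ Ico (0:ℝ) 1) : 0 < primG g a - primG g (a * s) := by
  have has : 0 ≤ a * s := mul_nonneg ha.1.le hs.1
  rw [hg.primG_sub has ha.1.le]
  apply intervalIntegral.intervalIntegral_pos_of_pos_on (hg.intervalIntegrable has ha.1.le)
  · intro x hx
    exact hg.pos (has.trans_lt hx.1) (hx.2.trans_le ha.2)
  · nlinarith [hs.2, ha.1]

/-! The mean value `G(u)/u`. -/

/-- At `u = 0` the convention `0 / 0 = 0` agrees with `g(0) = 0`, so the mean may be used on closed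
intervals containing the origin. -/
theorem mean_eq (hg : IsLogisticGrowth g σ) {u : ℝ} (hu : 0 ≤ u) :
    primG g u / u = ∫ t in (0:ℝ)..1, g (u * t) := by
  rcases eq_or_lt_of_le hu with h | h
  · simp [← h, hg.map_zero]
  · rw [hg.primG_eq_mul_integral hu]
    field_simp

/-- The mean is an average of the dilates `u ↦ g(ut)`, each of which is concave. -/
theorem mean_concaveOn (hg : IsLogisticGrowth g σ) :
    ConcaveOn ℝ (Icc 0 σ) (fun u => primG g u / u) := by
  refine ⟨convex_Icc 0 σ, ?_⟩
  intro x hx y hy p q hp hq hpq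
  have hz : 0 ≤ p • x + q • y := by
    simp only [smul_eq_mul]; exact add_nonneg (mul_nonneg hp hx.1) (mul_nonneg hq hy.1)
  have h01 := left_mem_Icc.2 (zero_le_one (α := ℝ))
  simp only
  rw [hg.mean_eq hx.1, hg.mean_eq hy.1, hg.mean_eq hz, smul_eq_mul, smul_eq_mul,
    ← intervalIntegral.integral_const_mul, ← intervalIntegral.integral_const_mul,
    ← intervalIntegral.integral_add ((hg.integrable_mul hx.1 h01).const_mul _)
      ((hg.integrable_mul hy.1 h01).const_mul _)]
  apply intervalIntegral.integral_mono_on zero_le_one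
    (((hg.integrable_mul hx.1 h01).const_mul _).add ((hg.integrable_mul hy.1 h01).const_mul _))
    (hg.integrable_mul hz h01)
  intro t ht
  have hxt : x * t ∈ Icc 0 σ :=
    ⟨mul_nonneg hx.1 ht.1, (mul_le_of_le_one_right hx.1 ht.2).trans hx.2⟩
  have hyt : y * t ∈ Icc 0 σ :=
    ⟨mul_nonneg hy.1 ht.1, (mul_le_of_le_one_right hy.1 ht.2).trans hy.2⟩
  have := hg.concaveOn.2 hxt hyt hp hq hpq
  simp only [smul_eq_mul] at this
  have he : (p * x + q * y) * t = p * (x * t) + q * (y * t) := by ring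
  rw [smul_eq_mul, smul_eq_mul, he]; exact this

theorem hasDerivAt_mean (hg : IsLogisticGrowth g σ) {u : ℝ} (hu : 0 < u) :
    HasDerivAt (fun v => primG g v / v) ((g u * u - primG g u) / u ^ 2) u := by
  have := (hg.hasDerivAt_primG hu).fun_div (hasDerivAt_id' u) hu.ne'
  rwa [mul_one] at this

theorem exists_deriv_nonneg (hg : IsLogisticGrowth g σ) :
    ∃ p ∈ Ioo 0 σ, deriv g p = 0 := by
  have := exists_deriv_eq_zero (f := g) hg.sigma_pos (hg.continuousOn.mono Icc_subset_Ici_self)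
    (by rw [hg.map_zero, hg.map_sigma])
  exact this

/-- If `g` does not exceed its mean at `u`, it stays strictly below its mean afterwards. -/
theorem lt_mean_of_le (hg : IsLogisticGrowth g σ) {u v : ℝ} (hu : 0 < u) (huv : u < v) (hv : v ≤ σ)
    (h : g u * u ≤ primG g u) : g v * v < primG g v := by
  have hu' : u ∈ Ioo 0 σ := ⟨hu, huv.trans_le hv⟩
  -- If `g'(u) ≥ 0`, concavity puts `g` strictly below `g(u)` on `(0, u)`, and `g(u)` would exceed
  -- its mean over `[0, u]`.
  have hd : deriv g u < 0 := by
    by_contra hc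
    push Not at hc
    have hlt : ∀ t ∈ Ioo 0 u, g t < g u := by
      intro t ht
      have ht' : t ∈ Ioo 0 σ := ⟨ht.1, ht.2.trans hu'.2⟩
      have h1 := hg.deriv_strictAntiOn ht' hu' ht.2
      have h3 : (t + u) / 2 ∈ Ioo 0 σ := ⟨by linarith [ht.1], by linarith [ht.2, hu'.2]⟩
      have h2 := hg.tangent h3 (t := t) ⟨ht.1.le, ht'.2.le⟩
      have h4 := hg.tangent hu' (t := (t + u) / 2) ⟨h3.1.le, h3.2.le⟩
      have h5 := hg.deriv_strictAntiOn h3 hu' (by linarith [ht.2])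
      nlinarith [ht.2]
    have h2 : 0 < ∫ t in (0:ℝ)..u, (g u - g t) := by
      apply intervalIntegral.intervalIntegral_pos_of_pos_on
        ((by simp : IntervalIntegrable (fun _ => g u) _ 0 u).sub
          (hg.intervalIntegrable le_rfl hu.le)) _ hu
      intro t ht
      linarith [hlt t ht]
    rw [intervalIntegral.integral_sub (by simp) (hg.intervalIntegrable le_rfl hu.le)] at h2
    simp only [intervalIntegral.integral_const, smul_eq_mul] at h2
    unfold primG at h
    linarith
  have hgl : ∀ w, u < w → w ≤ σ → g w < g u := by
    intro w hw hws
    have := hg.tangent hu' (t := w) ⟨(hu.trans hw).le, hws⟩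
    nlinarith
  have hle : ∀ t ∈ Icc u v, g v ≤ g t := by
    intro t ht
    rcases eq_or_lt_of_le ht.2 with h1 | h1
    · rw [h1]
    rcases eq_or_lt_of_le ht.1 with h2 | h2
    · rw [← h2]; exact (hgl v huv hv).le
    have ht' : t ∈ Ioo 0 σ := ⟨hu.trans h2, h1.trans_le hv⟩
    have h3 := hg.tangent ht' (t := v) ⟨(hu.trans huv).le, hv⟩
    have h4 := hg.deriv_strictAntiOn hu' ht' h2
    nlinarith
  -- Since `g(v) < g(u)`, this gives `G(v) ≥ G(u) + (v - u) g(v) ≥ u g(u) + (v - u) g(v) > v g(v)`.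
  have h3 : ∫ _t in u..v, g v ≤ ∫ t in u..v, g t :=
    intervalIntegral.integral_mono_on huv.le (by simp)
      (hg.intervalIntegrable hu.le (hu.trans huv).le) hle
  rw [← hg.primG_sub hu.le (hu.trans huv).le, intervalIntegral.integral_const, smul_eq_mul] at h3
  have := hgl v huv hv
  nlinarith

/-- The numerator `u g(u) - G(u)` of the derivative of the mean is nonnegative at a critical point
of `g`, where `g` is maximal, and negative at `σ`; `lt_mean_of_le` allows only one sign change. -/
theorem exists_isCStar (hg : IsLogisticGrowth g σ) : ∃ c, IsCStar g σ c := by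
  obtain ⟨p, hp, hp0⟩ := hg.exists_deriv_nonneg
  have hNp : 0 ≤ g p * p - primG g p := by
    by_contra hc
    push Not at hc
    have h1 : ∫ t in (0:ℝ)..p, g t ≤ ∫ _t in (0:ℝ)..p, g p := by
      apply intervalIntegral.integral_mono_on hp.1.le (hg.intervalIntegrable le_rfl hp.1.le) (by simp)
      intro t ht
      have := hg.tangent hp (t := t) ⟨ht.1, ht.2.trans hp.2.le⟩
      rw [hp0] at this; linarith
    simp only [intervalIntegral.integral_const, smul_eq_mul] at h1
    unfold primG at hc
    linarith
  have hNs : g σ * σ - primG g σ ≤ 0 := by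
    rw [hg.map_sigma]
    linarith [hg.primG_pos ⟨hg.sigma_pos, le_rfl⟩]
  have hcont : ContinuousOn (fun u => g u * u - primG g u) (Icc p σ) :=
    ((hg.continuousOn.mul continuousOn_id).sub hg.continuousOn_primG).mono
      fun x hx => hp.1.le.trans hx.1
  obtain ⟨c, hc, hc0⟩ := intermediate_value_Icc' hp.2.le hcont ⟨hNs, hNp⟩
  simp only at hc0
  have hc1 : 0 < c := hp.1.trans_le hc.1
  have hcs : c < σ := by
    rcases eq_or_lt_of_le hc.2 with h | h
    · rw [h, hg.map_sigma] at hc0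
      linarith [hg.primG_pos ⟨hg.sigma_pos, le_rfl⟩]
    · exact h
  refine ⟨c, ⟨hc1, hcs⟩, ?_, ?_, ?_, ?_⟩
  · intro u hu
    rw [(hg.hasDerivAt_mean hu.1).deriv]
    apply div_pos _ (pow_pos hu.1 2)
    by_contra hn
    push Not at hn
    have := hg.lt_mean_of_le hu.1 hu.2 hcs.le (by linarith)
    linarith
  · rw [(hg.hasDerivAt_mean hc1).deriv, hc0, zero_div]
  · intro u hu
    have hu0 := hc1.trans hu.1
    rw [(hg.hasDerivAt_mean hu0).deriv]
    apply div_neg_of_neg_of_pos _ (pow_pos hu0 2)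
    have := hg.lt_mean_of_le hc1 hu.1 hu.2.le (by linarith)
    linarith
  · field_simp; linarith

end IsLogisticGrowth

/-! ### Uniqueness of `c*` and the behaviour of the mean on either side of it. -/

theorem IsCStar.unique {g : ℝ → ℝ} {σ c c' : ℝ} (h : IsCStar g σ c) (h' : IsCStar g σ c') :
    c' = c := by
  rcases lt_trichotomy c' c with hlt | heq | hlt
  · have h1 : (c' + c) / 2 ∈ Ioo 0 c := ⟨by linarith [h'.mem.1, h.mem.1], by linarith⟩
    have h2 : (c' + c) / 2 ∈ Ioo c' σ := ⟨by linarith, by linarith [h.mem.2]⟩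
    linarith [h.deriv_pos _ h1, h'.deriv_neg _ h2]
  · exact heq
  · have h1 : (c' + c) / 2 ∈ Ioo 0 c' := ⟨by linarith [h'.mem.1, h.mem.1], by linarith⟩
    have h2 : (c' + c) / 2 ∈ Ioo c σ := ⟨by linarith, by linarith [h'.mem.2]⟩
    linarith [h'.deriv_pos _ h1, h.deriv_neg _ h2]

namespace IsCStar

variable {g : ℝ → ℝ} {σ c : ℝ}

theorem primG_lt (hc : IsCStar g σ c) (hg : IsLogisticGrowth g σ) {u : ℝ} (hu : u ∈ Ioo 0 c) :
    primG g u < g u * u := by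
  have := hc.deriv_pos u hu
  rw [(hg.hasDerivAt_mean hu.1).deriv] at this
  have h2 := pow_pos hu.1 2
  rw [div_pos_iff_of_pos_right h2] at this
  linarith

theorem le_primG (hc : IsCStar g σ c) (hg : IsLogisticGrowth g σ) {u : ℝ} (hu : u ∈ Ico c σ) :
    g u * u ≤ primG g u := by
  have h0 : 0 < u := hc.mem.1.trans_le hu.1
  rcases eq_or_lt_of_le hu.1 with h | h
  · have := hc.value
    rw [← h]
    have := hc.mem.1
    field_simp at *
    linarith
  have := hc.deriv_neg u ⟨h, hu.2⟩
  rw [(hg.hasDerivAt_mean h0).deriv] at this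
  have h2 := pow_pos h0 2
  have h3 : (g u * u - primG g u) < 0 := by
    by_contra hn
    push Not at hn
    linarith [div_nonneg hn h2.le]
  linarith

theorem mean_strictMonoOn (hc : IsCStar g σ c) (hg : IsLogisticGrowth g σ) :
    StrictMonoOn (fun u => primG g u / u) (Ioc 0 c) := by
  apply strictMonoOn_of_deriv_pos (convex_Ioc 0 c)
  · intro x hx
    exact (hg.hasDerivAt_mean hx.1).continuousAt.continuousWithinAt
  · intro x hx
    rw [interior_Ioc] at hx
    exact hc.deriv_pos x hx

end IsCStar


/-! ### The kernel of the time map: derivatives, bounds and convexity. -/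

/-- The kernel `(1 + x) / √((1 + x)² - 1)` of the Minkowski-curvature time map. -/
noncomputable def kern (x : ℝ) : ℝ := (1 + x) / √(x ^ 2 + 2 * x)

/-- Minus the derivative of `kern`. -/
noncomputable def kernD (x : ℝ) : ℝ := 1 / ((x ^ 2 + 2 * x) * √(x ^ 2 + 2 * x))

/-- The second derivative of `kern`. -/
noncomputable def kernDD (x : ℝ) : ℝ := 3 * (1 + x) / ((x ^ 2 + 2 * x) ^ 2 * √(x ^ 2 + 2 * x))

theorem kern_arg_pos {x : ℝ} (hx : 0 < x) : 0 < x ^ 2 + 2 * x := by positivity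

theorem hasDerivAt_sqrt_kern_arg {x : ℝ} (hx : 0 < x) :
    HasDerivAt (fun y : ℝ => √(y ^ 2 + 2 * y)) ((1 + x) / √(x ^ 2 + 2 * x)) x := by
  have h1 : HasDerivAt (fun y : ℝ => y ^ 2 + 2 * y) (2 * x + 2) x := by
    simpa using (hasDerivAt_pow 2 x).fun_add ((hasDerivAt_id' x).const_mul 2)
  refine HasDerivAt.congr_deriv (h1.sqrt (kern_arg_pos hx).ne') ?_
  have := Real.sqrt_pos.2 (kern_arg_pos hx)
  field_simp
  ring

theorem hasDerivAt_kern {x : ℝ} (hx : 0 < x) : HasDerivAt kern (-kernD x) x := by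
  have hR := Real.sqrt_pos.2 (kern_arg_pos hx)
  have hR2 := Real.sq_sqrt (kern_arg_pos hx).le
  have h1 : HasDerivAt (fun y : ℝ => 1 + y) 1 x := (hasDerivAt_id' x).const_add 1
  refine HasDerivAt.congr_deriv (h1.fun_div (hasDerivAt_sqrt_kern_arg hx) hR.ne') ?_
  unfold kernD
  have hP := kern_arg_pos hx
  set R := √(x ^ 2 + 2 * x) with hRdef
  rw [← hR2]
  field_simp
  nlinarith

theorem hasDerivAt_kernD {x : ℝ} (hx : 0 < x) : HasDerivAt kernD (-kernDD x) x := by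
  have hR := Real.sqrt_pos.2 (kern_arg_pos hx)
  have hR2 := Real.sq_sqrt (kern_arg_pos hx).le
  have hP := kern_arg_pos hx
  have h1 : HasDerivAt (fun y : ℝ => y ^ 2 + 2 * y) (2 * x + 2) x := by
    simpa using (hasDerivAt_pow 2 x).fun_add ((hasDerivAt_id' x).const_mul 2)
  have h2 := (hasDerivAt_const x (1:ℝ)).fun_div (h1.fun_mul (hasDerivAt_sqrt_kern_arg hx))
    (mul_pos hP hR).ne'
  refine HasDerivAt.congr_deriv (h2) ?_
  unfold kernDD
  set R := √(x ^ 2 + 2 * x) with hRdef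
  rw [← hR2]
  field_simp
  ring

theorem kernD_pos {x : ℝ} (hx : 0 < x) : 0 < kernD x := by
  have := kern_arg_pos hx
  have := Real.sqrt_pos.2 this
  unfold kernD; positivity

theorem kernDD_pos {x : ℝ} (hx : 0 < x) : 0 < kernDD x := by
  have := kern_arg_pos hx
  have := Real.sqrt_pos.2 this
  unfold kernDD; positivity

theorem kern_pos {x : ℝ} (hx : 0 < x) : 0 < kern x := by
  have := Real.sqrt_pos.2 (kern_arg_pos hx)
  unfold kern; positivity

theorem continuousOn_kern : ContinuousOn kern (Ioi 0) := fun _ hx =>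
  (hasDerivAt_kern hx).continuousAt.continuousWithinAt

theorem continuousOn_kernD : ContinuousOn kernD (Ioi 0) := fun _ hx =>
  (hasDerivAt_kernD hx).continuousAt.continuousWithinAt

theorem continuousOn_kernDD : ContinuousOn kernDD (Ioi 0) := by
  unfold kernDD
  apply ContinuousOn.div (by fun_prop) (by fun_prop)
  intro x hx
  have := kern_arg_pos hx
  have := Real.sqrt_pos.2 this
  positivity

theorem kern_strictAntiOn : StrictAntiOn kern (Ioi 0) := by
  apply strictAntiOn_of_deriv_neg (convex_Ioi 0) continuousOn_kern
  intro x hx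
  rw [interior_Ioi] at hx
  rw [(hasDerivAt_kern hx).deriv]
  linarith [kernD_pos hx]

theorem kernD_strictAntiOn : StrictAntiOn kernD (Ioi 0) := by
  apply strictAntiOn_of_deriv_neg (convex_Ioi 0) continuousOn_kernD
  intro x hx
  rw [interior_Ioi] at hx
  rw [(hasDerivAt_kernD hx).deriv]
  linarith [kernDD_pos hx]

theorem kern_convexOn : ConvexOn ℝ (Ioi 0) kern := by
  apply MonotoneOn.convexOn_of_deriv (convex_Ioi 0) continuousOn_kern
  · rw [interior_Ioi]; exact fun x hx => (hasDerivAt_kern hx).differentiableAt.differentiableWithinAt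
  · rw [interior_Ioi]
    intro x hx y hy hxy
    rw [(hasDerivAt_kern hx).deriv, (hasDerivAt_kern hy).deriv]
    linarith [kernD_strictAntiOn.antitoneOn hx hy hxy]

theorem kern_tangent {x y : ℝ} (hx : 0 < x) (hy : 0 < y) :
    kern x - kernD x * (y - x) ≤ kern y := by
  have hd := hasDerivAt_kern hx
  rcases lt_trichotomy y x with h | h | h
  · have := kern_convexOn.slope_le_of_hasDerivAt (mem_Ioi.2 hy) (mem_Ioi.2 hx) h hd
    rw [slope_def_field, div_le_iff₀ (by linarith)] at this
    linarith
  · simp [h]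
  · have := kern_convexOn.le_slope_of_hasDerivAt (mem_Ioi.2 hx) (mem_Ioi.2 hy) h hd
    rw [slope_def_field, le_div_iff₀ (by linarith)] at this
    linarith

theorem kern_sq {x : ℝ} (hx : 0 < x) : kern x ^ 2 = 1 + 1 / (x ^ 2 + 2 * x) := by
  have := kern_arg_pos hx
  unfold kern
  rw [div_pow, Real.sq_sqrt this.le]
  field_simp
  ring

theorem one_lt_kern {x : ℝ} (hx : 0 < x) : 1 < kern x := by
  have h := kern_sq hx
  have h2 : 0 < 1 / (x ^ 2 + 2 * x) := one_div_pos.2 (kern_arg_pos hx)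
  nlinarith [kern_pos hx]

theorem le_kern {x : ℝ} (hx : 0 < x) : 1 / √(2 * x) ≤ kern x := by
  have h := kern_sq hx
  have h0 : 0 < √(2 * x) := Real.sqrt_pos.2 (by positivity)
  apply le_of_sq_le_sq _ (kern_pos hx).le
  rw [h, div_pow, Real.sq_sqrt (by positivity), one_pow]
  have hP := kern_arg_pos hx
  rw [div_le_iff₀ (by positivity)]
  have : (1 + 1 / (x ^ 2 + 2 * x)) * (2 * x) - 1 = x * (2 * x + 3) / (x + 2) := by
    field_simp; ring
  have h3 : 0 ≤ x * (2 * x + 3) / (x + 2) := by positivity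
  linarith

theorem kern_le {x : ℝ} (hx : 0 < x) : kern x ≤ 1 + 1 / √(2 * x) := by
  have h := kern_sq hx
  have h0 : 0 < √(2 * x) := Real.sqrt_pos.2 (by positivity)
  apply le_of_sq_le_sq _ (by positivity)
  rw [h, add_sq, div_pow, Real.sq_sqrt (by positivity)]
  have h2 : 1 / (x ^ 2 + 2 * x) ≤ 1 / (2 * x) := by gcongr; nlinarith
  have h3 : 0 ≤ 1 / √(2 * x) := by positivity
  nlinarith

theorem kernD_le {x : ℝ} (hx : 0 < x) : kernD x ≤ 1 / (x * √x) := by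
  unfold kernD
  have := Real.sqrt_pos.2 hx
  apply one_div_le_one_div_of_le (by positivity)
  gcongr <;> nlinarith

theorem kernDD_le {x : ℝ} (hx : 0 < x) : kernDD x ≤ 3 / (x ^ 2 * √x) := by
  unfold kernDD
  have h1 := Real.sqrt_pos.2 hx
  have h2 := Real.sqrt_pos.2 (kern_arg_pos hx)
  have h3 : √x ≤ √(x ^ 2 + 2 * x) := Real.sqrt_le_sqrt (by nlinarith)
  have h4 := kern_arg_pos hx
  rw [div_le_div_iff₀ (by positivity) (by positivity)]
  have h5 : (1 + x) * x ^ 2 ≤ (x ^ 2 + 2 * x) ^ 2 := by nlinarith [pow_pos hx 3, pow_pos hx 4]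
  calc 3 * (1 + x) * (x ^ 2 * √x) = 3 * (((1 + x) * x ^ 2) * √x) := by ring
    _ ≤ 3 * ((x ^ 2 + 2 * x) ^ 2 * √(x ^ 2 + 2 * x)) := by gcongr

theorem kern_eq_kernD_mul {x : ℝ} (hx : 0 < x) :
    kern x = kernD x * ((1 + x) * (x ^ 2 + 2 * x)) := by
  have h2 := Real.sqrt_pos.2 (kern_arg_pos hx)
  have h4 := kern_arg_pos hx
  unfold kern kernD
  field_simp

theorem kernDD_eq_kernD_mul {x : ℝ} (hx : 0 < x) :
    kernDD x = kernD x * (3 * (1 + x) / (x ^ 2 + 2 * x)) := by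
  have h2 := Real.sqrt_pos.2 (kern_arg_pos hx)
  have h4 := kern_arg_pos hx
  unfold kernDD kernD
  field_simp

/-- The square of `c kern(c² w)` is `c² + 1/(w (c² w + 2))`, and the first term gains more than the
second loses. It makes the time map increase with the amplitude whenever the gap divided by `a²`
does not. -/
theorem mul_kern_lt_mul_kern {a b w : ℝ} (ha : 0 < a) (hab : a < b) (hw : 0 < w) :
    a * kern (a ^ 2 * w) < b * kern (b ^ 2 * w) := by
  have hb := ha.trans hab
  have haw : 0 < a ^ 2 * w := by positivity
  have hbw : 0 < b ^ 2 * w := by positivity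
  apply lt_of_pow_lt_pow_left₀ 2 (mul_pos hb (kern_pos hbw)).le
  rw [mul_pow, mul_pow, kern_sq haw, kern_sq hbw]
  have key : ∀ c : ℝ, 0 < c → c ^ 2 * (1 + 1 / ((c ^ 2 * w) ^ 2 + 2 * (c ^ 2 * w))) =
      c ^ 2 + 1 / (w * (c ^ 2 * w + 2)) := by
    intro c hc; field_simp
  rw [key a ha, key b hb]
  have h1 : a ^ 2 < b ^ 2 := by nlinarith
  have h2 : 1 / (w * (a ^ 2 * w + 2)) - 1 / (w * (b ^ 2 * w + 2)) =
      (b ^ 2 - a ^ 2) / ((a ^ 2 * w + 2) * (b ^ 2 * w + 2)) := by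
    field_simp; ring
  have h3 : (b ^ 2 - a ^ 2) / ((a ^ 2 * w + 2) * (b ^ 2 * w + 2)) < b ^ 2 - a ^ 2 := by
    rw [div_lt_iff₀ (by positivity)]
    have : 1 < (a ^ 2 * w + 2) * (b ^ 2 * w + 2) := by nlinarith [mul_pos haw hbw]
    nlinarith
  linarith

theorem mul_kern_lt_of_le {a b w v : ℝ} (ha : 0 < a) (hab : a < b) (hv : 0 < v) (hvw : v ≤ w) :
    a * kern (a ^ 2 * w) < b * kern (b ^ 2 * v) := by
  refine lt_of_le_of_lt ?_ (mul_kern_lt_mul_kern ha hab hv)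
  apply mul_le_mul_of_nonneg_left _ ha.le
  apply kern_strictAntiOn.antitoneOn
  · exact mem_Ioi.2 (by positivity)
  · exact mem_Ioi.2 (mul_pos (by positivity) (hv.trans_le hvw))
  · gcongr

/-- Positivity of the Hessian form of `(w, z) ↦ kern (w / z²) / z`. -/
theorem perspective_hessian_pos {x z a b : ℝ} (hx : 0 < x) (hz : 0 < z) (hb : b ≠ 0) :
    0 < kernDD x * (a / z ^ 2 - 2 * x * b / z) ^ 2 / z -
      kernD x * (-4 * a * b / z ^ 3 + 6 * x * b ^ 2 / z ^ 2) / z +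
      2 * (kernD x * (a / z ^ 2 - 2 * x * b / z) * b / z ^ 2) + 2 * kern x * b ^ 2 / z ^ 3 := by
  have hP := kern_arg_pos hx
  have hk := kernD_pos hx
  rw [kern_eq_kernD_mul hx, kernDD_eq_kernD_mul hx]
  have hb2 : 0 < b ^ 2 := by positivity
  -- In the variables `(e, b)` the form is a quadratic whose completed square leaves a positive
  -- multiple of `27x² + 24x³ + 6x⁴`.
  set e := a / z - 2 * x * b with he
  have ha : a = z * (e + 2 * x * b) := by rw [he]; field_simp; ring
  have : kernD x * (3 * (1 + x) / (x ^ 2 + 2 * x)) * (a / z ^ 2 - 2 * x * b / z) ^ 2 / z -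
      kernD x * (-4 * a * b / z ^ 3 + 6 * x * b ^ 2 / z ^ 2) / z +
      2 * (kernD x * (a / z ^ 2 - 2 * x * b / z) * b / z ^ 2) +
      2 * (kernD x * ((1 + x) * (x ^ 2 + 2 * x))) * b ^ 2 / z ^ 3 =
      kernD x / (z ^ 3 * (x ^ 2 + 2 * x)) * (3 * (1 + x) * e ^ 2 + 6 * (x ^ 2 + 2 * x) * e * b +
        (2 * x + 2 * (1 + x) * (x ^ 2 + 2 * x)) * (x ^ 2 + 2 * x) * b ^ 2) := by
    rw [ha]
    field_simp
    ring
  rw [this]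
  apply mul_pos (by positivity)
  have h1 : 0 < 3 * (1 + x) := by positivity
  have h2 : 3 * (1 + x) * (3 * (1 + x) * e ^ 2 + 6 * (x ^ 2 + 2 * x) * e * b +
        (2 * x + 2 * (1 + x) * (x ^ 2 + 2 * x)) * (x ^ 2 + 2 * x) * b ^ 2) =
      (3 * (1 + x) * e + 3 * (x ^ 2 + 2 * x) * b) ^ 2 +
      ((x ^ 2 + 2 * x) * b ^ 2) * (3 * (1 + x) * (2 * x + 2 * (1 + x) * (x ^ 2 + 2 * x)) -
        9 * (x ^ 2 + 2 * x)) := by ring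
  have h3 : 0 < 3 * (1 + x) * (2 * x + 2 * (1 + x) * (x ^ 2 + 2 * x)) -
        9 * (x ^ 2 + 2 * x) := by
    have : 3 * (1 + x) * (2 * x + 2 * (1 + x) * (x ^ 2 + 2 * x)) - 9 * (x ^ 2 + 2 * x) =
      27 * x ^ 2 + 24 * x ^ 3 + 6 * x ^ 4 := by ring
    rw [this]; positivity
  by_contra hc
  push Not at hc
  have h4 := mul_nonpos_of_nonneg_of_nonpos h1.le hc
  have h5 : 0 < ((x ^ 2 + 2 * x) * b ^ 2) * (3 * (1 + x) * (2 * x + 2 * (1 + x) * (x ^ 2 + 2 * x)) -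
        9 * (x ^ 2 + 2 * x)) := by positivity
  nlinarith [sq_nonneg (3 * (1 + x) * e + 3 * (x ^ 2 + 2 * x) * b)]

/-- The function `(w, z) ↦ kern (w / z²) / z` is convex, strictly so in directions that move `z`. -/
theorem perspective_lt {w₀ w₁ z₀ z₁ p q : ℝ} (hw₀ : 0 < w₀) (hw₁ : 0 < w₁) (hz₀ : 0 < z₀)
    (hz₁ : 0 < z₁) (hz : z₀ ≠ z₁) (hp : 0 < p) (hq : 0 < q) (hpq : p + q = 1) :
    kern ((p * w₀ + q * w₁) / (p * z₀ + q * z₁) ^ 2) / (p * z₀ + q * z₁) <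
      p * (kern (w₀ / z₀ ^ 2) / z₀) + q * (kern (w₁ / z₁ ^ 2) / z₁) := by
  set a := w₁ - w₀ with ha
  set b := z₁ - z₀ with hb
  have hb0 : b ≠ 0 := sub_ne_zero.2 hz.symm
  -- Strict convexity is checked along the segment from `(w₀, z₀)` to `(w₁, z₁)` through the second
  -- derivative.
  let w : ℝ → ℝ := fun t => w₀ + t * a
  let z : ℝ → ℝ := fun t => z₀ + t * b
  have hwpos : ∀ t ∈ Icc (0:ℝ) 1, 0 < w t := by
    intro t ht
    have : w t = (1 - t) * w₀ + t * w₁ := by simp only [w, ha]; ring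
    rw [this]
    rcases eq_or_lt_of_le ht.1 with h | h
    · rw [← h]; simpa using hw₀
    · have := mul_nonneg (sub_nonneg.2 ht.2) hw₀.le
      have := mul_pos h hw₁
      linarith
  have hzpos : ∀ t ∈ Icc (0:ℝ) 1, 0 < z t := by
    intro t ht
    have : z t = (1 - t) * z₀ + t * z₁ := by simp only [z, hb]; ring
    rw [this]
    rcases eq_or_lt_of_le ht.1 with h | h
    · rw [← h]; simpa using hz₀
    · have := mul_nonneg (sub_nonneg.2 ht.2) hz₀.le
      have := mul_pos h hz₁
      linarith
  have hdw : ∀ t, HasDerivAt w a t := fun t =>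
    (((hasDerivAt_id' t).mul_const a).const_add w₀).congr_deriv (one_mul a)
  have hdz : ∀ t, HasDerivAt z b t := fun t =>
    (((hasDerivAt_id' t).mul_const b).const_add z₀).congr_deriv (one_mul b)
  let j : ℝ → ℝ := fun t => kern (w t / z t ^ 2) / z t
  let j' : ℝ → ℝ := fun t => -kernD (w t / z t ^ 2) * (a / z t ^ 2 - 2 * (w t * b) / z t ^ 3) / z t
    - kern (w t / z t ^ 2) * b / z t ^ 2
  have hΔ : ∀ t ∈ Icc (0:ℝ) 1,
      HasDerivAt (fun t => w t / z t ^ 2) (a / z t ^ 2 - 2 * (w t * b) / z t ^ 3) t := by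
    intro t ht
    have hzt := hzpos t ht
    refine HasDerivAt.congr_deriv ((hdw t).fun_div ((hdz t).fun_pow 2) (by positivity)) ?_
    simp only [Nat.cast_ofNat]
    field_simp
    norm_num
    ring
  have hΔpos : ∀ t ∈ Icc (0:ℝ) 1, 0 < w t / z t ^ 2 := fun t ht =>
    div_pos (hwpos t ht) (pow_pos (hzpos t ht) 2)
  have hj : ∀ t ∈ Icc (0:ℝ) 1, HasDerivAt j (j' t) t := by
    intro t ht
    have hzt := hzpos t ht
    have h := ((hasDerivAt_kern (hΔpos t ht)).comp t (hΔ t ht)).fun_div (hdz t) hzt.ne'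
    refine h.congr_deriv ?_
    simp only [j', Function.comp]
    field_simp
  have hΔ' : ∀ t ∈ Icc (0:ℝ) 1,
      HasDerivAt (fun t => a / z t ^ 2 - 2 * (w t * b) / z t ^ 3)
        (-4 * a * b / z t ^ 3 + 6 * (w t * b ^ 2) / z t ^ 4) t := by
    intro t ht
    have hzt := hzpos t ht
    refine HasDerivAt.congr_deriv (((hasDerivAt_const t a).fun_div ((hdz t).fun_pow 2) (by positivity)).fun_sub
      ((((hdw t).mul_const b).const_mul 2).fun_div ((hdz t).fun_pow 3) (by positivity))) ?_
    simp only [Nat.cast_ofNat]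
    field_simp
    ring
  have hj' : ∀ t ∈ Icc (0:ℝ) 1, ∃ y, HasDerivAt j' y t ∧ 0 < y := by
    intro t ht
    have hzt := hzpos t ht
    have hk := (hasDerivAt_kern (hΔpos t ht)).comp t (hΔ t ht)
    have hk' := (hasDerivAt_kernD (hΔpos t ht)).comp t (hΔ t ht)
    have h := (((hk'.fun_neg).fun_mul (hΔ' t ht)).fun_div (hdz t) hzt.ne').fun_sub
      ((hk.mul_const b).fun_div ((hdz t).fun_pow 2) (by positivity))
    refine ⟨_, h, ?_⟩
    have hpos := perspective_hessian_pos (a := a) (hΔpos t ht) hzt hb0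
    convert hpos using 1
    simp only [Nat.cast_ofNat, Function.comp]
    field_simp
    ring
  have hconv : StrictConvexOn ℝ (Icc 0 1) j := by
    apply StrictMonoOn.strictConvexOn_of_deriv (convex_Icc 0 1)
    · exact fun t ht => (hj t ht).continuousAt.continuousWithinAt
    · have hm : StrictMonoOn j' (Icc 0 1) := by
        apply strictMonoOn_of_deriv_pos (convex_Icc 0 1)
        · intro t ht
          obtain ⟨y, hy, -⟩ := hj' t ht
          exact hy.continuousAt.continuousWithinAt
        · intro t ht
          obtain ⟨y, hy, hy0⟩ := hj' t (interior_subset ht)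
          rwa [hy.deriv]
      intro s hs t ht hst
      rw [(hj s (interior_subset hs)).deriv, (hj t (interior_subset ht)).deriv]
      exact hm (interior_subset hs) (interior_subset ht) hst
  have h := hconv.2 (left_mem_Icc.2 zero_le_one) (right_mem_Icc.2 zero_le_one) zero_ne_one hp hq hpq
  have e1 : w q = p * w₀ + q * w₁ := by
    have : p = 1 - q := by linarith
    simp only [w, ha, this]; ring
  have e2 : z q = p * z₀ + q * z₁ := by
    have : p = 1 - q := by linarith
    simp only [z, hb, this]; ring
  have e3 : w 0 = w₀ := by simp [w]
  have e4 : z 0 = z₀ := by simp [z]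
  have e5 : w 1 = w₁ := by simp [w, ha]
  have e6 : z 1 = z₁ := by simp [z, hb]
  simp only [smul_eq_mul, mul_zero, mul_one, zero_add, j, e1, e2, e3, e4, e5, e6] at h
  exact h

/-! Two elementary singular integrals. -/

theorem hasDerivAt_arcsin_two_mul_sub {s : ℝ} (hs : s ∈ Ioo (0:ℝ) 1) :
    HasDerivAt (fun s : ℝ => Real.arcsin (2 * s - 1)) (1 / √(s * (1 - s))) s := by
  have h1 := Real.hasDerivAt_arcsin (x := 2 * s - 1) (by linarith [hs.1]) (by linarith [hs.2])
  have h2 : HasDerivAt (fun s : ℝ => 2 * s - 1) 2 s := by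
    simpa using ((hasDerivAt_id' s).const_mul 2).sub_const 1
  have h := h1.comp s h2
  refine h.congr_deriv ?_
  have h3 : 1 - (2 * s - 1) ^ 2 = 2 ^ 2 * (s * (1 - s)) := by ring
  rw [h3, Real.sqrt_mul (by norm_num), Real.sqrt_sq (by norm_num)]
  have : 0 < √(s * (1 - s)) := Real.sqrt_pos.2 (mul_pos hs.1 (by linarith [hs.2]))
  field_simp

theorem integrableOn_one_div_sqrt_mul :
    MeasureTheory.IntegrableOn (fun s : ℝ => 1 / √(s * (1 - s))) (Ioo 0 1) := by
  have := intervalIntegral.integrableOn_deriv_of_nonneg (a := 0) (b := 1)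
    (g := fun s : ℝ => Real.arcsin (2 * s - 1)) (g' := fun s : ℝ => 1 / √(s * (1 - s)))
    (Real.continuous_arcsin.comp (by fun_prop)).continuousOn
    (fun s hs => hasDerivAt_arcsin_two_mul_sub hs) (fun s _ => by positivity)
  exact this.mono_set Ioo_subset_Ioc_self

theorem integral_one_div_sqrt_mul :
    ∫ s in Ioo (0:ℝ) 1, 1 / √(s * (1 - s)) = Real.pi := by
  rw [← MeasureTheory.integral_Ioc_eq_integral_Ioo, ← intervalIntegral.integral_of_le zero_le_one,
    intervalIntegral.integral_eq_sub_of_hasDerivAt_of_le zero_le_one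
      (f := fun s : ℝ => Real.arcsin (2 * s - 1))
      (Real.continuous_arcsin.comp (by fun_prop)).continuousOn
      (fun s hs => hasDerivAt_arcsin_two_mul_sub hs)]
  · norm_num [Real.arcsin_one, Real.arcsin_neg_one]
  · rw [intervalIntegrable_iff_integrableOn_Ioo_of_le zero_le_one]
    exact integrableOn_one_div_sqrt_mul

theorem hasDerivAt_arcsin_Ioo {s : ℝ} (hs : s ∈ Ioo (0:ℝ) 1) :
    HasDerivAt Real.arcsin (1 / √(1 - s ^ 2)) s :=
  Real.hasDerivAt_arcsin (by linarith [hs.1]) (by linarith [hs.2])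

theorem integrableOn_one_div_sqrt_one_sub_sq :
    MeasureTheory.IntegrableOn (fun s : ℝ => 1 / √(1 - s ^ 2)) (Ioo 0 1) := by
  have := intervalIntegral.integrableOn_deriv_of_nonneg (a := 0) (b := 1)
    (g := Real.arcsin) (g' := fun s : ℝ => 1 / √(1 - s ^ 2))
    Real.continuous_arcsin.continuousOn
    (fun s hs => hasDerivAt_arcsin_Ioo hs) (fun s _ => by positivity)
  exact this.mono_set Ioo_subset_Ioc_self

theorem integral_one_div_sqrt_one_sub_sq :
    ∫ s in Ioo (0:ℝ) 1, 1 / √(1 - s ^ 2) = Real.pi / 2 := by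
  rw [← MeasureTheory.integral_Ioc_eq_integral_Ioo, ← intervalIntegral.integral_of_le zero_le_one,
    intervalIntegral.integral_eq_sub_of_hasDerivAt_of_le zero_le_one
      Real.continuous_arcsin.continuousOn (fun s hs => hasDerivAt_arcsin_Ioo hs)]
  · norm_num [Real.arcsin_one]
  · rw [intervalIntegrable_iff_integrableOn_Ioo_of_le zero_le_one]
    exact integrableOn_one_div_sqrt_one_sub_sq

theorem setIntegral_Ioo_lt {f h : ℝ → ℝ}
    (hf : MeasureTheory.IntegrableOn f (Ioo (0:ℝ) 1))
    (hh : MeasureTheory.IntegrableOn h (Ioo (0:ℝ) 1)) (hlt : ∀ s ∈ Ioo (0:ℝ) 1, f s < h s) :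
    ∫ s in Ioo (0:ℝ) 1, f s < ∫ s in Ioo (0:ℝ) 1, h s := by
  rw [← sub_pos, ← MeasureTheory.integral_sub hh hf,
    ← MeasureTheory.integral_Ioc_eq_integral_Ioo, ← intervalIntegral.integral_of_le zero_le_one]
  apply intervalIntegral.intervalIntegral_pos_of_pos_on
  · rw [intervalIntegrable_iff_integrableOn_Ioo_of_le zero_le_one]
    exact hh.sub hf
  · exact fun s hs => sub_pos.2 (hlt s hs)
  · exact zero_lt_one


/-! ### The gap, admissible maxima and the time map. -/

/-- `F_{m,l}(a) - F_{m,l}(a s)`. -/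
noncomputable def gap (g : ℝ → ℝ) (l m a s : ℝ) : ℝ :=
  l * (primG g a - primG g (a * s)) - m * (a * (1 - s))

/-- The time map: half of the length of the interval on which the solution with maximum `a` of the
autonomous equation is positive. -/
noncomputable def timeMap (g : ℝ → ℝ) (l m a : ℝ) : ℝ := ∫ s in Ioo (0:ℝ) 1, a * kern (gap g l m a s)

/-- `a` is an admissible maximum of a positive solution for the parameters `l`, `m`. -/
structure Adm (g : ℝ → ℝ) (σ l m a : ℝ) : Prop where
  l_pos : 0 < l
  mem : a ∈ Ioo 0 σ
  primF_nonneg : 0 ≤ primF g m l a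
  reaction_pos : 0 < reaction g m l a

section

variable {g : ℝ → ℝ} {σ l m a : ℝ}

theorem le_gap (hg : IsLogisticGrowth g σ) (hl : 0 ≤ l) (ha : a ∈ Ioc 0 σ) {s : ℝ}
    (hs : s ∈ Icc (0:ℝ) 1) :
    (1 - s) * ((1 - s) * primF g m l a + s * (a * reaction g m l a)) ≤ gap g l m a s := by
  have := mul_le_mul_of_nonneg_left (hg.primG_sub_lower ha hs) hl
  unfold gap primF reaction
  nlinarith

theorem gap_le (hg : IsLogisticGrowth g σ) (hl : 0 ≤ l) (ha : a ∈ Ioo 0 σ) {s : ℝ}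
    (hs : s ∈ Icc (0:ℝ) 1) :
    gap g l m a s ≤ a * (1 - s) * (reaction g m l a + l * |deriv g a| * (a * (1 - s))) := by
  have := mul_le_mul_of_nonneg_left (hg.primG_sub_upper ha hs) hl
  unfold gap reaction
  nlinarith

theorem continuousOn_gap (hg : IsLogisticGrowth g σ) (ha : 0 ≤ a) :
    ContinuousOn (gap g l m a) (Ici 0) := by
  unfold gap
  apply ContinuousOn.sub
  · apply continuousOn_const.mul
    apply continuousOn_const.sub
    exact hg.continuousOn_primG.comp (by fun_prop) fun s hs => mul_nonneg ha hs
  · fun_prop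

namespace Adm

theorem mem' (h : Adm g σ l m a) : a ∈ Ioc 0 σ := ⟨h.mem.1, h.mem.2.le⟩

theorem mul_reaction_pos (h : Adm g σ l m a) : 0 < a * reaction g m l a :=
  mul_pos h.mem.1 h.reaction_pos

/-- This weaker bound survives `F(a) = 0`, where the gap vanishes at `s = 0` as well as at `s = 1`.
It makes the integrand at most of order `1/√(s(1 - s))`, which is integrable. -/
theorem le_gap (h : Adm g σ l m a) (hg : IsLogisticGrowth g σ) {s : ℝ} (hs : s ∈ Icc (0:ℝ) 1) :
    s * (1 - s) * (a * reaction g m l a) ≤ gap g l m a s := by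
  refine le_trans ?_ (_root_.le_gap hg h.l_pos.le h.mem' hs)
  have := mul_nonneg (mul_nonneg (sub_nonneg.2 hs.2) (sub_nonneg.2 hs.2)) h.primF_nonneg
  linarith

theorem gap_pos (h : Adm g σ l m a) (hg : IsLogisticGrowth g σ) {s : ℝ} (hs : s ∈ Ioo (0:ℝ) 1) :
    0 < gap g l m a s :=
  lt_of_lt_of_le (mul_pos (mul_pos hs.1 (sub_pos.2 hs.2)) h.mul_reaction_pos)
    (h.le_gap hg ⟨hs.1.le, hs.2.le⟩)

theorem kern_gap_le (h : Adm g σ l m a) (hg : IsLogisticGrowth g σ) {e : ℝ} (he : 0 < e)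
    (hle : e ≤ 2 * (a * reaction g m l a)) {s : ℝ} (hs : s ∈ Ioo (0:ℝ) 1) :
    kern (gap g l m a s) ≤ 1 + 1 / √e * (1 / √(s * (1 - s))) := by
  refine (kern_le (h.gap_pos hg hs)).trans ?_
  have hs' : 0 < s * (1 - s) := mul_pos hs.1 (sub_pos.2 hs.2)
  rw [one_div_mul_one_div, ← Real.sqrt_mul he.le]
  have h1 := h.le_gap hg ⟨hs.1.le, hs.2.le⟩
  have h2 := mul_le_mul_of_nonneg_left hle hs'.le
  have h3 : 0 < e * (s * (1 - s)) := mul_pos he hs'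
  exact add_le_add le_rfl (one_div_le_one_div_of_le (Real.sqrt_pos.2 h3)
    (Real.sqrt_le_sqrt (by linarith)))

theorem continuousOn_kern_gap (h : Adm g σ l m a) (hg : IsLogisticGrowth g σ) :
    ContinuousOn (fun s => a * kern (gap g l m a s)) (Ioo 0 1) :=
  continuousOn_const.mul (continuousOn_kern.comp
    ((continuousOn_gap hg h.mem.1.le).mono fun _ hs => hs.1.le) fun _ hs => h.gap_pos hg hs)

theorem integrableOn (h : Adm g σ l m a) (hg : IsLogisticGrowth g σ) :
    MeasureTheory.IntegrableOn (fun s => a * kern (gap g l m a s)) (Ioo 0 1) := by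
  have hb : MeasureTheory.IntegrableOn (fun s : ℝ =>
      a * (1 + 1 / √(2 * (a * reaction g m l a)) * (1 / √(s * (1 - s))))) (Ioo 0 1) :=
    ((MeasureTheory.integrable_const _).add (integrableOn_one_div_sqrt_mul.const_mul _)).const_mul _
  refine hb.mono' ((h.continuousOn_kern_gap hg).aestronglyMeasurable measurableSet_Ioo) ?_
  filter_upwards [MeasureTheory.self_mem_ae_restrict measurableSet_Ioo] with s hs
  have h1 := kern_pos (h.gap_pos hg hs)
  rw [Real.norm_of_nonneg (mul_pos h.mem.1 h1).le]
  exact mul_le_mul_of_nonneg_left (h.kern_gap_le hg (by linarith [h.mul_reaction_pos]) le_rfl hs) h.mem.1.le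

theorem timeMap_le (h : Adm g σ l m a) (hg : IsLogisticGrowth g σ) :
    timeMap g l m a ≤ a * (1 + Real.pi / √(2 * (a * reaction g m l a))) := by
  have hb : MeasureTheory.IntegrableOn (fun s : ℝ =>
      a * (1 + 1 / √(2 * (a * reaction g m l a)) * (1 / √(s * (1 - s))))) (Ioo 0 1) :=
    ((MeasureTheory.integrable_const _).add (integrableOn_one_div_sqrt_mul.const_mul _)).const_mul _
  have h1 := MeasureTheory.setIntegral_mono_on (h.integrableOn hg) hb measurableSet_Ioo
    fun s hs => mul_le_mul_of_nonneg_left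
      (h.kern_gap_le hg (by linarith [h.mul_reaction_pos]) le_rfl hs) h.mem.1.le
  refine h1.trans (le_of_eq ?_)
  rw [MeasureTheory.integral_const_mul, MeasureTheory.integral_add
    (MeasureTheory.integrable_const _) (integrableOn_one_div_sqrt_mul.const_mul _),
    MeasureTheory.integral_const_mul, integral_one_div_sqrt_mul]
  rw [MeasureTheory.setIntegral_const]
  simp only [MeasureTheory.measureReal_def, Real.volume_Ioo, sub_zero, ENNReal.ofReal_one,
    ENNReal.toReal_one, one_smul]
  ring

/-- Slopes stay below one, which is `1 < kern`. Consequently every height on the curve is smaller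
than `L`. -/
theorem lt_timeMap (h : Adm g σ l m a) (hg : IsLogisticGrowth g σ) : a < timeMap g l m a := by
  have := setIntegral_Ioo_lt (f := fun _ => a) (h := fun s => a * kern (gap g l m a s))
    (MeasureTheory.integrable_const _) (h.integrableOn hg) fun s hs => by
      have := one_lt_kern (h.gap_pos hg hs)
      nlinarith [h.mem.1]
  simpa [timeMap] using this

theorem mono_l (h : Adm g σ l m a) (hg : IsLogisticGrowth g σ) {l' : ℝ} (hl : l ≤ l') :
    Adm g σ l' m a := by
  refine ⟨h.l_pos.trans_le hl, h.mem, ?_, ?_⟩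
  · have := h.primF_nonneg
    have := mul_le_mul_of_nonneg_right hl (hg.primG_pos h.mem').le
    unfold primF at *; linarith
  · have := h.reaction_pos
    have := mul_le_mul_of_nonneg_right hl (hg.pos h.mem.1 h.mem.2).le
    unfold reaction at *; linarith

theorem anti_m (h : Adm g σ l m a) {m' : ℝ} (hm : m' ≤ m) : Adm g σ l m' a := by
  refine ⟨h.l_pos, h.mem, ?_, ?_⟩
  · have := h.primF_nonneg
    have := mul_le_mul_of_nonneg_right hm h.mem.1.le
    unfold primF at *; linarith
  · have := h.reaction_pos
    unfold reaction at *; linarith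

theorem timeMap_lt_of_gap_lt {l' m' : ℝ} (h : Adm g σ l m a) (h' : Adm g σ l' m' a)
    (hg : IsLogisticGrowth g σ) (hlt : ∀ s ∈ Ioo (0:ℝ) 1, gap g l m a s < gap g l' m' a s) :
    timeMap g l' m' a < timeMap g l m a := by
  apply setIntegral_Ioo_lt (h'.integrableOn hg) (h.integrableOn hg)
  intro s hs
  apply mul_lt_mul_of_pos_left _ h.mem.1
  exact kern_strictAntiOn (h.gap_pos hg hs) (h'.gap_pos hg hs) (hlt s hs)

theorem timeMap_lt_of_lt_l (h : Adm g σ l m a) (hg : IsLogisticGrowth g σ) {l' : ℝ} (hl : l < l') :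
    timeMap g l' m a < timeMap g l m a := by
  apply h.timeMap_lt_of_gap_lt (h.mono_l hg hl.le) hg
  intro s hs
  have := mul_lt_mul_of_pos_right hl (hg.primG_sub_pos h.mem' ⟨hs.1.le, hs.2⟩)
  unfold gap; linarith

theorem timeMap_le_of_le_l (h : Adm g σ l m a) (hg : IsLogisticGrowth g σ) {l' : ℝ} (hl : l ≤ l') :
    timeMap g l' m a ≤ timeMap g l m a := by
  rcases eq_or_lt_of_le hl with rfl | hl
  · exact le_rfl
  · exact (h.timeMap_lt_of_lt_l hg hl).le

theorem timeMap_lt_of_lt_m (h : Adm g σ l m a) (hg : IsLogisticGrowth g σ) {m' : ℝ} (hm : m' < m) :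
    timeMap g l m' a < timeMap g l m a := by
  apply h.timeMap_lt_of_gap_lt (h.anti_m hm.le) hg
  intro s hs
  have := mul_lt_mul_of_pos_right hm (mul_pos h.mem.1 (sub_pos.2 hs.2))
  unfold gap; linarith

/-- For fixed `m` and `a` the time map is injective in `l`. -/
theorem l_eq_of_timeMap_eq {l' : ℝ} (h : Adm g σ l m a) (h' : Adm g σ l' m a)
    (hg : IsLogisticGrowth g σ) (heq : timeMap g l m a = timeMap g l' m a) : l = l' := by
  rcases lt_trichotomy l l' with hl | hl | hl
  · linarith [h.timeMap_lt_of_lt_l hg hl]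
  · exact hl
  · linarith [h'.timeMap_lt_of_lt_l hg hl]

/-- A logarithmic lower bound, which forces `reaction` to stay away from zero on level sets. -/
theorem log_le_timeMap (h : Adm g σ l m a) (hg : IsLogisticGrowth g σ) {e C : ℝ} (he : 0 < e)
    (hr : reaction g m l a ≤ e) (hC : l * |deriv g a| * a ≤ C) :
    √(a / (2 * (1 + C))) * Real.log (1 + 1 / e) ≤ timeMap g l m a := by
  have hC0 : 0 ≤ C := le_trans (mul_nonneg (mul_nonneg h.l_pos.le (abs_nonneg _)) h.mem.1.le) hC
  have hpos : ∀ s ∈ Icc (0:ℝ) 1, 0 < e + 1 - s := fun s hs => by linarith [hs.2]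
  have hder : ∀ s ∈ uIcc (0:ℝ) 1,
      HasDerivAt (fun s => -Real.log (e + 1 - s)) (1 / (e + 1 - s)) s := by
    intro s hs
    rw [uIcc_of_le zero_le_one] at hs
    have h1 : HasDerivAt (fun s : ℝ => e + 1 - s) (-1) s := (hasDerivAt_id' s).const_sub _
    have h2 := (h1.log (hpos s hs).ne').fun_neg
    refine h2.congr_deriv ?_
    have := (hpos s hs).ne'
    field_simp
  have hcont : ContinuousOn (fun s : ℝ => 1 / (e + 1 - s)) (Icc 0 1) :=
    continuousOn_const.div (by fun_prop) fun s hs => (hpos s hs).ne'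
  have hint : IntervalIntegrable (fun s : ℝ => 1 / (e + 1 - s)) MeasureTheory.volume 0 1 := by
    apply ContinuousOn.intervalIntegrable
    rwa [uIcc_of_le zero_le_one]
  have hval := intervalIntegral.integral_eq_sub_of_hasDerivAt hder hint
  have hlog : -Real.log (e + 1 - 1) - -Real.log (e + 1 - 0) = Real.log (1 + 1 / e) := by
    have : 1 + 1 / e = (e + 1) / e := by field_simp
    rw [this, Real.log_div (by positivity) he.ne']
    simp only [add_sub_cancel_right, sub_zero]; ring
  rw [hlog, intervalIntegral.integral_of_le zero_le_one,
    MeasureTheory.integral_Ioc_eq_integral_Ioo] at hval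
  rw [← hval, ← MeasureTheory.integral_const_mul]
  apply MeasureTheory.setIntegral_mono_on _ (h.integrableOn hg) measurableSet_Ioo
  · intro s hs
    have hs0 : 0 < 1 - s := sub_pos.2 hs.2
    have hgp := h.gap_pos hg hs
    have hk := le_kern hgp
    -- The gap is at most quadratic in `e + 1 - s`, so the integrand dominates a multiple of `1/(e +
    -- 1 - s)`, whose integral is `log (1 + 1/e)`.
    have hup : 2 * gap g l m a s ≤ 2 * a * (1 + C) * (e + 1 - s) ^ 2 := by
      have h1 := _root_.gap_le (m := m) hg h.l_pos.le h.mem ⟨hs.1.le, hs.2.le⟩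
      have h2 : reaction g m l a + l * |deriv g a| * (a * (1 - s)) ≤ (1 + C) * (e + 1 - s) := by
        have : l * |deriv g a| * a * (1 - s) ≤ C * (1 - s) :=
          mul_le_mul_of_nonneg_right hC hs0.le
        nlinarith [mul_nonneg hC0 he.le]
      have h3 : 0 ≤ a * (1 - s) := mul_nonneg h.mem.1.le hs0.le
      have h4 := mul_le_mul_of_nonneg_left h2 h3
      have h5 : a * (1 - s) * ((1 + C) * (e + 1 - s)) ≤ a * (e + 1 - s) * ((1 + C) * (e + 1 - s)) := by
        apply mul_le_mul_of_nonneg_right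
        · nlinarith [h.mem.1]
        · have := hpos s ⟨hs.1.le, hs.2.le⟩; positivity
      nlinarith
    have hsq : √(2 * gap g l m a s) ≤ √(2 * a * (1 + C)) * (e + 1 - s) := by
      have := Real.sqrt_le_sqrt hup
      rwa [Real.sqrt_mul (x := 2 * a * (1 + C)) (by have := h.mem.1; positivity),
        Real.sqrt_sq (hpos s ⟨hs.1.le, hs.2.le⟩).le] at this
    have hq : √(a / (2 * (1 + C))) = a / √(2 * a * (1 + C)) := by
      have ha := h.mem.1
      rw [eq_div_iff (by positivity), ← Real.sqrt_mul (by positivity)]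
      have : a / (2 * (1 + C)) * (2 * a * (1 + C)) = a ^ 2 := by field_simp
      rw [this, Real.sqrt_sq ha.le]
    rw [hq, div_mul_div_comm, mul_one, ← mul_one_div]
    apply mul_le_mul_of_nonneg_left _ h.mem.1.le
    refine le_trans ?_ hk
    apply one_div_le_one_div_of_le (Real.sqrt_pos.2 (by positivity)) hsq
  · exact (hcont.integrableOn_Icc.mono_set Ioo_subset_Icc_self).const_mul _

end Adm

/-! Continuity of the time map and closedness of its level sets. -/

variable {ι : Type*} {F : Filter ι} {li mi ai : ι → ℝ}

theorem tendsto_primF (hg : IsLogisticGrowth g σ) (ha : 0 < a) (hli : Tendsto li F (𝓝 l))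
    (hmi : Tendsto mi F (𝓝 m)) (hai : Tendsto ai F (𝓝 a)) :
    Tendsto (fun i => primF g (mi i) (li i) (ai i)) F (𝓝 (primF g m l a)) :=
  (hli.mul ((hg.hasDerivAt_primG ha).continuousAt.tendsto.comp hai)).sub (hmi.mul hai)

theorem tendsto_reaction (hg : IsLogisticGrowth g σ) (ha : 0 < a) (hli : Tendsto li F (𝓝 l))
    (hmi : Tendsto mi F (𝓝 m)) (hai : Tendsto ai F (𝓝 a)) :
    Tendsto (fun i => reaction g (mi i) (li i) (ai i)) F (𝓝 (reaction g m l a)) :=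
  (hli.mul ((hg.continuousAt ha).tendsto.comp hai)).sub hmi

theorem tendsto_gap (hg : IsLogisticGrowth g σ) (ha : 0 < a) {s : ℝ} (hs : 0 < s)
    (hli : Tendsto li F (𝓝 l)) (hmi : Tendsto mi F (𝓝 m)) (hai : Tendsto ai F (𝓝 a)) :
    Tendsto (fun i => gap g (li i) (mi i) (ai i) s) F (𝓝 (gap g l m a s)) := by
  have h1 := (hg.hasDerivAt_primG ha).continuousAt.tendsto.comp hai
  have h2 := (hg.hasDerivAt_primG (mul_pos ha hs)).continuousAt.tendsto.comp (hai.mul_const s)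
  exact (hli.mul (h1.sub h2)).sub (hmi.mul (hai.mul_const (1 - s)))

theorem Adm.eventually (hg : IsLogisticGrowth g σ) (h : Adm g σ l m a) (hF : 0 < primF g m l a)
    (hli : Tendsto li F (𝓝 l)) (hmi : Tendsto mi F (𝓝 m)) (hai : Tendsto ai F (𝓝 a)) :
    ∀ᶠ i in F, Adm g σ (li i) (mi i) (ai i) ∧ 0 < primF g (mi i) (li i) (ai i) := by
  filter_upwards [hli.eventually (lt_mem_nhds h.l_pos), hai.eventually (Ioo_mem_nhds h.mem.1 h.mem.2),
    (tendsto_primF hg h.mem.1 hli hmi hai).eventually (lt_mem_nhds hF),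
    (tendsto_reaction hg h.mem.1 hli hmi hai).eventually (lt_mem_nhds h.reaction_pos)]
    with i h1 h2 h3 h4 using ⟨⟨h1, h2, h3.le, h4⟩, h3⟩

theorem Adm.tendsto_timeMap_aux [F.IsCountablyGenerated] (hg : IsLogisticGrowth g σ)
    (h : Adm g σ l m a) (hli : Tendsto li F (𝓝 l)) (hmi : Tendsto mi F (𝓝 m))
    (hai : Tendsto ai F (𝓝 a)) (hi : ∀ᶠ i in F, Adm g σ (li i) (mi i) (ai i)) :
    Tendsto (fun i => timeMap g (li i) (mi i) (ai i)) F (𝓝 (timeMap g l m a)) := by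
  have hprod : Tendsto (fun i => ai i * reaction g (mi i) (li i) (ai i)) F
      (𝓝 (a * reaction g m l a)) := hai.mul (tendsto_reaction hg h.mem.1 hli hmi hai)
  have hev := hprod.eventually (lt_mem_nhds (half_lt_self h.mul_reaction_pos))
  apply MeasureTheory.tendsto_integral_filter_of_dominated_convergence
    (bound := fun s : ℝ => σ * (1 + 1 / √(a * reaction g m l a) * (1 / √(s * (1 - s)))))
  · filter_upwards [hi] with i hi
    exact (hi.continuousOn_kern_gap hg).aestronglyMeasurable measurableSet_Ioo
  · filter_upwards [hi, hev] with i hi hev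
    filter_upwards [MeasureTheory.self_mem_ae_restrict measurableSet_Ioo] with s hs
    have h1 := kern_pos (hi.gap_pos hg hs)
    rw [Real.norm_of_nonneg (mul_pos hi.mem.1 h1).le]
    exact mul_le_mul hi.mem.2.le (hi.kern_gap_le hg h.mul_reaction_pos (by linarith) hs) h1.le hg.sigma_pos.le
  · exact ((MeasureTheory.integrable_const _).add
      (integrableOn_one_div_sqrt_mul.const_mul _)).const_mul _
  · filter_upwards [MeasureTheory.self_mem_ae_restrict measurableSet_Ioo] with s hs
    exact hai.mul ((hasDerivAt_kern (h.gap_pos hg hs)).continuousAt.tendsto.comp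
      (tendsto_gap hg h.mem.1 hs.1 hli hmi hai))

/-- Dominated convergence needs a countably generated filter. Passing through the neighbourhood
filter of `(l, m, a)` within the admissible set removes this restriction, so that ultrafilters are
allowed. -/
theorem Adm.tendsto_timeMap (hg : IsLogisticGrowth g σ)
    (h : Adm g σ l m a) (hli : Tendsto li F (𝓝 l)) (hmi : Tendsto mi F (𝓝 m))
    (hai : Tendsto ai F (𝓝 a)) (hi : ∀ᶠ i in F, Adm g σ (li i) (mi i) (ai i)) :
    Tendsto (fun i => timeMap g (li i) (mi i) (ai i)) F (𝓝 (timeMap g l m a)) := by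
  let S : Set (ℝ × ℝ × ℝ) := {p | Adm g σ p.1 p.2.1 p.2.2}
  have ht : Tendsto (fun i => (li i, mi i, ai i)) F (𝓝[S] (l, m, a)) :=
    tendsto_nhdsWithin_iff.2 ⟨hli.prodMk_nhds (hmi.prodMk_nhds hai), hi⟩
  have hid : Tendsto (fun p : ℝ × ℝ × ℝ => p) (𝓝[S] (l, m, a)) (𝓝 (l, m, a)) :=
    tendsto_id.mono_left nhdsWithin_le_nhds
  have h1 : Tendsto (fun p : ℝ × ℝ × ℝ => timeMap g p.1 p.2.1 p.2.2) (𝓝[S] (l, m, a))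
      (𝓝 (timeMap g l m a)) :=
    h.tendsto_timeMap_aux hg hid.fst_nhds hid.snd_nhds.fst_nhds hid.snd_nhds.snd_nhds
      self_mem_nhdsWithin
  exact h1.comp ht

/-- The pattern behind most continuity statements below: trap a family in a compact set, then
identify each limit along an ultrafilter by a uniqueness property. -/
theorem IsCompact.tendsto_nhds_of_unique_ultrafilter {X : Type*} [TopologicalSpace X] {K : Set X}
    (hK : IsCompact K) {f : ι → X} {y : X} (hmem : ∀ᶠ i in F, f i ∈ K)
    (h : ∀ U : Ultrafilter ι, ↑U ≤ F → ∀ x ∈ K, Tendsto f U (𝓝 x) → x = y) :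
    Tendsto f F (𝓝 y) := by
  apply hK.tendsto_nhds_of_unique_mapClusterPt hmem
  intro x hx hcl
  obtain ⟨U, hU, hUx⟩ := mapClusterPt_iff_ultrafilter.1 hcl
  exact h U hU x hx hUx

/-- Limits of admissible points with bounded time map are admissible. -/
theorem Adm.of_tendsto [F.NeBot] (hg : IsLogisticGrowth g σ) (hl : 0 < l) (ha : a ∈ Ioo 0 σ)
    (hli : Tendsto li F (𝓝 l)) (hmi : Tendsto mi F (𝓝 m))
    (hai : Tendsto ai F (𝓝 a)) (hi : ∀ᶠ i in F, Adm g σ (li i) (mi i) (ai i)) {B : ℝ}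
    (hB : ∀ᶠ i in F, timeMap g (li i) (mi i) (ai i) ≤ B) : Adm g σ l m a := by
  have hF : 0 ≤ primF g m l a :=
    ge_of_tendsto (tendsto_primF hg ha.1 hli hmi hai) (hi.mono fun i h => h.primF_nonneg)
  have hr := tendsto_reaction hg ha.1 hli hmi hai
  have hr0 : 0 ≤ reaction g m l a := ge_of_tendsto hr (hi.mono fun i h => h.reaction_pos.le)
  -- If the reaction vanished in the limit, the logarithmic lower bound would exceed `B`.
  refine ⟨hl, ha, hF, lt_of_le_of_ne hr0 fun h0 => ?_⟩
  rw [← h0] at hr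
  set C := l * |deriv g a| * a + 1 with hCdef
  have hCt : Tendsto (fun i => li i * |deriv g (ai i)| * ai i) F (𝓝 (l * |deriv g a| * a)) := by
    have hd : ContinuousAt (deriv g) a := hg.continuousOn_deriv.continuousAt (Ioi_mem_nhds ha.1)
    exact (hli.mul (hd.tendsto.comp hai).abs).mul hai
  have hC := hCt.eventually (gt_mem_nhds (show l * |deriv g a| * a < C by linarith))
  have hC0 : 0 ≤ C := by
    have := mul_nonneg (mul_nonneg hl.le (abs_nonneg (deriv g a))) ha.1.le
    linarith
  have hc : 0 < √(a / 2 / (2 * (1 + C))) := Real.sqrt_pos.2 (by have := ha.1; positivity)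
  obtain ⟨e, he0, he⟩ : ∃ e : ℝ, 0 < e ∧
      B < √(a / 2 / (2 * (1 + C))) * Real.log (1 + 1 / e) := by
    have h1 : Tendsto (fun x : ℝ => √(a / 2 / (2 * (1 + C))) * Real.log (1 + x)) atTop atTop :=
      (Real.tendsto_log_atTop.comp (tendsto_atTop_add_const_left _ 1 tendsto_id)).const_mul_atTop hc
    obtain ⟨x, hx1, hx2⟩ := ((h1.eventually_gt_atTop B).and (eventually_gt_atTop 0)).exists
    exact ⟨1 / x, by positivity, by simpa using hx1⟩
  have hev : ∀ᶠ i in F, False := by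
    filter_upwards [hi, hB, hC, hr.eventually (gt_mem_nhds he0),
      hai.eventually (lt_mem_nhds (half_lt_self ha.1))] with i h1 h2 h3 h4 h5
    have h6 := h1.log_le_timeMap hg he0 h4.le h3.le
    have h7 : √(a / 2 / (2 * (1 + C))) ≤ √(ai i / (2 * (1 + C))) := by
      apply Real.sqrt_le_sqrt; gcongr
    have h8 : 0 ≤ Real.log (1 + 1 / e) := Real.log_nonneg (by
      have : 0 < 1 / e := by positivity
      linarith)
    have := mul_le_mul_of_nonneg_right h7 h8
    linarith
  exact hev.exists.elim fun _ h => h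

end


/-! ### From positive solutions to the time map. -/

section

variable {g : ℝ → ℝ} {σ l m a L : ℝ}

/-- The time needed by the solution with maximum `a` to descend to the level `a s`. -/
noncomputable def tailTime (g : ℝ → ℝ) (l m a s : ℝ) : ℝ := ∫ t in s..1, a * kern (gap g l m a t)

theorem gap_one : gap g l m a 1 = 0 := by simp [gap]

theorem tailTime_one : tailTime g l m a 1 = 0 := by simp [tailTime]

theorem tailTime_zero : tailTime g l m a 0 = timeMap g l m a := by
  unfold tailTime timeMap
  rw [intervalIntegral.integral_of_le zero_le_one, MeasureTheory.integral_Ioc_eq_integral_Ioo]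

theorem gap_eq (ha : a ≠ 0) (v : ℝ) : gap g l m a (v / a) = primF g m l a - primF g m l v := by
  unfold gap primF
  rw [mul_div_cancel₀ _ ha]
  field_simp
  ring

namespace Adm

theorem intervalIntegrable (h : Adm g σ l m a) (hg : IsLogisticGrowth g σ) :
    IntervalIntegrable (fun s => a * kern (gap g l m a s)) MeasureTheory.volume 0 1 := by
  rw [intervalIntegrable_iff_integrableOn_Ioo_of_le zero_le_one]
  exact h.integrableOn hg

theorem continuousOn_tailTime (h : Adm g σ l m a) (hg : IsLogisticGrowth g σ) :
    ContinuousOn (tailTime g l m a) (Icc 0 1) := by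
  have h1 := intervalIntegral.continuousOn_primitive_interval_left
    (μ := MeasureTheory.volume) (f := fun s => a * kern (gap g l m a s)) (a := 0) (b := 1)
    (by rw [uIcc_of_le zero_le_one, integrableOn_Icc_iff_integrableOn_Ioo]
        exact h.integrableOn hg)
  rwa [uIcc_of_le zero_le_one] at h1

theorem hasDerivAt_tailTime (h : Adm g σ l m a) (hg : IsLogisticGrowth g σ) {s : ℝ}
    (hs : s ∈ Ioo (0:ℝ) 1) :
    HasDerivAt (tailTime g l m a) (-(a * kern (gap g l m a s))) s := by
  have hc := h.continuousOn_kern_gap hg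
  apply intervalIntegral.integral_hasDerivAt_left
  · apply (h.intervalIntegrable hg).mono_set
    rw [uIcc_of_le zero_le_one, uIcc_of_le hs.2.le]
    exact Icc_subset_Icc_left hs.1.le
  · exact hc.stronglyMeasurableAtFilter isOpen_Ioo s hs
  · exact hc.continuousAt (Ioo_mem_nhds hs.1 hs.2)

theorem tailTime_strictAntiOn (h : Adm g σ l m a) (hg : IsLogisticGrowth g σ) :
    StrictAntiOn (tailTime g l m a) (Icc 0 1) := by
  apply strictAntiOn_of_deriv_neg (convex_Icc 0 1) (h.continuousOn_tailTime hg)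
  intro s hs
  rw [interior_Icc] at hs
  rw [(h.hasDerivAt_tailTime hg hs).deriv]
  linarith [mul_pos h.mem.1 (kern_pos (h.gap_pos hg hs))]

end Adm

/-! From solutions to the time map. -/

theorem hasDerivAt_primF (hg : IsLogisticGrowth g σ) {v : ℝ} (hv : 0 < v) :
    HasDerivAt (primF g m l) (reaction g m l v) v := by
  have := ((hg.hasDerivAt_primG hv).const_mul l).fun_sub ((hasDerivAt_id' v).const_mul m)
  rw [mul_one] at this
  exact this

namespace IsPositiveSolution

variable {u : ℝ → ℝ}

theorem hasDerivAt (hu : IsPositiveSolution g L l m u) {x : ℝ} (hx : x ∈ Ioo (-L) L) :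
    HasDerivAt u (deriv u x) x :=
  ((hu.contDiffOn.contDiffAt (Ioo_mem_nhds hx.1 hx.2)).differentiableAt (by norm_num)).hasDerivAt

theorem one_sub_sq_pos (hu : IsPositiveSolution g L l m u) {x : ℝ} (hx : x ∈ Ioo (-L) L) :
    0 < 1 - (deriv u x) ^ 2 := by
  have := hu.slope_lt_one x hx
  have := sq_lt_one_iff_abs_lt_one (deriv u x) |>.2 this
  linarith

/-- The energy `1/√(1 - u'²) + F(u)` is conserved. -/
theorem energy_eq (hu : IsPositiveSolution g L l m u) (hg : IsLogisticGrowth g σ) {x y : ℝ}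
    (hx : x ∈ Ioo (-L) L) (hy : y ∈ Ioo (-L) L) :
    1 / √(1 - (deriv u x) ^ 2) + primF g m l (u x) =
      1 / √(1 - (deriv u y) ^ 2) + primF g m l (u y) := by
  -- The equation supplies `q'` directly, and `√(1 + q²)` is the kinetic part `1/√(1 - u'²)` of the
  -- energy.
  let q : ℝ → ℝ := fun y => -(deriv u y / √(1 - (deriv u y) ^ 2))
  have hq : ∀ x ∈ Ioo (-L) L, √(1 + q x ^ 2) = 1 / √(1 - (deriv u x) ^ 2) := by
    intro x hx
    have h0 := hu.one_sub_sq_pos hx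
    have h1 := Real.sqrt_pos.2 h0
    have : 1 + q x ^ 2 = (1 / √(1 - (deriv u x) ^ 2)) ^ 2 := by
      simp only [q]
      rw [neg_sq, div_pow, div_pow, Real.sq_sqrt h0.le]
      field_simp
      ring
    rw [this, Real.sqrt_sq (by positivity)]
  have hE : ∀ x ∈ Ioo (-L) L,
      HasDerivAt (fun x => √(1 + q x ^ 2) + primF g m l (u x)) 0 x := by
    intro x hx
    have h0 := hu.one_sub_sq_pos hx
    have h1 := Real.sqrt_pos.2 h0
    have h2 : HasDerivAt q (l * g (u x) - m) x := hu.equation x hx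
    have h3 := ((h2.fun_pow 2).const_add 1).sqrt (by positivity)
    have h4 := (hasDerivAt_primF (m := m) (l := l) hg (hu.pos x hx)).comp x (hu.hasDerivAt hx)
    have h5 := h3.fun_add h4
    refine h5.congr_deriv ?_
    rw [hq x hx]
    simp only [q, reaction, Nat.cast_ofNat, Nat.add_one_sub_one, pow_one]
    field_simp
    ring
  have hconst := (isOpen_Ioo (a := -L) (b := L)).is_const_of_deriv_eq_zero isPreconnected_Ioo
    (f := fun x => √(1 + q x ^ 2) + primF g m l (u x))
    (fun x hx => (hE x hx).differentiableAt.differentiableWithinAt)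
    (fun x hx => (hE x hx).deriv) hx hy
  rwa [hq x hx, hq y hy] at hconst

/-- The reflected solution. -/
theorem reflect (hu : IsPositiveSolution g L l m u) : IsPositiveSolution g L l m fun x => u (-x) := by
  have hI : ∀ x ∈ Ioo (-L) L, -x ∈ Ioo (-L) L := fun x hx => ⟨by linarith [hx.2], by linarith [hx.1]⟩
  have hd : ∀ x, deriv (fun x => u (-x)) x = -deriv u (-x) := fun x => deriv_comp_neg u x
  refine ⟨?_, ?_, fun x hx => hu.pos _ (hI x hx), ?_, ?_, ?_, ?_⟩
  · exact hu.continuousOn.comp continuousOn_neg fun x hx => ⟨by linarith [hx.2], by linarith [hx.1]⟩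
  · exact hu.contDiffOn.comp contDiff_neg.contDiffOn hI
  · intro x hx
    rw [hd, abs_neg]
    exact hu.slope_lt_one _ (hI x hx)
  · intro x hx
    have h := ((hu.equation (-x) (hI x hx)).comp x (hasDerivAt_neg x)).fun_neg
    have h2 : (fun y => -(deriv (fun x => u (-x)) y / √(1 - deriv (fun x => u (-x)) y ^ 2))) =
        fun y => -((fun y => -(deriv u y / √(1 - deriv u y ^ 2))) ∘ Neg.neg) y := by
      funext y
      simp only [hd, Function.comp, neg_sq, neg_div]
    rw [h2]
    exact h.congr_deriv (by ring)
  · simpa using hu.right_bc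
  · simpa using hu.left_bc

/-- The maximum of a positive solution is attained at an interior point. -/
theorem exists_max (hu : IsPositiveSolution g L l m u) (hL : 0 < L) :
    ∃ x₀ ∈ Ioo (-L) L, ∀ x ∈ Icc (-L) L, u x ≤ u x₀ := by
  obtain ⟨x₀, hx₀, hmax⟩ := isCompact_Icc.exists_isMaxOn
    (nonempty_Icc.2 (by linarith : -L ≤ L)) hu.continuousOn
  have h0 : 0 < u x₀ := (hu.pos 0 ⟨by linarith, hL⟩).trans_le (hmax ⟨by linarith, hL.le⟩)
  refine ⟨x₀, ⟨lt_of_le_of_ne hx₀.1 ?_, lt_of_le_of_ne hx₀.2 ?_⟩, fun x hx => hmax hx⟩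
  · intro h; rw [← h, hu.left_bc] at h0; exact lt_irrefl _ h0
  · intro h; rw [h, hu.right_bc] at h0; exact lt_irrefl _ h0

theorem supNorm_eq (hu : IsPositiveSolution g L l m u) {x₀ : ℝ} (hx₀ : x₀ ∈ Ioo (-L) L)
    (hmax : ∀ x ∈ Icc (-L) L, u x ≤ u x₀) : supNorm L u = u x₀ := by
  have hnn : ∀ x ∈ Icc (-L) L, 0 ≤ u x := by
    intro x hx
    rcases eq_or_lt_of_le hx.1 with h | h
    · rw [← h, hu.left_bc]
    rcases eq_or_lt_of_le hx.2 with h' | h'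
    · rw [h', hu.right_bc]
    · exact (hu.pos x ⟨h, h'⟩).le
  apply IsGreatest.csSup_eq
  refine ⟨⟨x₀, ⟨hx₀.1.le, hx₀.2.le⟩, abs_of_nonneg (hnn x₀ ⟨hx₀.1.le, hx₀.2.le⟩)⟩, ?_⟩
  rintro _ ⟨x, hx, rfl⟩
  simp only
  rw [abs_of_nonneg (hnn x hx)]
  exact hmax x hx

section maximum

variable {x₀ : ℝ}

theorem deriv_max (hx₀ : x₀ ∈ Ioo (-L) L) (hmax : ∀ x ∈ Icc (-L) L, u x ≤ u x₀) :
    deriv u x₀ = 0 := by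
  apply IsLocalMax.deriv_eq_zero
  filter_upwards [Icc_mem_nhds hx₀.1 hx₀.2] with x hx using hmax x hx

theorem energy_max (hu : IsPositiveSolution g L l m u) (hg : IsLogisticGrowth g σ)
    (hx₀ : x₀ ∈ Ioo (-L) L) (hmax : ∀ x ∈ Icc (-L) L, u x ≤ u x₀) {x : ℝ} (hx : x ∈ Ioo (-L) L) :
    1 / √(1 - (deriv u x) ^ 2) = 1 + (primF g m l (u x₀) - primF g m l (u x)) := by
  have := hu.energy_eq hg hx hx₀
  rw [deriv_max hx₀ hmax] at this
  norm_num at this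
  rw [one_div]
  linarith

theorem primF_le_max (hu : IsPositiveSolution g L l m u) (hg : IsLogisticGrowth g σ)
    (hx₀ : x₀ ∈ Ioo (-L) L) (hmax : ∀ x ∈ Icc (-L) L, u x ≤ u x₀) {x : ℝ} (hx : x ∈ Ioo (-L) L) :
    primF g m l (u x) ≤ primF g m l (u x₀) := by
  have h := hu.energy_max hg hx₀ hmax hx
  have h0 := hu.one_sub_sq_pos hx
  have h1 : 1 ≤ 1 / √(1 - (deriv u x) ^ 2) := by
    rw [le_div_iff₀ (Real.sqrt_pos.2 h0), one_mul]
    apply Real.sqrt_le_one.2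
    nlinarith [sq_nonneg (deriv u x)]
  linarith

/-- A solution takes every value between `0` and its maximum, so `F` is largest at the maximum among
all these values. Letting `v` tend to either end yields `f ≥ 0` and `F ≥ 0` at the maximum. -/
theorem primF_le_max' (hu : IsPositiveSolution g L l m u) (hg : IsLogisticGrowth g σ)
    (hx₀ : x₀ ∈ Ioo (-L) L) (hmax : ∀ x ∈ Icc (-L) L, u x ≤ u x₀) {v : ℝ} (hv : v ∈ Ioo 0 (u x₀)) :
    primF g m l v ≤ primF g m l (u x₀) := by
  have hc : ContinuousOn u (Icc x₀ L) := hu.continuousOn.mono (Icc_subset_Icc_left hx₀.1.le)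
  have := intermediate_value_Ioo' hx₀.2.le hc
  rw [hu.right_bc] at this
  obtain ⟨x, hx, rfl⟩ := this hv
  exact hu.primF_le_max hg hx₀ hmax ⟨hx₀.1.trans hx.1, hx.2⟩

theorem reaction_max_nonneg (hu : IsPositiveSolution g L l m u) (hg : IsLogisticGrowth g σ)
    (hx₀ : x₀ ∈ Ioo (-L) L) (hmax : ∀ x ∈ Icc (-L) L, u x ≤ u x₀) :
    0 ≤ reaction g m l (u x₀) := by
  have hpos := hu.pos x₀ hx₀
  have h1 := (hasDerivAt_primF (m := m) (l := l) hg hpos).hasDerivWithinAt (s := Iio (u x₀))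
  rw [hasDerivWithinAt_iff_tendsto_slope' self_notMem_Iio] at h1
  apply ge_of_tendsto h1
  filter_upwards [Ioo_mem_nhdsLT hpos] with v hv
  rw [slope_def_field]
  apply div_nonneg_of_nonpos
  · linarith [hu.primF_le_max' hg hx₀ hmax hv]
  · linarith [hv.2]

theorem primF_max_nonneg (hu : IsPositiveSolution g L l m u) (hg : IsLogisticGrowth g σ)
    (hx₀ : x₀ ∈ Ioo (-L) L) (hmax : ∀ x ∈ Icc (-L) L, u x ≤ u x₀) :
    0 ≤ primF g m l (u x₀) := by
  have hpos := hu.pos x₀ hx₀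
  have hc : ContinuousWithinAt (primF g m l) (Ioi 0) 0 := by
    have : ContinuousOn (primF g m l) (Ici 0) :=
      (continuousOn_const.mul hg.continuousOn_primG).sub (continuousOn_const.mul continuousOn_id)
    exact (this 0 self_mem_Ici).mono Ioi_subset_Ici_self
  have h0 : primF g m l 0 = 0 := by simp [primF, IsLogisticGrowth.primG_zero]
  rw [← h0]
  apply le_of_tendsto hc.tendsto
  filter_upwards [Ioo_mem_nhdsGT hpos] with v hv using hu.primF_le_max' hg hx₀ hmax hv

theorem max_lt_sigma (hu : IsPositiveSolution g L l m u) (hg : IsLogisticGrowth g σ) (hl : 0 < l)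
    (hm : 0 < m) (hx₀ : x₀ ∈ Ioo (-L) L) (hmax : ∀ x ∈ Icc (-L) L, u x ≤ u x₀) : u x₀ < σ := by
  by_contra hc
  push Not at hc
  have h1 := hu.reaction_max_nonneg hg hx₀ hmax
  have h2 : g (u x₀) ≤ 0 := by
    rcases eq_or_lt_of_le hc with h | h
    · rw [← h, hg.map_sigma]
    · exact (hg.neg h).le
  unfold reaction at h1
  nlinarith

/-- If `f` vanished at the maximum `α`, then `F(α) - F(u)` would be at most quadratic in `α - u`,
and the energy would give `-u' ≤ √(2K) (α - u)`. A Gronwall argument then keeps `u` equal to `α` up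
to the end point, against `u(L) = 0`. -/
theorem reaction_max_pos (hu : IsPositiveSolution g L l m u) (hg : IsLogisticGrowth g σ) (hl : 0 < l)
    (hm : 0 < m) (hx₀ : x₀ ∈ Ioo (-L) L) (hmax : ∀ x ∈ Icc (-L) L, u x ≤ u x₀) :
    0 < reaction g m l (u x₀) := by
  refine lt_of_le_of_ne (hu.reaction_max_nonneg hg hx₀ hmax) fun h0 => ?_
  set α := u x₀ with hα
  have hpos : 0 < α := hu.pos x₀ hx₀
  have hαs : α ∈ Ioo 0 σ := ⟨hpos, hu.max_lt_sigma hg hl hm hx₀ hmax⟩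
  set K := l * |deriv g α| with hK
  have hK0 : 0 ≤ K := mul_nonneg hl.le (abs_nonneg _)
  have hslope : ∀ x ∈ Ioo (-L) L, -deriv u x ≤ √(2 * K) * (α - u x) := by
    intro x hx
    have hxm := hmax x ⟨hx.1.le, hx.2.le⟩
    have hup : 0 < u x := hu.pos x hx
    have hδ : primF g m l α - primF g m l (u x) ≤ K * (α - u x) ^ 2 := by
      have h := gap_le (m := m) hg hl.le hαs (s := u x / α)
        ⟨by positivity, div_le_one_of_le₀ hxm hpos.le⟩
      rw [gap_eq hpos.ne', ← h0] at h
      refine h.trans (le_of_eq ?_)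
      rw [← hK]; field_simp; ring
    have hen := hu.energy_max hg hx₀ hmax hx
    rw [← hα] at hen
    set δ := primF g m l α - primF g m l (u x) with hδdef
    have hδ0 : 0 ≤ δ := by linarith [hu.primF_le_max hg hx₀ hmax hx]
    have h1 := hu.one_sub_sq_pos hx
    have hs := Real.sqrt_pos.2 h1
    have hw : (deriv u x) ^ 2 ≤ 2 * δ := by
      have h2 : √(1 - deriv u x ^ 2) * (1 + δ) = 1 := by rw [← hen]; field_simp
      have h3 : (1 - deriv u x ^ 2) * (1 + δ) ^ 2 = 1 := by
        rw [← Real.sq_sqrt h1.le, ← mul_pow, h2, one_pow]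
      nlinarith [sq_nonneg δ, mul_nonneg hδ0 hδ0, mul_nonneg (mul_nonneg hδ0 hδ0) hδ0]
    have h5 : deriv u x ^ 2 ≤ (√(2 * K) * (α - u x)) ^ 2 := by
      rw [mul_pow, Real.sq_sqrt (by positivity)]; linarith
    have h6 := abs_le.1 (abs_le_of_sq_le_sq h5 (mul_nonneg (Real.sqrt_nonneg _) (by linarith)))
    linarith [h6.1]
  have hanti : AntitoneOn (fun x => (α - u x) * Real.exp (-(√(2 * K)) * x)) (Icc x₀ L) := by
    have hd : ∀ x ∈ Ioo x₀ L, HasDerivAt (fun x => (α - u x) * Real.exp (-(√(2 * K)) * x))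
        ((-deriv u x) * Real.exp (-(√(2 * K)) * x) +
          (α - u x) * (Real.exp (-(√(2 * K)) * x) * -(√(2 * K)))) x := by
      intro x hx
      have hx' : x ∈ Ioo (-L) L := ⟨hx₀.1.trans hx.1, hx.2⟩
      have h1 : HasDerivAt (fun x : ℝ => -(√(2 * K)) * x) (-(√(2 * K))) x := by
        simpa using (hasDerivAt_id' x).const_mul (-(√(2 * K)))
      exact ((hu.hasDerivAt hx').const_sub α).fun_mul h1.exp
    apply antitoneOn_of_deriv_nonpos (convex_Icc _ _)
    · exact (continuousOn_const.sub (hu.continuousOn.mono (Icc_subset_Icc_left hx₀.1.le))).mul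
        (by fun_prop)
    · rw [interior_Icc]
      exact fun x hx => (hd x hx).differentiableAt.differentiableWithinAt
    · rw [interior_Icc]
      intro x hx
      rw [(hd x hx).deriv]
      have := hslope x ⟨hx₀.1.trans hx.1, hx.2⟩
      have he := Real.exp_pos (-(√(2 * K)) * x)
      nlinarith
  have h := hanti (left_mem_Icc.2 hx₀.2.le) (right_mem_Icc.2 hx₀.2.le) hx₀.2.le
  simp only [hu.right_bc, sub_zero] at h
  rw [← hα, sub_self, zero_mul] at h
  have := mul_pos hpos (Real.exp_pos (-(√(2 * K)) * L))
  linarith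

theorem adm (hu : IsPositiveSolution g L l m u) (hg : IsLogisticGrowth g σ) (hl : 0 < l)
    (hm : 0 < m) (hx₀ : x₀ ∈ Ioo (-L) L) (hmax : ∀ x ∈ Icc (-L) L, u x ≤ u x₀) :
    Adm g σ l m (u x₀) :=
  ⟨hl, ⟨hu.pos x₀ hx₀, hu.max_lt_sigma hg hl hm hx₀ hmax⟩, hu.primF_max_nonneg hg hx₀ hmax,
    hu.reaction_max_pos hg hl hm hx₀ hmax⟩

/-- At a critical point the energy identity forces `F(u(x)) = F(u(x₀))`, while the gap is positive
below the maximum. -/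
theorem deriv_ne_zero (hu : IsPositiveSolution g L l m u) (hg : IsLogisticGrowth g σ) (hl : 0 < l)
    (hm : 0 < m) (hx₀ : x₀ ∈ Ioo (-L) L) (hmax : ∀ x ∈ Icc (-L) L, u x ≤ u x₀) {x : ℝ}
    (hx : x ∈ Ioo (-L) L) (hlt : u x < u x₀) : deriv u x ≠ 0 := by
  intro h0
  have hA := hu.adm hg hl hm hx₀ hmax
  have hen := hu.energy_max hg hx₀ hmax hx
  rw [h0] at hen
  norm_num at hen
  have h1 := hA.gap_pos hg (s := u x / u x₀)
    ⟨div_pos (hu.pos x hx) hA.mem.1, (div_lt_one hA.mem.1).2 hlt⟩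
  rw [gap_eq hA.mem.1.ne'] at h1
  linarith

/-- Between two maximum points there would be an interior minimum, which is a critical point below
the maximum unless `u` is constant there; a constant solution would make the reaction vanish at the
maximum. -/
theorem lt_max (hu : IsPositiveSolution g L l m u) (hg : IsLogisticGrowth g σ) (hl : 0 < l)
    (hm : 0 < m) (hx₀ : x₀ ∈ Ioo (-L) L) (hmax : ∀ x ∈ Icc (-L) L, u x ≤ u x₀) {x₁ : ℝ}
    (hx₁ : x₁ ∈ Ioo x₀ L) : u x₁ < u x₀ := by
  refine lt_of_le_of_ne (hmax x₁ ⟨(hx₀.1.trans hx₁.1).le, hx₁.2.le⟩) fun heq => ?_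
  have hsub : ∀ x ∈ Icc x₀ x₁, x ∈ Ioo (-L) L := fun x hx =>
    ⟨hx₀.1.trans_le hx.1, hx.2.trans_lt hx₁.2⟩
  have hall : ∀ x ∈ Icc x₀ x₁, u x = u x₀ := by
    obtain ⟨x₂, hx₂, hmin⟩ := isCompact_Icc.exists_isMinOn
      (nonempty_Icc.2 hx₁.1.le) (hu.continuousOn.mono fun x hx =>
        ⟨(hsub x hx).1.le, (hsub x hx).2.le⟩)
    have hx₂e : u x₂ = u x₀ := by
      by_contra hne
      have hlt : u x₂ < u x₀ :=
        lt_of_le_of_ne (hmax x₂ ⟨(hsub x₂ hx₂).1.le, (hsub x₂ hx₂).2.le⟩) hne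
      have h1 : x₀ < x₂ := lt_of_le_of_ne hx₂.1 fun h => hne (by rw [h])
      have h2 : x₂ < x₁ := lt_of_le_of_ne hx₂.2 fun h => hne (by rw [h, heq])
      apply hu.deriv_ne_zero hg hl hm hx₀ hmax (hsub x₂ hx₂) hlt
      apply IsLocalMin.deriv_eq_zero
      filter_upwards [Icc_mem_nhds h1 h2] with x hx using hmin hx
    intro x hx
    apply le_antisymm (hmax x ⟨(hsub x hx).1.le, (hsub x hx).2.le⟩)
    rw [← hx₂e]; exact hmin hx
  have hmid : (x₀ + x₁) / 2 ∈ Ioo x₀ x₁ := ⟨by linarith [hx₁.1], by linarith [hx₁.1]⟩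
  have hd0 : ∀ x ∈ Ioo x₀ x₁, deriv u x = 0 := by
    intro x hx
    have : u =ᶠ[𝓝 x] fun _ => u x₀ := by
      filter_upwards [Icc_mem_nhds hx.1 hx.2] with y hy using hall y hy
    rw [this.deriv_eq, deriv_const]
  have heqn := hu.equation _ (hsub _ ⟨hmid.1.le, hmid.2.le⟩)
  have hz : (fun y => -(deriv u y / √(1 - deriv u y ^ 2))) =ᶠ[𝓝 ((x₀ + x₁) / 2)] fun _ => 0 := by
    filter_upwards [Ioo_mem_nhds hmid.1 hmid.2] with y hy
    rw [hd0 y hy]; simp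
  have h0 := (heqn.congr_of_eventuallyEq hz.symm).unique (hasDerivAt_const _ _)
  have := hu.reaction_max_pos hg hl hm hx₀ hmax
  rw [hall _ ⟨hmid.1.le, hmid.2.le⟩] at h0
  unfold reaction at this
  linarith

/-- The distance of the maximum point from the right end of the interval is the time map. -/
theorem timeMap_eq_sub (hu : IsPositiveSolution g L l m u) (hg : IsLogisticGrowth g σ) (hl : 0 < l)
    (hm : 0 < m) (hx₀ : x₀ ∈ Ioo (-L) L) (hmax : ∀ x ∈ Icc (-L) L, u x ≤ u x₀) :
    timeMap g l m (u x₀) = L - x₀ := by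
  have hA := hu.adm hg hl hm hx₀ hmax
  have hsub : ∀ x ∈ Ioo x₀ L, x ∈ Ioo (-L) L := fun x hx => ⟨hx₀.1.trans hx.1, hx.2⟩
  have hcu : ContinuousOn u (Icc x₀ L) := hu.continuousOn.mono (Icc_subset_Icc_left hx₀.1.le)
  have hneg : ∀ x ∈ Ioo x₀ L, deriv u x < 0 := by
    rcases hasDerivWithinAt_forall_lt_or_forall_gt_of_forall_ne (convex_Ioo x₀ L)
      (fun x hx => (hu.hasDerivAt (hsub x hx)).hasDerivWithinAt) (m := 0)
      (fun x hx => hu.deriv_ne_zero hg hl hm hx₀ hmax (hsub x hx)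
        (hu.lt_max hg hl hm hx₀ hmax hx)) with h | h
    · exact h
    · exfalso
      have hmono : StrictMonoOn u (Icc x₀ L) := by
        apply strictMonoOn_of_deriv_pos (convex_Icc _ _) hcu
        rw [interior_Icc]; exact h
      have := hmono (left_mem_Icc.2 hx₀.2.le) (right_mem_Icc.2 hx₀.2.le) hx₀.2
      rw [hu.right_bc] at this
      linarith [hA.mem.1]
  set α := u x₀ with hα
  have hcont : ContinuousOn (fun x => tailTime g l m α (u x / α)) (Icc x₀ L) := by
    apply (hA.continuousOn_tailTime hg).comp (hcu.div_const α)
    intro x hx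
    have h1 : 0 ≤ u x := by
      rcases eq_or_lt_of_le hx.2 with h | h
      · rw [h, hu.right_bc]
      · exact (hu.pos x ⟨hx₀.1.trans_le hx.1, h⟩).le
    exact ⟨div_nonneg h1 hA.mem.1.le,
      div_le_one_of_le₀ (hmax x ⟨(hx₀.1.trans_le hx.1).le, hx.2⟩) hA.mem.1.le⟩
  -- The energy identity amounts to `kern δ * (-u') = 1`: the descent time advances at unit speed.
  have hder : ∀ x ∈ Ioo x₀ L, HasDerivAt (fun x => tailTime g l m α (u x / α)) 1 x := by
    intro x hx
    have hs : u x / α ∈ Ioo (0:ℝ) 1 := ⟨div_pos (hu.pos x (hsub x hx)) hA.mem.1,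
      (div_lt_one hA.mem.1).2 (hu.lt_max hg hl hm hx₀ hmax hx)⟩
    have h1 := (hA.hasDerivAt_tailTime hg hs).comp x ((hu.hasDerivAt (hsub x hx)).div_const α)
    refine h1.congr_deriv ?_
    have hgp := hA.gap_pos hg hs
    have hen := hu.energy_max hg hx₀ hmax (hsub x hx)
    rw [← hα, ← gap_eq hA.mem.1.ne'] at hen
    set δ := gap g l m α (u x / α) with hδ
    have hk : kern δ * -deriv u x = 1 := by
      have h2 := hu.one_sub_sq_pos (hsub x hx)
      have h3 : (1 - deriv u x ^ 2) * (1 + δ) ^ 2 = 1 := by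
        rw [← hen, div_pow, Real.sq_sqrt h2.le]; field_simp
      have hP := kern_arg_pos hgp
      have h4 : kern δ ^ 2 * deriv u x ^ 2 = 1 := by
        rw [kern_sq hgp]
        field_simp
        nlinarith
      have h5 : 0 < kern δ * -deriv u x := mul_pos (kern_pos hgp) (by linarith [hneg x hx])
      nlinarith
    have := hA.mem.1
    field_simp
    linarith
  obtain ⟨c, -, hc⟩ := exists_hasDerivAt_eq_slope _ _ hx₀.2 hcont hder
  have h1 : L - x₀ ≠ 0 := by linarith [hx₀.2]
  rw [eq_div_iff h1, hu.right_bc, zero_div, tailTime_zero, ← hα, div_self hA.mem.1.ne',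
    tailTime_one] at hc
  linarith

end maximum

theorem adm_and_timeMap_eq (hu : IsPositiveSolution g L l m u) (hg : IsLogisticGrowth g σ)
    (hL : 0 < L) (hl : 0 < l) (hm : 0 < m) :
    Adm g σ l m (supNorm L u) ∧ timeMap g l m (supNorm L u) = L := by
  obtain ⟨x₀, hx₀, hmax⟩ := hu.exists_max hL
  rw [hu.supNorm_eq hx₀ hmax]
  refine ⟨hu.adm hg hl hm hx₀ hmax, ?_⟩
  have h1 := hu.timeMap_eq_sub hg hl hm hx₀ hmax
  have hI : -x₀ ∈ Ioo (-L) L := ⟨by linarith [hx₀.2], by linarith [hx₀.1]⟩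
  -- The reflected solution gives `L + x₀` for the same time map, hence `x₀ = 0`.
  have h2 := hu.reflect.timeMap_eq_sub hg hl hm (x₀ := -x₀) hI (fun x hx => by
    simpa using hmax (-x) ⟨by linarith [hx.2], by linarith [hx.1]⟩)
  simp only [neg_neg] at h2
  linarith

end IsPositiveSolution

end


/-! ### From the time map back to positive solutions. -/

/-- A local version of `hasDerivAt_of_hasDerivAt_of_ne`. -/
theorem hasDerivAt_of_hasDerivAt_of_ne_of_mem {f f' : ℝ → ℝ} {x : ℝ} {U : Set ℝ} (hU : U ∈ 𝓝 x)
    (hd : ∀ y ∈ U, y ≠ x → HasDerivAt f (f' y) y) (hf : ContinuousAt f x)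
    (hf' : ContinuousAt f' x) : HasDerivAt f (f' x) x := by
  obtain ⟨a, b, hx, hab⟩ := mem_nhds_iff_exists_Ioo_subset.1 hU
  have A : HasDerivWithinAt f (f' x) (Ici x) x := by
    apply hasDerivWithinAt_Ici_of_tendsto_deriv (s := Ioo x b) _ hf.continuousWithinAt
      (Ioo_mem_nhdsGT hx.2)
    · refine (tendsto_inf_left hf' : Tendsto f' (𝓝[>] x) (𝓝 (f' x))).congr' ?_
      filter_upwards [Ioo_mem_nhdsGT hx.2] with y hy
      exact (hd y (hab ⟨hx.1.trans hy.1, hy.2⟩) hy.1.ne').deriv.symm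
    · exact fun y hy =>
        (hd y (hab ⟨hx.1.trans hy.1, hy.2⟩) hy.1.ne').differentiableAt.differentiableWithinAt
  have B : HasDerivWithinAt f (f' x) (Iic x) x := by
    apply hasDerivWithinAt_Iic_of_tendsto_deriv (s := Ioo a x) _ hf.continuousWithinAt
      (Ioo_mem_nhdsLT hx.1)
    · refine (tendsto_inf_left hf' : Tendsto f' (𝓝[<] x) (𝓝 (f' x))).congr' ?_
      filter_upwards [Ioo_mem_nhdsLT hx.1] with y hy
      exact (hd y (hab ⟨hy.1, hy.2.trans hx.2⟩) hy.2.ne).deriv.symm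
    · exact fun y hy =>
        (hd y (hab ⟨hy.1, hy.2.trans hx.2⟩) hy.2.ne).differentiableAt.differentiableWithinAt
  simpa using B.union A

theorem ContinuousOn.rightInverse_of_compact {X S : ℝ → ℝ} {K D : Set ℝ} (hK : IsCompact K)
    (hX : ContinuousOn X K) (hinj : InjOn X K) (hS : ∀ x ∈ D, S x ∈ K ∧ X (S x) = x) :
    ContinuousOn S D := by
  intro x hx
  apply hK.tendsto_nhds_of_unique_ultrafilter
  · filter_upwards [self_mem_nhdsWithin] with y hy using (hS y hy).1
  · intro U hU s hs hlim
    have hev : ∀ᶠ y in (U : Filter ℝ), y ∈ D := hU self_mem_nhdsWithin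
    have h1 : Tendsto S U (𝓝[K] s) :=
      tendsto_nhdsWithin_iff.2 ⟨hlim, hev.mono fun y hy => (hS y hy).1⟩
    have h2 : Tendsto (fun y => X (S y)) U (𝓝 (X s)) := (hX s hs).tendsto.comp h1
    have h3 : Tendsto (fun y : ℝ => y) U (𝓝 (X s)) :=
      h2.congr' (hev.mono fun y hy => (hS y hy).2)
    have h4 : Tendsto (fun y : ℝ => y) U (𝓝 x) := hU.trans nhdsWithin_le_nhds
    apply hinj hs (hS x hx).1
    rw [(hS x hx).2]
    exact tendsto_nhds_unique h3 h4

section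

variable {g : ℝ → ℝ} {σ l m a L : ℝ}

theorem hasDerivAt_gap (hg : IsLogisticGrowth g σ) (ha : 0 < a) {s : ℝ} (hs : 0 < s) :
    HasDerivAt (gap g l m a) (-(a * reaction g m l (a * s))) s := by
  have h1 : HasDerivAt (fun s : ℝ => a * s) a s := by
    simpa using (hasDerivAt_id' s).const_mul a
  have h2 := (((hg.hasDerivAt_primG (mul_pos ha hs)).comp s h1).const_sub (primG g a)).const_mul l
  have h3 := (((hasDerivAt_id' s).const_sub 1).const_mul a).const_mul m
  refine (h2.fun_sub h3).congr_deriv ?_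
  unfold reaction
  ring

/-- Every admissible point of a level set of the time map comes from a positive solution. -/
theorem Adm.exists_solution (h : Adm g σ l m a) (hg : IsLogisticGrowth g σ)
    (hT : timeMap g l m a = L) : ∃ u, IsPositiveSolution g L l m u ∧ supNorm L u = a := by
  have ha := h.mem.1
  have hL : 0 < L := by rw [← hT]; exact ha.trans (h.lt_timeMap hg)
  have hXc := h.continuousOn_tailTime hg
  have hXi := (h.tailTime_strictAntiOn hg).injOn
  have hX0 : tailTime g l m a 0 = L := tailTime_zero.trans hT
  have hX1 : tailTime g l m a 1 = 0 := tailTime_one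
  have hex : ∀ x ∈ Icc 0 L, ∃ s, s ∈ Icc (0:ℝ) 1 ∧ tailTime g l m a s = x := by
    intro x hx
    have := intermediate_value_Icc' zero_le_one hXc
    rw [hX0, hX1] at this
    exact this hx
  choose! S hS using hex
  have hSc : ContinuousOn S (Icc 0 L) :=
    ContinuousOn.rightInverse_of_compact isCompact_Icc hXc hXi hS
  have hI0 : (0:ℝ) ∈ Icc 0 L := left_mem_Icc.2 hL.le
  have hIL : L ∈ Icc 0 L := right_mem_Icc.2 hL.le
  have hS0 : S 0 = 1 := hXi (hS 0 hI0).1 (right_mem_Icc.2 zero_le_one) ((hS 0 hI0).2.trans hX1.symm)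
  have hSL : S L = 0 := hXi (hS L hIL).1 (left_mem_Icc.2 zero_le_one) ((hS L hIL).2.trans hX0.symm)
  have hSpos : ∀ x ∈ Ico 0 L, 0 < S x := by
    intro x hx
    have hx' : x ∈ Icc 0 L := ⟨hx.1, hx.2.le⟩
    refine lt_of_le_of_ne (hS x hx').1.1 fun h0 => ?_
    have := (hS x hx').2
    rw [← h0, hX0] at this
    linarith [hx.2]
  have hSlt : ∀ x ∈ Ioc 0 L, S x < 1 := by
    intro x hx
    have hx' : x ∈ Icc 0 L := ⟨hx.1.le, hx.2⟩
    refine lt_of_le_of_ne (hS x hx').1.2 fun h0 => ?_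
    have := (hS x hx').2
    rw [h0, hX1] at this
    linarith [hx.1]
  have hSmem : ∀ x ∈ Ioo 0 L, S x ∈ Ioo (0:ℝ) 1 := fun x hx =>
    ⟨hSpos x ⟨hx.1.le, hx.2⟩, hSlt x ⟨hx.1, hx.2.le⟩⟩
  have hSd : ∀ x ∈ Ioo 0 L, HasDerivAt S (-(a * kern (gap g l m a (S x))))⁻¹ x := by
    intro x hx
    have hgp := h.gap_pos hg (hSmem x hx)
    apply HasDerivAt.of_local_left_inverse (hSc.continuousAt (Icc_mem_nhds hx.1 hx.2))
      (h.hasDerivAt_tailTime hg (hSmem x hx))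
    · exact neg_ne_zero.2 (mul_pos ha (kern_pos hgp)).ne'
    · filter_upwards [Ioo_mem_nhds hx.1 hx.2] with y hy using (hS y ⟨hy.1.le, hy.2.le⟩).2
  let u : ℝ → ℝ := fun x => a * S |x|
  let R : ℝ → ℝ := fun x => √((gap g l m a (S x)) ^ 2 + 2 * gap g l m a (S x))
  -- The solution is the even function `u(x) = a S(|x|)`, with `S` the inverse of the descent time.
  -- The odd function `q` plays the role of `-u'/√(1 - u'²)`, so the problem becomes `u' = -q/√(1 +
  -- q²)` and `q' = f(u)`.
  let q : ℝ → ℝ := fun x => if 0 ≤ x then R |x| else -R |x|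
  have hq2 : ∀ x, q x ^ 2 = R |x| ^ 2 := by
    intro x; simp only [q]; split_ifs <;> ring
  have habs : ∀ x ∈ Icc (-L) L, |x| ∈ Icc 0 L := fun x hx =>
    ⟨abs_nonneg x, abs_le.2 ⟨hx.1, hx.2⟩⟩
  have habs' : ∀ x ∈ Ioo (-L) L, x ≠ 0 → |x| ∈ Ioo 0 L := fun x hx h0 =>
    ⟨abs_pos.2 h0, abs_lt.2 hx⟩
  have hSabs : ContinuousOn (fun x => S |x|) (Icc (-L) L) :=
    hSc.comp continuous_abs.continuousOn habs
  have huc : ContinuousOn u (Icc (-L) L) := continuousOn_const.mul hSabs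
  have hgapc : ContinuousOn (fun x => gap g l m a (S |x|)) (Icc (-L) L) :=
    (continuousOn_gap hg ha.le).comp hSabs fun x hx => (hS _ (habs x hx)).1.1
  have hRc : ContinuousOn (fun x => R |x|) (Icc (-L) L) :=
    ((hgapc.pow 2).add (continuousOn_const.mul hgapc)).sqrt
  have hupos : ∀ x ∈ Ioo (-L) L, 0 < u x := fun x hx =>
    mul_pos ha (hSpos _ ⟨abs_nonneg x, abs_lt.2 hx⟩)
  have hR1 : ∀ x ∈ Ioo 0 L, HasDerivAt R (reaction g m l (a * S x)) x := by
    intro x hx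
    have hgp := h.gap_pos hg (hSmem x hx)
    have h1 := (hasDerivAt_gap (l := l) (m := m) hg ha (hSmem x hx).1).comp x (hSd x hx)
    have h2 := (hasDerivAt_sqrt_kern_arg hgp).comp x h1
    refine h2.congr_deriv ?_
    have h3 := Real.sqrt_pos.2 (kern_arg_pos hgp)
    simp only [kern]
    have : 1 + gap g l m a (S x) ≠ 0 := by positivity
    field_simp
  have hsqrt : ∀ x ∈ Icc 0 L, √(1 + R x ^ 2) = 1 + gap g l m a (S x) := by
    intro x hx
    have hgp : 0 ≤ gap g l m a (S x) := by
      have h1 := h.le_gap hg (hS x hx).1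
      have h2 := (hS x hx).1
      exact le_trans (mul_nonneg (mul_nonneg h2.1 (sub_nonneg.2 h2.2)) h.mul_reaction_pos.le) h1
    simp only [R]
    rw [Real.sq_sqrt (by positivity)]
    have : 1 + (gap g l m a (S x) ^ 2 + 2 * gap g l m a (S x)) = (1 + gap g l m a (S x)) ^ 2 := by
      ring
    rw [this, Real.sqrt_sq (by positivity)]
  have hu1 : ∀ x ∈ Ioo 0 L, HasDerivAt (fun x => a * S x) (-(R x / √(1 + R x ^ 2))) x := by
    intro x hx
    have hgp := h.gap_pos hg (hSmem x hx)
    refine ((hSd x hx).const_mul a).congr_deriv ?_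
    rw [hsqrt x ⟨hx.1.le, hx.2.le⟩]
    have h3 := Real.sqrt_pos.2 (kern_arg_pos hgp)
    simp only [kern, R]
    have : 1 + gap g l m a (S x) ≠ 0 := by positivity
    field_simp
  have hqd0 : ∀ x ∈ Ioo (-L) L, x ≠ 0 → HasDerivAt q (reaction g m l (u x)) x := by
    intro x hx h0
    rcases lt_or_gt_of_ne h0 with hlt | hgt
    · have hx' : -x ∈ Ioo 0 L := ⟨by linarith, by linarith [hx.1]⟩
      have h1 := ((hR1 (-x) hx').comp x (hasDerivAt_neg x)).fun_neg
      have h2 : q =ᶠ[𝓝 x] fun y => -(R ∘ Neg.neg) y := by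
        filter_upwards [Iio_mem_nhds hlt] with y hy
        simp only [q, Function.comp]
        rw [if_neg (not_le.2 hy), abs_of_neg hy]
      refine (h1.congr_of_eventuallyEq h2).congr_deriv ?_
      simp only [u, abs_of_neg hlt]; ring
    · have hx' : x ∈ Ioo 0 L := ⟨hgt, hx.2⟩
      have h2 : q =ᶠ[𝓝 x] R := by
        filter_upwards [Ioi_mem_nhds hgt] with y hy
        simp only [q]
        rw [if_pos (le_of_lt hy), abs_of_pos hy]
      refine ((hR1 x hx').congr_of_eventuallyEq h2).congr_deriv ?_
      simp only [u, abs_of_pos hgt]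
  have hud0 : ∀ x ∈ Ioo (-L) L, x ≠ 0 → HasDerivAt u (-(q x / √(1 + q x ^ 2))) x := by
    intro x hx h0
    rcases lt_or_gt_of_ne h0 with hlt | hgt
    · have hx' : -x ∈ Ioo 0 L := ⟨by linarith, by linarith [hx.1]⟩
      have h1 := (hu1 (-x) hx').comp x (hasDerivAt_neg x)
      have h2 : u =ᶠ[𝓝 x] (fun x => a * S x) ∘ Neg.neg := by
        filter_upwards [Iio_mem_nhds hlt] with y hy
        simp only [u, Function.comp]
        rw [abs_of_neg hy]
      refine (h1.congr_of_eventuallyEq h2).congr_deriv ?_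
      rw [hq2]
      simp only [q, abs_of_neg hlt, if_neg (not_le.2 hlt)]; ring
    · have hx' : x ∈ Ioo 0 L := ⟨hgt, hx.2⟩
      have h2 : u =ᶠ[𝓝 x] (fun x => a * S x) := by
        filter_upwards [Ioi_mem_nhds hgt] with y hy
        simp only [u]
        rw [abs_of_pos hy]
      refine ((hu1 x hx').congr_of_eventuallyEq h2).congr_deriv ?_
      rw [hq2]
      simp only [q, abs_of_pos hgt, if_pos hgt.le]
  have hnhds : ∀ x ∈ Ioo (-L) L, Icc (-L) L ∈ 𝓝 x := fun x hx => Icc_mem_nhds hx.1 hx.2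
  have h00 : (0:ℝ) ∈ Ioo (-L) L := ⟨by linarith, hL⟩
  have hR0 : R |0| = 0 := by simp [R, hS0, gap_one]
  have hqc0 : ContinuousAt q 0 := by
    have hq0 : q 0 = 0 := by simp only [q, le_refl, if_true, hR0]
    unfold ContinuousAt
    rw [hq0, tendsto_zero_iff_abs_tendsto_zero]
    have h1 := (hRc.continuousAt (hnhds 0 h00)).tendsto
    rw [hR0] at h1
    refine h1.congr fun x => ?_
    have : 0 ≤ R |x| := Real.sqrt_nonneg _
    simp only [q, Function.comp]
    split_ifs
    · rw [abs_of_nonneg this]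
    · rw [abs_neg, abs_of_nonneg this]
  have huca : ∀ x ∈ Ioo (-L) L, ContinuousAt u x := fun x hx => huc.continuousAt (hnhds x hx)
  have hrc : ∀ x ∈ Ioo (-L) L, ContinuousAt (fun x => reaction g m l (u x)) x := fun x hx =>
    (continuousAt_const.mul ((hg.continuousAt (hupos x hx)).comp (huca x hx))).sub continuousAt_const
  -- At `x = 0` the gap vanishes and the inverse function rule is unavailable; the derivatives there
  -- are obtained as limits of the nearby ones.
  have hqd : ∀ x ∈ Ioo (-L) L, HasDerivAt q (reaction g m l (u x)) x := by
    intro x hx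
    rcases eq_or_ne x 0 with rfl | h0
    · exact hasDerivAt_of_hasDerivAt_of_ne_of_mem (f' := fun x => reaction g m l (u x))
        (Ioo_mem_nhds h00.1 h00.2) hqd0 hqc0 (hrc 0 h00)
    · exact hqd0 x hx h0
  have hud : ∀ x ∈ Ioo (-L) L, HasDerivAt u (-(q x / √(1 + q x ^ 2))) x := by
    intro x hx
    rcases eq_or_ne x 0 with rfl | h0
    · refine hasDerivAt_of_hasDerivAt_of_ne_of_mem (f' := fun x => -(q x / √(1 + q x ^ 2)))
        (Ioo_mem_nhds h00.1 h00.2) hud0 (huca 0 h00) ?_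
      exact (hqc0.div ((continuousAt_const.add (hqc0.pow 2)).sqrt)
        (Real.sqrt_pos.2 (by positivity : (0:ℝ) < 1 + q 0 ^ 2)).ne').neg
    · exact hud0 x hx h0
  have hderu : ∀ x ∈ Ioo (-L) L, deriv u x = -(q x / √(1 + q x ^ 2)) := fun x hx => (hud x hx).deriv
  have hslope : ∀ x, 1 - (-(q x / √(1 + q x ^ 2))) ^ 2 = (1 / √(1 + q x ^ 2)) ^ 2 := by
    intro x
    have h1 : (0:ℝ) < 1 + q x ^ 2 := by positivity
    rw [neg_sq, div_pow, div_pow, Real.sq_sqrt h1.le]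
    field_simp
    ring
  refine ⟨u, ⟨huc, ?_, hupos, ?_, ?_, ?_, ?_⟩, ?_⟩
  · have hq1 : ContDiffOn ℝ 1 q (Ioo (-L) L) := by
      rw [show (1 : WithTop ℕ∞) = 0 + 1 from rfl, contDiffOn_succ_iff_deriv_of_isOpen isOpen_Ioo]
      refine ⟨fun x hx => (hqd x hx).differentiableAt.differentiableWithinAt, by simp, ?_⟩
      rw [contDiffOn_zero]
      have hc : ContinuousOn (fun x => reaction g m l (u x)) (Ioo (-L) L) :=
        fun x hx => (hrc x hx).continuousWithinAt
      exact hc.congr fun x hx => (hqd x hx).deriv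
    rw [show (2 : WithTop ℕ∞) = 1 + 1 from rfl, contDiffOn_succ_iff_deriv_of_isOpen isOpen_Ioo]
    refine ⟨fun x hx => (hud x hx).differentiableAt.differentiableWithinAt, by simp, ?_⟩
    refine ContDiffOn.congr ?_ hderu
    refine (hq1.div ((contDiffOn_const.add (hq1.pow 2)).sqrt fun x _ => ?_) fun x _ => ?_).neg
    · positivity
    · exact (Real.sqrt_pos.2 (by positivity)).ne'
  · intro x hx
    rw [hderu x hx, ← sq_lt_one_iff_abs_lt_one]
    have h1 := hslope x
    have h2 : 0 < (1 / √(1 + q x ^ 2)) ^ 2 := by positivity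
    linarith
  · intro x hx
    refine (hqd x hx).congr_of_eventuallyEq ?_
    filter_upwards [Ioo_mem_nhds hx.1 hx.2] with y hy
    rw [hderu y hy, hslope, Real.sqrt_sq (by positivity)]
    have : 0 < √(1 + q y ^ 2) := Real.sqrt_pos.2 (by positivity)
    field_simp
  · simp only [u, abs_neg, abs_of_pos hL, hSL, mul_zero]
  · simp only [u, abs_of_pos hL, hSL, mul_zero]
  · apply IsGreatest.csSup_eq
    refine ⟨⟨0, ⟨by linarith, hL.le⟩, by simp [u, hS0, abs_of_pos ha]⟩, ?_⟩
    rintro _ ⟨x, hx, rfl⟩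
    have h1 := (hS _ (habs x hx)).1
    simp only [u]
    rw [abs_of_nonneg (mul_nonneg ha.le h1.1)]
    exact mul_le_of_le_one_right ha.le h1.2

/-- The bifurcation curve is a level set of the time map. -/
theorem mem_bifurcationCurve_iff (hg : IsLogisticGrowth g σ) (hL : 0 < L) (hm : 0 < m) {p : ℝ × ℝ} :
    p ∈ bifurcationCurve g L m ↔ Adm g σ p.1 m p.2 ∧ timeMap g p.1 m p.2 = L := by
  constructor
  · rintro ⟨hl, u, hu, hp⟩
    rw [hp]
    exact hu.adm_and_timeMap_eq hg hL hl hm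
  · rintro ⟨h, hT⟩
    obtain ⟨u, hu, hn⟩ := h.exists_solution hg hT
    exact ⟨h.l_pos, u, hu, hn.symm⟩

end


/-! ### Comparison bounds, convexity in `1/a`, the branch `F = 0` and the unharvested problem. -/

section

variable {g : ℝ → ℝ} {σ l m a b c L : ℝ}

/-- The kernel exceeds `1/√(2x)` by at most `1`, so replacing the gap by a model costs at most `a`,
which is negligible for small amplitudes. -/
theorem Adm.timeMap_le_of_le_gap (h : Adm g σ l m a) (hg : IsLogisticGrowth g σ) {φ : ℝ → ℝ} {e : ℝ}
    (he : 0 < e) (hφ : ∀ s ∈ Ioo (0:ℝ) 1, 0 < φ s)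
    (hint : MeasureTheory.IntegrableOn (fun s => 1 / √(φ s)) (Ioo 0 1))
    (hle : ∀ s ∈ Ioo (0:ℝ) 1, e * a ^ 2 * φ s ≤ 2 * gap g l m a s) :
    timeMap g l m a ≤ a + 1 / √e * ∫ s in Ioo (0:ℝ) 1, 1 / √(φ s) := by
  have hb : MeasureTheory.IntegrableOn (fun s : ℝ => a + 1 / √e * (1 / √(φ s))) (Ioo 0 1) :=
    (MeasureTheory.integrable_const _).add (hint.const_mul _)
  have h1 := MeasureTheory.setIntegral_mono_on (h.integrableOn hg) hb measurableSet_Ioo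
    fun s hs => by
      have hgp := h.gap_pos hg hs
      have ha := h.mem.1
      have h2 := kern_le hgp
      have h3 := hφ s hs
      have h4 : √(e * a ^ 2 * φ s) ≤ √(2 * gap g l m a s) := Real.sqrt_le_sqrt (hle s hs)
      have h5 : √(e * a ^ 2 * φ s) = √e * a * √(φ s) := by
        rw [Real.sqrt_mul (by positivity), Real.sqrt_mul he.le, Real.sqrt_sq ha.le]
      have h6 : 0 < √e := Real.sqrt_pos.2 he
      have h7 : 0 < √(φ s) := Real.sqrt_pos.2 h3
      rw [h5] at h4
      have h8 : 1 / √(2 * gap g l m a s) ≤ 1 / (√e * a * √(φ s)) :=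
        one_div_le_one_div_of_le (by positivity) h4
      have h9 : a * (1 / (√e * a * √(φ s))) = 1 / √e * (1 / √(φ s)) := by field_simp
      calc a * kern (gap g l m a s) ≤ a * (1 + 1 / (√e * a * √(φ s))) :=
            mul_le_mul_of_nonneg_left (by linarith) ha.le
        _ = a + 1 / √e * (1 / √(φ s)) := by rw [mul_add, mul_one, h9]
  refine h1.trans (le_of_eq ?_)
  rw [MeasureTheory.integral_add (MeasureTheory.integrable_const _) (hint.const_mul _),
    MeasureTheory.integral_const_mul, MeasureTheory.setIntegral_const]
  simp [MeasureTheory.measureReal_def]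

theorem Adm.le_timeMap_of_gap_le (h : Adm g σ l m a) (hg : IsLogisticGrowth g σ) {φ : ℝ → ℝ} {e : ℝ}
    (he : 0 < e) (hφ : ∀ s ∈ Ioo (0:ℝ) 1, 0 < φ s)
    (hint : MeasureTheory.IntegrableOn (fun s => 1 / √(φ s)) (Ioo 0 1))
    (hle : ∀ s ∈ Ioo (0:ℝ) 1, 2 * gap g l m a s ≤ e * a ^ 2 * φ s) :
    1 / √e * (∫ s in Ioo (0:ℝ) 1, 1 / √(φ s)) ≤ timeMap g l m a := by
  rw [← MeasureTheory.integral_const_mul]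
  apply MeasureTheory.setIntegral_mono_on (hint.const_mul _) (h.integrableOn hg) measurableSet_Ioo
  intro s hs
  have hgp := h.gap_pos hg hs
  have ha := h.mem.1
  have h2 := le_kern hgp
  have h3 := hφ s hs
  have h4 : √(2 * gap g l m a s) ≤ √(e * a ^ 2 * φ s) := Real.sqrt_le_sqrt (hle s hs)
  have h5 : √(e * a ^ 2 * φ s) = √e * a * √(φ s) := by
    rw [Real.sqrt_mul (by positivity), Real.sqrt_mul he.le, Real.sqrt_sq ha.le]
  have h6 : 0 < √e := Real.sqrt_pos.2 he
  have h7 : 0 < √(φ s) := Real.sqrt_pos.2 h3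
  rw [h5] at h4
  have h8 : 1 / (√e * a * √(φ s)) ≤ 1 / √(2 * gap g l m a s) :=
    one_div_le_one_div_of_le (Real.sqrt_pos.2 (by positivity)) h4
  have h9 : a * (1 / (√e * a * √(φ s))) = 1 / √e * (1 / √(φ s)) := by field_simp
  rw [← h9]
  exact mul_le_mul_of_nonneg_left (h8.trans h2) ha.le

/-! Convexity of the time map in the variable `1 / a`. -/

theorem gap_div_sq (hg : IsLogisticGrowth g σ) (ha : 0 < a) {s : ℝ} (hs : 0 ≤ s) :
    gap g l m a s / a ^ 2 = l * (∫ t in s..1, g (a * t) / a) - m * ((1 - s) * (1 / a)) := by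
  unfold gap
  rw [hg.primG_sub_mul ha.le hs, intervalIntegral.integral_div]
  field_simp

/-- In `z = 1/a` the quantity `g(at)/a` is the perspective `z g(t/z)` of a concave function, and the
harvesting term is linear. The weights `pd/a` and `qd/b` are those for which the combination of `at`
and `bt` is `dt`. -/
theorem gap_div_sq_concave (hg : IsLogisticGrowth g σ) (hl : 0 ≤ l) (ha : a ∈ Ioc 0 σ)
    (hb : b ∈ Ioc 0 σ) {p q : ℝ} (hp : 0 < p) (hq : 0 < q) (hpq : p + q = 1) {s : ℝ}
    (hs : s ∈ Icc (0:ℝ) 1) :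
    p * (gap g l m a s / a ^ 2) + q * (gap g l m b s / b ^ 2) ≤
      gap g l m (1 / (p * (1 / a) + q * (1 / b))) s / (1 / (p * (1 / a) + q * (1 / b))) ^ 2 := by
  have ha0 := ha.1
  have hb0 := hb.1
  have hz : 0 < p * (1 / a) + q * (1 / b) := by positivity
  set d := 1 / (p * (1 / a) + q * (1 / b)) with hd
  have hd0 : 0 < d := by positivity
  have hdz : 1 / d = p * (1 / a) + q * (1 / b) := by rw [hd]; field_simp
  rw [gap_div_sq hg ha0 hs.1, gap_div_sq hg hb0 hs.1, gap_div_sq hg hd0 hs.1, hdz]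
  have ia := (hg.integrable_mul ha0.le hs).div_const a
  have ib := (hg.integrable_mul hb0.le hs).div_const b
  have key : (∫ t in s..1, (p * (g (a * t) / a) + q * (g (b * t) / b))) ≤
      ∫ t in s..1, g (d * t) / d := by
    apply intervalIntegral.integral_mono_on hs.2 ((ia.const_mul p).add (ib.const_mul q))
      ((hg.integrable_mul hd0.le hs).div_const d)
    intro t ht
    have ht0 : 0 ≤ t := hs.1.trans ht.1
    have hat : a * t ∈ Icc 0 σ :=
      ⟨mul_nonneg ha0.le ht0, (mul_le_of_le_one_right ha0.le ht.2).trans ha.2⟩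
    have hbt : b * t ∈ Icc 0 σ :=
      ⟨mul_nonneg hb0.le ht0, (mul_le_of_le_one_right hb0.le ht.2).trans hb.2⟩
    have hsum : p * d / a + q * d / b = 1 := by
      have : p * d / a + q * d / b = d * (1 / d) := by rw [hdz]; field_simp
      rw [this]; field_simp
    have hcc := hg.concaveOn.2 hat hbt (by positivity : 0 ≤ p * d / a)
      (by positivity : 0 ≤ q * d / b) hsum
    simp only [smul_eq_mul] at hcc
    have e1 : p * d / a * (a * t) + q * d / b * (b * t) = d * t := by
      have : p * d / a * (a * t) + q * d / b * (b * t) = (p + q) * d * t := by field_simp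
      rw [this, hpq, one_mul]
    rw [e1] at hcc
    rw [le_div_iff₀ hd0]
    refine le_trans (le_of_eq ?_) hcc
    field_simp
  rw [intervalIntegral.integral_add (ia.const_mul p) (ib.const_mul q),
    intervalIntegral.integral_const_mul, intervalIntegral.integral_const_mul] at key
  have := mul_le_mul_of_nonneg_left key hl
  nlinarith

theorem strictMonoOn_primF (hg : IsLogisticGrowth g σ) (hl : 0 < l) (ha : Adm g σ l m a)
    (hb : Adm g σ l m b) : StrictMonoOn (primF g m l) (Icc a b) := by
  apply strictMonoOn_of_deriv_pos (convex_Icc a b)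
  · exact fun x hx =>
      (hasDerivAt_primF hg (ha.mem.1.trans_le hx.1)).continuousAt.continuousWithinAt
  · intro x hx
    rw [interior_Icc] at hx
    rw [(hasDerivAt_primF hg (ha.mem.1.trans hx.1)).deriv]
    have h1 := hg.concaveOn.min_le_of_mem_Icc ⟨ha.mem.1.le, ha.mem.2.le⟩
      ⟨hb.mem.1.le, hb.mem.2.le⟩ (z := x) ⟨hx.1.le, hx.2.le⟩
    have h2 := ha.reaction_pos
    have h3 := hb.reaction_pos
    unfold reaction at *
    rcases min_le_iff.1 h1 with h | h
    · have := mul_le_mul_of_nonneg_left h hl.le; linarith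
    · have := mul_le_mul_of_nonneg_left h hl.le; linarith

/-- For fixed parameters, the admissible maxima form an interval. -/
theorem Adm.between (ha : Adm g σ l m a) (hb : Adm g σ l m b) (hg : IsLogisticGrowth g σ) {x : ℝ}
    (hx : x ∈ Ioo a b) : Adm g σ l m x ∧ 0 < primF g m l x := by
  have hF : 0 < primF g m l x :=
    ha.primF_nonneg.trans_lt (strictMonoOn_primF hg ha.l_pos ha hb
      (left_mem_Icc.2 (hx.1.trans hx.2).le) ⟨hx.1.le, hx.2.le⟩ hx.1)
  refine ⟨⟨ha.l_pos, ⟨ha.mem.1.trans hx.1, hx.2.trans hb.mem.2⟩, hF.le, ?_⟩, hF⟩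
  have h1 := hg.concaveOn.min_le_of_mem_Icc ⟨ha.mem.1.le, ha.mem.2.le⟩
    ⟨hb.mem.1.le, hb.mem.2.le⟩ (z := x) ⟨hx.1.le, hx.2.le⟩
  have h2 := ha.reaction_pos
  have h3 := hb.reaction_pos
  unfold reaction at *
  rcases min_le_iff.1 h1 with h | h
  · have := mul_le_mul_of_nonneg_left h ha.l_pos.le; linarith
  · have := mul_le_mul_of_nonneg_left h ha.l_pos.le; linarith

/-- Concavity of the scaled gap in `1/a` combines with the convexity `perspective_lt`, because the
kernel decreases in the gap. -/
theorem Adm.timeMap_lt_convex (ha : Adm g σ l m a) (hb : Adm g σ l m b) (hg : IsLogisticGrowth g σ)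
    (hab : a ≠ b) {p q : ℝ} (hp : 0 < p) (hq : 0 < q) (hpq : p + q = 1)
    (hd : Adm g σ l m (1 / (p * (1 / a) + q * (1 / b)))) :
    timeMap g l m (1 / (p * (1 / a) + q * (1 / b))) < p * timeMap g l m a + q * timeMap g l m b := by
  unfold timeMap
  rw [← MeasureTheory.integral_const_mul, ← MeasureTheory.integral_const_mul,
    ← MeasureTheory.integral_add ((ha.integrableOn hg).const_mul _)
      ((hb.integrableOn hg).const_mul _)]
  apply setIntegral_Ioo_lt (hd.integrableOn hg)
    (((ha.integrableOn hg).const_mul _).add ((hb.integrableOn hg).const_mul _))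
  intro s hs
  have ha0 := ha.mem.1
  have hb0 := hb.mem.1
  have hga := ha.gap_pos hg hs
  have hgb := hb.gap_pos hg hs
  have hgd := hd.gap_pos hg hs
  have hz : 0 < p * (1 / a) + q * (1 / b) := by positivity
  set d := 1 / (p * (1 / a) + q * (1 / b)) with hdd
  have hd0 : 0 < d := by positivity
  have hdz : p * (1 / a) + q * (1 / b) = 1 / d := by rw [hdd]; field_simp
  have h1 := gap_div_sq_concave (m := m) hg ha.l_pos.le ha.mem' hb.mem' hp hq hpq
    (s := s) ⟨hs.1.le, hs.2.le⟩
  rw [← hdd] at h1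
  have h2 := perspective_lt (w₀ := gap g l m a s / a ^ 2) (w₁ := gap g l m b s / b ^ 2)
    (z₀ := 1 / a) (z₁ := 1 / b) (by positivity) (by positivity) (by positivity) (by positivity)
    (fun h => hab (by simpa using h)) hp hq hpq
  rw [hdz] at h2
  have hscale : ∀ x y : ℝ, 0 < x → kern (y / x ^ 2 / (1 / x) ^ 2) / (1 / x) = x * kern y := by
    intro x y hx
    have : y / x ^ 2 / (1 / x) ^ 2 = y := by field_simp
    rw [this]; field_simp
  rw [hscale a _ ha0, hscale b _ hb0] at h2
  refine lt_of_le_of_lt ?_ h2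
  rw [div_div_eq_mul_div, div_one, mul_comm d]
  apply mul_le_mul_of_nonneg_right _ hd0.le
  have hpos : 0 < p * (gap g l m a s / a ^ 2) + q * (gap g l m b s / b ^ 2) := by positivity
  apply kern_strictAntiOn.antitoneOn (mem_Ioi.2 (by positivity)) (mem_Ioi.2 hgd)
  calc (p * (gap g l m a s / a ^ 2) + q * (gap g l m b s / b ^ 2)) / (1 / d) ^ 2
      ≤ (gap g l m d s / d ^ 2) / (1 / d) ^ 2 := by gcongr
    _ = gap g l m d s := by field_simp

/-- The time map is strictly quasiconvex in `a`. -/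
theorem Adm.timeMap_lt_max (ha : Adm g σ l m a) (hb : Adm g σ l m b) (hg : IsLogisticGrowth g σ)
    {x : ℝ} (hx : x ∈ Ioo a b) : timeMap g l m x < max (timeMap g l m a) (timeMap g l m b) := by
  have ha0 := ha.mem.1
  have hb0 := hb.mem.1
  have hx0 := ha0.trans hx.1
  have hab := hx.1.trans hx.2
  have h1 : 0 < 1 / a - 1 / b := sub_pos.2 (one_div_lt_one_div_of_lt ha0 hab)
  have h2 : 0 < 1 / x - 1 / b := sub_pos.2 (one_div_lt_one_div_of_lt hx0 hx.2)
  have h3 : 0 < 1 / a - 1 / x := sub_pos.2 (one_div_lt_one_div_of_lt ha0 hx.1)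
  set p := (1 / x - 1 / b) / (1 / a - 1 / b) with hp
  set q := (1 / a - 1 / x) / (1 / a - 1 / b) with hq
  have hp0 : 0 < p := by positivity
  have hq0 : 0 < q := by positivity
  have hpq : p + q = 1 := by rw [hp, hq, ← add_div, div_eq_one_iff_eq h1.ne']; ring
  have hz : p * (1 / a) + q * (1 / b) = 1 / x := by
    rw [hp, hq, div_mul_eq_mul_div, div_mul_eq_mul_div, ← add_div, div_eq_iff h1.ne']
    ring
  have hxe : 1 / (p * (1 / a) + q * (1 / b)) = x := by rw [hz, one_div_one_div]
  have h := ha.timeMap_lt_convex hb hg hab.ne hp0 hq0 hpq (by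
    rw [hxe]; exact (ha.between hb hg hx).1)
  rw [hxe] at h
  have h4 := mul_le_mul_of_nonneg_left (le_max_left (timeMap g l m a) (timeMap g l m b)) hp0.le
  have h5 := mul_le_mul_of_nonneg_left (le_max_right (timeMap g l m a) (timeMap g l m b)) hq0.le
  have h6 : p * max (timeMap g l m a) (timeMap g l m b) + q * max (timeMap g l m a) (timeMap g l m b)
    = max (timeMap g l m a) (timeMap g l m b) := by rw [← add_mul, hpq, one_mul]
  linarith

/-! The branch `primF = 0`, on which solutions have zero slope at the end points. -/

/-- Secants of a concave function are compared through the intermediate chord from `x` to `y'`. The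
value `x = 0` is allowed and is used in `IsCStar.branch_lower`. -/
theorem mean_slope_anti (hg : IsLogisticGrowth g σ) {x y x' y' : ℝ} (hx : 0 ≤ x) (hxy : x < y)
    (hxx : x ≤ x') (hyy : y ≤ y') (hxy' : x' < y') (hy' : y' ≤ σ) :
    (primG g y' / y' - primG g x' / x') / (y' - x') ≤ (primG g y / y - primG g x / x) / (y - x) := by
  have hcv := hg.mean_concaveOn.neg
  have mx : x ∈ Icc 0 σ := ⟨hx, by linarith⟩
  have my : y ∈ Icc 0 σ := ⟨by linarith, by linarith⟩
  have mx' : x' ∈ Icc 0 σ := ⟨by linarith, by linarith⟩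
  have my' : y' ∈ Icc 0 σ := ⟨by linarith, hy'⟩
  have h1 := hcv.secant_mono mx my my' hxy.ne' (by linarith) hyy
  have h2 := hcv.secant_mono my' mx mx' (by linarith) hxy'.ne hxx
  simp only [Pi.neg_apply] at h1 h2
  have e1 : (-(primG g x / x) - -(primG g y' / y')) / (x - y') =
      (-(primG g y' / y') - -(primG g x / x)) / (y' - x) := by
    rw [← neg_sub y' x, div_neg, ← neg_div]; ring
  have e2 : (-(primG g x' / x') - -(primG g y' / y')) / (x' - y') =
      -((primG g y' / y' - primG g x' / x') / (y' - x')) := by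
    rw [← neg_sub y' x', div_neg]; ring
  have e3 : (-(primG g y / y) - -(primG g x / x)) / (y - x) =
      -((primG g y / y - primG g x / x) / (y - x)) := by ring
  rw [e3] at h1
  rw [e1, e2] at h2
  linarith

/-- Here `F(a) = 0`, so the gap is `-F(as)`, a difference of two means. The factor `a²` is extracted
to suit `mul_kern_lt_of_le`. -/
theorem gap_branch (ha : a ≠ 0) {s : ℝ} (hs : s ≠ 0) :
    gap g l (l * (primG g a / a)) a s =
      a ^ 2 * (l * s * ((primG g a / a - primG g (a * s) / (a * s)) / a)) := by
  unfold gap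
  field_simp
  ring

theorem IsCStar.mean_lt (hc : IsCStar g σ c) (hg : IsLogisticGrowth g σ) (ha : a ∈ Ioo 0 c) :
    primG g a / a < g a := by
  rw [div_lt_iff₀ ha.1]; exact hc.primG_lt hg ha

theorem IsCStar.mean_pos (hc : IsCStar g σ c) (hg : IsLogisticGrowth g σ) (ha : a ∈ Ioc 0 c) :
    0 < primG g a / a :=
  div_pos (hg.primG_pos ⟨ha.1, ha.2.trans hc.mem.2.le⟩) ha.1

theorem IsCStar.adm_branch (hc : IsCStar g σ c) (hg : IsLogisticGrowth g σ) (hl : 0 < l)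
    (ha : a ∈ Ioo 0 c) : Adm g σ l (l * (primG g a / a)) a := by
  refine ⟨hl, ⟨ha.1, ha.2.trans hc.mem.2⟩, ?_, ?_⟩
  · unfold primF
    have := ha.1
    apply le_of_eq; field_simp; ring
  · unfold reaction
    have := mul_lt_mul_of_pos_left (hc.mean_lt hg ha) hl
    linarith

/-- On the branch `primF = 0`, the time map increases with `a` and decreases with `l`. -/
theorem IsCStar.branch_lt (hc : IsCStar g σ c) (hg : IsLogisticGrowth g σ) {l' : ℝ} (hl' : 0 < l')
    (hll : l' ≤ l) (ha : 0 < a) (hab : a ≤ b) (hb : b < c) (hne : l' < l ∨ a < b) :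
    timeMap g l (l * (primG g a / a)) a < timeMap g l' (l' * (primG g b / b)) b := by
  have hA := hc.adm_branch hg (hl'.trans_le hll) ⟨ha, hab.trans_lt hb⟩
  have hB := hc.adm_branch hg hl' ⟨ha.trans_le hab, hb⟩
  have hb0 := ha.trans_le hab
  apply setIntegral_Ioo_lt (hA.integrableOn hg) (hB.integrableOn hg)
  intro s hs
  have hgA := hA.gap_pos hg hs
  have hgB := hB.gap_pos hg hs
  rw [gap_branch ha.ne' hs.1.ne'] at hgA ⊢
  rw [gap_branch hb0.ne' hs.1.ne'] at hgB ⊢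
  have hwA := (mul_pos_iff_of_pos_left (by positivity)).1 hgA
  have hwB := (mul_pos_iff_of_pos_left (by positivity)).1 hgB
  have hls : 0 < l' * s := mul_pos hl' hs.1
  have hslope := mean_slope_anti hg (x := a * s) (y := a) (x' := b * s) (y' := b)
    (by have := hs.1; positivity) (by nlinarith [hs.2]) (by nlinarith [hs.1]) hab
    (by nlinarith [hs.2]) (hb.trans hc.mem.2).le
  have hs1 : 0 < 1 - s := sub_pos.2 hs.2
  have e1 : ∀ x y : ℝ, 0 < x → y / (x - x * s) * (1 - s) = y / x := by
    intro x y hx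
    have : x - x * s = x * (1 - s) := by ring
    rw [this]; field_simp
  have hslope' := mul_le_mul_of_nonneg_right hslope hs1.le
  rw [e1 a _ ha, e1 b _ hb0] at hslope'
  set ωA := (primG g a / a - primG g (a * s) / (a * s)) / a
  set ωB := (primG g b / b - primG g (b * s) / (b * s)) / b
  have hωB : 0 < ωB := (mul_pos_iff_of_pos_left hls).1 hwB
  have hle : l' * s * ωB ≤ l * s * ωA := by
    have h1 : l' * s ≤ l * s := mul_le_mul_of_nonneg_right hll hs.1.le
    exact mul_le_mul h1 hslope' hωB.le (hls.le.trans h1)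
  rcases eq_or_lt_of_le hab with heq | hlt
  · rcases hne with h | h
    · have hlt : l' * s * ωB < l * s * ωA := by
        have h1 : l' * s < l * s := mul_lt_mul_of_pos_right h hs.1
        calc l' * s * ωB < l * s * ωB := mul_lt_mul_of_pos_right h1 hωB
          _ ≤ l * s * ωA := mul_le_mul_of_nonneg_left hslope' (hls.le.trans h1.le)
      rw [heq] at hgA ⊢
      apply mul_lt_mul_of_pos_left _ hb0
      exact kern_strictAntiOn hgB hgA (mul_lt_mul_of_pos_left hlt (by positivity))
    · exact absurd heq h.ne
  · exact mul_kern_lt_of_le ha hlt hwB hle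

/-- The secant of the concave mean to the right of `a` is flatter than those to its left, so the gap
is at least `a² l D s(1 - s)`, a weight whose inverse square root integrates to `π`. -/
theorem IsCStar.branch_upper (hc : IsCStar g σ c) (hg : IsLogisticGrowth g σ) (hl : 0 < l)
    (ha : a ∈ Ioo 0 c) (hab : a < b) (hb : b ≤ c) :
    timeMap g l (l * (primG g a / a)) a ≤
      a + 1 / √(2 * (l * ((primG g b / b - primG g a / a) / (b - a)))) * Real.pi := by
  have hA := hc.adm_branch hg hl ha
  have hD : 0 < (primG g b / b - primG g a / a) / (b - a) := by
    apply div_pos _ (sub_pos.2 hab)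
    exact sub_pos.2 (hc.mean_strictMonoOn hg ⟨ha.1, ha.2.le⟩ ⟨ha.1.trans hab, hb⟩ hab)
  set D := (primG g b / b - primG g a / a) / (b - a) with hDdef
  have := hA.timeMap_le_of_le_gap hg (φ := fun s => s * (1 - s)) (e := 2 * (l * D)) (by positivity)
    (fun s hs => mul_pos hs.1 (sub_pos.2 hs.2)) integrableOn_one_div_sqrt_mul ?_
  · rwa [integral_one_div_sqrt_mul] at this
  intro s hs
  have ha0 := ha.1
  rw [gap_branch ha0.ne' hs.1.ne']
  have hslope := mean_slope_anti hg (x := a * s) (y := a) (x' := a) (y' := b)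
    (by have := hs.1; positivity) (by nlinarith [hs.2]) (by nlinarith [hs.2]) hab.le hab
    (hb.trans hc.mem.2.le)
  rw [← hDdef, le_div_iff₀ (by nlinarith [hs.2])] at hslope
  have h1 : D * (1 - s) ≤ (primG g a / a - primG g (a * s) / (a * s)) / a := by
    rw [le_div_iff₀ ha0]; linarith
  have h2 : 0 ≤ 2 * (a ^ 2 * (l * s)) := by have := hs.1; positivity
  have := mul_le_mul_of_nonneg_left h1 h2
  linarith

theorem primG_le_of_le_mul (hg : IsLogisticGrowth g σ) {d : ℝ} {v w : ℝ} (hv : 0 ≤ v) (hvw : v ≤ w)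
    (hd : ∀ u ∈ Icc v w, g u ≤ d * u) : primG g w - primG g v ≤ d * (w ^ 2 - v ^ 2) / 2 := by
  rw [hg.primG_sub hv (hv.trans hvw)]
  have h1 := intervalIntegral.integral_mono_on hvw (hg.intervalIntegrable hv (hv.trans hvw))
    (g := fun u => d * u) (by apply Continuous.intervalIntegrable; fun_prop) hd
  rw [intervalIntegral.integral_const_mul, integral_id] at h1
  linarith

/-- From `g(u) ≤ du` the mean is at most `dv/2` at `v`, so by concavity all its secants have slope
at most `d/2`; the model weight is again `s(1 - s)`. -/
theorem IsCStar.branch_lower (hc : IsCStar g σ c) (hg : IsLogisticGrowth g σ) (hl : 0 < l)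
    (ha : a ∈ Ioo 0 c) {d : ℝ} (hd0 : 0 < d) (hd : ∀ u ∈ Icc 0 σ, g u ≤ d * u) :
    1 / √(l * d) * Real.pi ≤ timeMap g l (l * (primG g a / a)) a := by
  have hA := hc.adm_branch hg hl ha
  have := hA.le_timeMap_of_gap_le hg (φ := fun s => s * (1 - s)) (e := l * d) (by positivity)
    (fun s hs => mul_pos hs.1 (sub_pos.2 hs.2)) integrableOn_one_div_sqrt_mul ?_
  · rwa [integral_one_div_sqrt_mul] at this
  intro s hs
  have ha0 := ha.1
  have hs0 := hs.1
  have has : 0 < a * s := by positivity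
  have hasl : a * s < a := by nlinarith [hs.2]
  rw [gap_branch ha0.ne' hs.1.ne']
  have hslope := mean_slope_anti hg (x := 0) (y := a * s) (x' := a * s) (y' := a)
    le_rfl has has.le hasl.le hasl (ha.2.trans hc.mem.2).le
  have h0 := primG_le_of_le_mul hg le_rfl has.le (d := d) fun u hu => hd u ⟨hu.1, by
    linarith [hu.2, hc.mem.2, ha.2]⟩
  simp only [div_zero, sub_zero, IsLogisticGrowth.primG_zero] at hslope h0
  have h1 : primG g (a * s) / (a * s) / (a * s) ≤ d / 2 := by
    rw [div_div, div_le_iff₀ (by positivity)]; nlinarith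
  have h2 := hslope.trans h1
  rw [div_le_iff₀ (by linarith)] at h2
  have h3 : (primG g a / a - primG g (a * s) / (a * s)) / a ≤ d / 2 * (1 - s) := by
    rw [div_le_iff₀ ha0]; linarith
  have h4 : 0 ≤ 2 * (a ^ 2 * (l * s)) := by positivity
  have := mul_le_mul_of_nonneg_left h3 h4
  linarith

/-! The unharvested problem `m = 0`. -/

theorem adm_zero (hg : IsLogisticGrowth g σ) (hl : 0 < l) (ha : a ∈ Ioo 0 σ) : Adm g σ l 0 a := by
  refine ⟨hl, ha, ?_, ?_⟩
  · unfold primF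
    have := mul_pos hl (hg.primG_pos ⟨ha.1, ha.2.le⟩)
    linarith
  · unfold reaction
    have := mul_pos hl (hg.pos ha.1 ha.2)
    linarith

/-- Without harvesting the gap divided by `a²` cannot increase with `a`, because `g(at)/a` does not;
`mul_kern_lt_of_le` then applies. -/
theorem timeMap_zero_lt (hg : IsLogisticGrowth g σ) (hl : 0 < l) (ha : 0 < a) (hab : a < b)
    (hb : b < σ) : timeMap g l 0 a < timeMap g l 0 b := by
  have hA := adm_zero hg hl ⟨ha, hab.trans hb⟩
  have hB := adm_zero hg hl ⟨ha.trans hab, hb⟩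
  have hb0 := ha.trans hab
  apply setIntegral_Ioo_lt (hA.integrableOn hg) (hB.integrableOn hg)
  intro s hs
  have hgB := hB.gap_pos hg hs
  have eA : gap g l 0 a s = a ^ 2 * (gap g l 0 a s / a ^ 2) := by field_simp
  have eB : gap g l 0 b s = b ^ 2 * (gap g l 0 b s / b ^ 2) := by field_simp
  rw [eA, eB]
  apply mul_kern_lt_of_le ha hab (by positivity)
  rw [gap_div_sq hg ha hs.1.le, gap_div_sq hg hb0 hs.1.le]
  have hs' : s ∈ Icc (0:ℝ) 1 := ⟨hs.1.le, hs.2.le⟩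
  have : (∫ t in s..1, g (b * t) / b) ≤ ∫ t in s..1, g (a * t) / a := by
    apply intervalIntegral.integral_mono_on hs.2.le ((hg.integrable_mul hb0.le hs').div_const b)
      ((hg.integrable_mul ha.le hs').div_const a)
    intro t ht
    have ht0 : 0 ≤ t := hs.1.le.trans ht.1
    have h1 := hg.mul_le (a := b * t) (t := a / b)
      ⟨by positivity, (mul_le_of_le_one_right hb0.le ht.2).trans hb.le⟩
      ⟨by positivity, div_le_one_of_le₀ hab.le hb0.le⟩
    have e1 : b * t * (a / b) = a * t := by field_simp
    rw [e1] at h1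
    rw [le_div_iff₀ ha]
    calc g (b * t) / b * a = a / b * g (b * t) := by ring
      _ ≤ _ := h1
  have := mul_le_mul_of_nonneg_left this hl.le
  linarith

theorem one_sub_sq_pos_of_mem {s : ℝ} (hs : s ∈ Ioo (0:ℝ) 1) : 0 < 1 - s ^ 2 := by
  nlinarith [hs.1, hs.2]

/-- The chord bound `g(at) ≥ t g(a)` replaces `g` by a linear function. The weight becomes `1 - s²`,
which contributes `π/2`. -/
theorem timeMap_zero_le (hg : IsLogisticGrowth g σ) (hl : 0 < l) (ha : a ∈ Ioo 0 σ) :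
    timeMap g l 0 a ≤ a + 1 / √(l * (g a / a)) * (Real.pi / 2) := by
  have hA := adm_zero hg hl ha
  have hga := hg.pos ha.1 ha.2
  have ha0 := ha.1
  have := hA.timeMap_le_of_le_gap hg (φ := fun s => 1 - s ^ 2) (e := l * (g a / a)) (by positivity)
    (fun s hs => one_sub_sq_pos_of_mem hs) integrableOn_one_div_sqrt_one_sub_sq ?_
  · rwa [integral_one_div_sqrt_one_sub_sq] at this
  intro s hs
  have hs' : s ∈ Icc (0:ℝ) 1 := ⟨hs.1.le, hs.2.le⟩
  unfold gap
  rw [hg.primG_sub_mul ha0.le hs.1.le]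
  have h1 : (∫ t in s..1, t * g a) ≤ ∫ t in s..1, g (a * t) := by
    apply intervalIntegral.integral_mono_on hs.2.le
      (by apply Continuous.intervalIntegrable; fun_prop) (hg.integrable_mul ha0.le hs')
    intro t ht
    exact hg.mul_le ⟨ha0.le, ha.2.le⟩ ⟨hs.1.le.trans ht.1, ht.2⟩
  rw [intervalIntegral.integral_mul_const, integral_id] at h1
  have h2 := mul_le_mul_of_nonneg_left h1 (by positivity : 0 ≤ 2 * (l * a))
  have e : l * (g a / a) * a ^ 2 * (1 - s ^ 2) = 2 * (l * a) * ((1 ^ 2 - s ^ 2) / 2 * g a) := by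
    field_simp
  rw [e]
  linarith

theorem Adm.le_timeMap_of_le_mul (h : Adm g σ l m a) (hg : IsLogisticGrowth g σ) (hm : 0 ≤ m)
    {d : ℝ} (hd0 : 0 < d) (hd : ∀ u ∈ Icc 0 σ, g u ≤ d * u) :
    1 / √(l * d) * (Real.pi / 2) ≤ timeMap g l m a := by
  have hl := h.l_pos
  have ha0 := h.mem.1
  have := h.le_timeMap_of_gap_le hg (φ := fun s => 1 - s ^ 2) (e := l * d) (by positivity)
    (fun s hs => one_sub_sq_pos_of_mem hs) integrableOn_one_div_sqrt_one_sub_sq ?_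
  · rwa [integral_one_div_sqrt_one_sub_sq] at this
  intro s hs
  have hs0 := hs.1
  have hasl : a * s ≤ a := by nlinarith [hs.2]
  have h0 := primG_le_of_le_mul hg (by positivity : 0 ≤ a * s) hasl (d := d) fun u hu => hd u ⟨by
    have : 0 ≤ a * s := by positivity
    linarith [hu.1], by linarith [hu.2, h.mem.2]⟩
  have h1 := mul_le_mul_of_nonneg_left h0 hl.le
  have h2 : 0 ≤ m * (a * (1 - s)) := mul_nonneg hm (mul_nonneg ha0.le (by linarith [hs.2]))
  unfold gap
  nlinarith

end


/-! ### The infinite negative slope of the time map where `F` vanishes. -/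

section

variable {g : ℝ → ℝ} {σ l m a b c L : ℝ}

theorem tendsto_kern_zero : Tendsto kern (𝓝[>] 0) atTop := by
  have h1 : Tendsto (fun x : ℝ => √(2 * x)) (𝓝[>] 0) (𝓝[>] 0) := by
    apply tendsto_nhdsWithin_of_tendsto_nhds_of_eventually_within
    · have : Continuous fun x : ℝ => √(2 * x) := by fun_prop
      have h := this.tendsto 0
      simp only [mul_zero, Real.sqrt_zero] at h
      exact h.mono_left nhdsWithin_le_nhds
    · filter_upwards [self_mem_nhdsWithin] with x hx
      exact Real.sqrt_pos.2 (mul_pos two_pos hx)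
  have h2 : Tendsto (fun x : ℝ => 1 / √(2 * x)) (𝓝[>] 0) atTop := by
    simp_rw [one_div]
    exact tendsto_inv_nhdsGT_zero.comp h1
  apply tendsto_atTop_mono' _ _ h2
  filter_upwards [self_mem_nhdsWithin] with x hx using le_kern hx

/-- The value tends to infinity as `η → 0`, since `kern` blows up at `0`; this is the source of the
infinite slope. -/
theorem integral_kernD_affine {η C : ℝ} (hη : 0 < η) (hC : 0 < C) :
    MeasureTheory.IntegrableOn (fun s => kernD (η + C * s)) (Ioo 0 1) ∧
    ∫ s in Ioo (0:ℝ) 1, kernD (η + C * s) = (kern η - kern (η + C)) / C := by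
  have hpos : ∀ s ∈ Icc (0:ℝ) 1, 0 < η + C * s := fun s hs => by
    have := mul_nonneg hC.le hs.1; linarith
  have hcont : ContinuousOn (fun s => kernD (η + C * s)) (Icc 0 1) :=
    continuousOn_kernD.comp (by fun_prop) hpos
  refine ⟨hcont.integrableOn_Icc.mono_set Ioo_subset_Icc_self, ?_⟩
  rw [← MeasureTheory.integral_Ioc_eq_integral_Ioo, ← intervalIntegral.integral_of_le zero_le_one]
  have hd : ∀ s ∈ uIcc (0:ℝ) 1, HasDerivAt (fun s => -kern (η + C * s) / C)
      (kernD (η + C * s)) s := by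
    intro s hs
    rw [uIcc_of_le zero_le_one] at hs
    have h1 : HasDerivAt (fun s : ℝ => η + C * s) C s := by
      simpa using ((hasDerivAt_id' s).const_mul C).const_add η
    have h2 := (((hasDerivAt_kern (hpos s hs)).comp s h1).fun_neg).div_const C
    refine h2.congr_deriv ?_
    field_simp
  rw [intervalIntegral.integral_eq_sub_of_hasDerivAt hd]
  · simp only [mul_one, mul_zero, add_zero]; field_simp; ring
  · apply ContinuousOn.intervalIntegrable
    rwa [uIcc_of_le zero_le_one]

theorem hasDerivAt_gap_left (hg : IsLogisticGrowth g σ) (ha : 0 < a) {s : ℝ} (hs : 0 < s) :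
    HasDerivAt (fun a => gap g l m a s) (reaction g m l a - s * reaction g m l (a * s)) a := by
  have h1 : HasDerivAt (fun a : ℝ => a * s) s a := by
    simpa using (hasDerivAt_id' a).mul_const s
  have h2 := ((hg.hasDerivAt_primG ha).fun_sub
    ((hg.hasDerivAt_primG (mul_pos ha hs)).comp a h1)).const_mul l
  have h3 := ((hasDerivAt_id' a).mul_const (1 - s)).const_mul m
  refine (h2.fun_sub h3).congr_deriv ?_
  unfold reaction
  ring

theorem reaction_sub_lower (hg : IsLogisticGrowth g σ) (hl : 0 < l) {x : ℝ}
    (hb : b ∈ Ioo 0 σ) (hx : x ∈ Ioo 0 σ) (hbx : b ≤ x) {s : ℝ} (hs : s ∈ Ioo (0:ℝ) 1) :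
    -((l * (σ * |deriv g x|) + m) * (1 - s)) ≤ reaction g m l b - s * reaction g m l (b * s) := by
  have hbs : b * s ∈ Icc 0 σ := by
    have := mul_pos hb.1 hs.1
    constructor
    · exact this.le
    · exact (mul_le_of_le_one_right hb.1.le hs.2.le).trans hb.2.le
  have h1 := hg.tangent hb hbs
  have h2 : -|deriv g x| ≤ deriv g b :=
    (neg_abs_le _).trans (hg.deriv_strictAntiOn.antitoneOn hb hx hbx)
  have h3 := hg.nonneg hbs
  have hs1 : 0 < 1 - s := sub_pos.2 hs.2
  have h4 : -(σ * |deriv g x|) * (1 - s) ≤ g b - g (b * s) := by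
    have e1 : -|deriv g x| * (b * (1 - s)) ≤ deriv g b * (b * (1 - s)) :=
      mul_le_mul_of_nonneg_right h2 (mul_nonneg hb.1.le hs1.le)
    have e2 : |deriv g x| * (b * (1 - s)) ≤ |deriv g x| * (σ * (1 - s)) :=
      mul_le_mul_of_nonneg_left (mul_le_mul_of_nonneg_right hb.2.le hs1.le) (abs_nonneg _)
    nlinarith
  have h5 := mul_le_mul_of_nonneg_left h4 hl.le
  have h6 := mul_nonneg (mul_nonneg hl.le hs1.le) h3
  unfold reaction
  linarith

set_option maxHeartbeats 400000 in
/-- At a point where `primF` vanishes, the time map decreases with infinite slope. -/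
theorem Adm.exists_timeMap_lt (h : Adm g σ l m a) (hg : IsLogisticGrowth g σ) (hm : 0 < m)
    (hF : primF g m l a = 0) :
    ∃ b, a < b ∧ Adm g σ l m b ∧ timeMap g l m b < timeMap g l m a := by
  have ha0 := h.mem.1
  have hl := h.l_pos
  set φ := reaction g m l a with hφ
  have hφ0 : 0 < φ := h.reaction_pos
  -- a neighbourhood to the right of `a` of admissible points
  have hrc : Tendsto (fun x => reaction g m l x) (𝓝 a) (𝓝 φ) :=
    tendsto_reaction hg ha0 tendsto_const_nhds tendsto_const_nhds tendsto_id
  obtain ⟨x, hax, hxs, hxr⟩ : ∃ x, a < x ∧ x < σ ∧ ∀ b ∈ Icc a x, φ / 2 < reaction g m l b := by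
    have h1 := hrc.eventually (lt_mem_nhds (half_lt_self hφ0))
    obtain ⟨p, q, hpq, hsub⟩ := mem_nhds_iff_exists_Ioo_subset.1 h1
    have h2 : a < min q σ := lt_min hpq.2 h.mem.2
    obtain ⟨x, hx1, hx2⟩ := exists_between h2
    exact ⟨x, hx1, hx2.trans_le (min_le_right _ _), fun b hb =>
      hsub ⟨hpq.1.trans_le hb.1, hb.2.trans_lt (hx2.trans_le (min_le_left _ _))⟩⟩
  have hFb : ∀ b ∈ Icc a x, φ / 2 * (b - a) ≤ primF g m l b := by
    intro b hb
    rcases eq_or_lt_of_le hb.1 with he | hlt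
    · rw [← he, hF]; simp
    obtain ⟨y, hy, hy'⟩ := exists_hasDerivAt_eq_slope (primF g m l) (reaction g m l) hlt
      (fun y hy => (hasDerivAt_primF hg (ha0.trans_le hy.1)).continuousAt.continuousWithinAt)
      (fun y hy => hasDerivAt_primF hg (ha0.trans hy.1))
    rw [hF, sub_zero, eq_div_iff (by linarith)] at hy'
    rw [← hy']
    exact mul_le_mul_of_nonneg_right (hxr y ⟨hy.1.le, hy.2.le.trans hb.2⟩).le (by linarith)
  have hAb : ∀ b ∈ Icc a x, Adm g σ l m b := fun b hb =>
    ⟨hl, ⟨ha0.trans_le hb.1, hb.2.trans_lt hxs⟩,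
      (mul_nonneg (by linarith) (by linarith [hb.1])).trans (hFb b hb),
      (by linarith : (0:ℝ) < φ / 2).trans (hxr b hb)⟩
  -- near zero the reaction term is negative
  obtain ⟨v, hv0, hvs, hv⟩ : ∃ v, 0 < v ∧ v < x ∧ ∀ y ∈ Ioo 0 v, reaction g m l y < 0 := by
    have h1 : Tendsto (fun y => reaction g m l y) (𝓝[>] 0) (𝓝 (reaction g m l 0)) := by
      have := (hg.continuousOn 0 self_mem_Ici).mono Ioi_subset_Ici_self
      exact (tendsto_const_nhds.mul this.tendsto).sub tendsto_const_nhds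
    have h2 : reaction g m l 0 < 0 := by unfold reaction; rw [hg.map_zero]; linarith
    obtain ⟨v, hv, hsub⟩ := mem_nhdsGT_iff_exists_Ioo_subset.1 (h1.eventually (gt_mem_nhds h2))
    have hx0 := ha0.trans hax
    refine ⟨min v (x / 2), lt_min hv (by linarith), (min_le_right _ _).trans_lt (by linarith),
      fun y hy => hsub ⟨hy.1, hy.2.trans_le (min_le_left _ _)⟩⟩
  have hx0 : 0 < x := ha0.trans hax
  -- For `s < s₁` and `b < x` the point `bs` lies where the reaction is negative. Of the constants
  -- below, `C` bounds the loss of gap per unit of `b`, `c₃ (1 - s)` bounds the gap from below on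
  -- `[s₁, 1)`, and `C₂` is the slope of an affine bound from above.
  set s₁ := v / x with hs₁
  have hs₁0 : 0 < s₁ := by positivity
  have hσ := hg.sigma_pos
  set C := l * (σ * |deriv g x|) + m with hC
  have hC0 : 0 < C := by positivity
  set c₃ := s₁ * (a * φ / 2) with hc₃
  have hc₃0 : 0 < c₃ := by positivity
  set C₂ := m * σ with hC₂
  have hC₂0 : 0 < C₂ := by positivity
  set C₄ := C / (c₃ * √c₃) with hC₄
  have hC₄0 : 0 < C₄ := by have := Real.sqrt_pos.2 hc₃0; positivity
  -- With this choice `kernD (η + C₂ s) - K₃ ≤ 0` for `s ≥ s₁`, so the gain obtained on `(0, s₁)`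
  -- can be written by one formula on all of `(0, 1)`.
  set K₃ := kernD (C₂ * s₁) with hK₃
  have hK₃0 : 0 < K₃ := kernD_pos (by positivity)
  -- choice of `b`
  set B := (1 + Real.pi / √(a * φ)) + a * (C₄ * Real.pi + φ / 2 * K₃) with hB
  obtain ⟨b, hb, hbk⟩ : ∃ b ∈ Ioo a x,
      B < a * (φ / 2) * ((kern (primF g m l b) - kern C₂) / C₂) := by
    have h1 : Tendsto (fun b => primF g m l b) (𝓝[>] a) (𝓝[>] 0) := by
      apply tendsto_nhdsWithin_of_tendsto_nhds_of_eventually_within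
      · have := (hasDerivAt_primF (m := m) (l := l) hg ha0).continuousAt.tendsto
        rw [hF] at this
        exact this.mono_left nhdsWithin_le_nhds
      · filter_upwards [Ioo_mem_nhdsGT hax] with b hb
        exact (mul_pos (by linarith) (by linarith [hb.1])).trans_le (hFb b ⟨hb.1.le, hb.2.le⟩)
    have h2 : Tendsto (fun b => a * (φ / 2) * ((kern (primF g m l b) - kern C₂) / C₂)) (𝓝[>] a)
        atTop := by
      apply Tendsto.const_mul_atTop (by positivity)
      apply Tendsto.atTop_div_const hC₂0
      exact tendsto_atTop_add_const_right _ _ (tendsto_kern_zero.comp h1)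
    obtain ⟨b, hb1, hb2⟩ := ((h2.eventually_gt_atTop B).and (Ioo_mem_nhdsGT hax)).exists
    exact ⟨b, hb2, hb1⟩
  have hb' : b ∈ Icc a x := ⟨hb.1.le, hb.2.le⟩
  have hA := hAb b hb'
  refine ⟨b, hb.1, hA, ?_⟩
  set η := primF g m l b with hη
  have hη0 : 0 < η := (mul_pos (by linarith) (by linarith [hb.1])).trans_le (hFb b hb')
  set d := b - a with hd
  have hd0 : 0 < d := sub_pos.2 hb.1
  have hkD := integral_kernD_affine hη0 hC₂0
  -- estimate of the variation of the gap
  have hD : ∀ s ∈ Ioo (0:ℝ) 1, -(C * (1 - s)) * d ≤ gap g l m b s - gap g l m a s := by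
    intro s hs
    obtain ⟨y, hy, hy'⟩ := exists_hasDerivAt_eq_slope (fun a => gap g l m a s)
      (fun a => reaction g m l a - s * reaction g m l (a * s)) hb.1
      (fun y hy => (hasDerivAt_gap_left hg (ha0.trans_le hy.1) hs.1).continuousAt.continuousWithinAt)
      (fun y hy => hasDerivAt_gap_left hg (ha0.trans hy.1) hs.1)
    rw [eq_div_iff hd0.ne'] at hy'
    rw [← hy']
    apply mul_le_mul_of_nonneg_right _ hd0.le
    exact reaction_sub_lower hg hl ⟨ha0.trans hy.1, hy.2.trans (hb.2.trans hxs)⟩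
      ⟨hx0, hxs⟩ (hy.2.trans hb.2).le hs
  -- For small `s`, `F` decreases between `as` and `bs`, so the gap grows by at least `F(b)`.
  have hD' : ∀ s ∈ Ioo (0:ℝ) s₁, φ / 2 * d ≤ gap g l m b s - gap g l m a s := by
    intro s hs
    have hbs : b * s < v := by
      calc b * s < x * s₁ := mul_lt_mul hb.2 hs.2.le hs.1 hx0.le
        _ = v := by rw [hs₁]; field_simp
    have hsp := hs.1
    have hb0 : 0 < b := ha0.trans hb.1
    have hanti : primF g m l (b * s) ≤ primF g m l (a * s) := by
      have hanti : AntitoneOn (primF g m l) (Icc (a * s) (b * s)) := by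
        apply antitoneOn_of_deriv_nonpos (convex_Icc _ _)
        · exact fun y hy => (hasDerivAt_primF hg
            ((mul_pos ha0 hsp).trans_le hy.1)).continuousAt.continuousWithinAt
        · rw [interior_Icc]
          exact fun y hy => (hasDerivAt_primF hg
            ((mul_pos ha0 hsp).trans hy.1)).differentiableAt.differentiableWithinAt
        · rw [interior_Icc]
          intro y hy
          rw [(hasDerivAt_primF hg ((mul_pos ha0 hsp).trans hy.1)).deriv]
          exact (hv y ⟨(mul_pos ha0 hsp).trans hy.1, hy.2.trans hbs⟩).le
      have hle : a * s ≤ b * s := mul_le_mul_of_nonneg_right hb.1.le hsp.le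
      exact hanti (left_mem_Icc.2 hle) (right_mem_Icc.2 hle) hle
    have e1 := gap_eq (g := g) (l := l) (m := m) hb0.ne' (b * s)
    have e2 := gap_eq (g := g) (l := l) (m := m) ha0.ne' (a * s)
    rw [mul_div_cancel_left₀ _ hb0.ne'] at e1
    rw [mul_div_cancel_left₀ _ ha0.ne'] at e2
    rw [e1, e2, hF]
    have := hFb b hb'
    linarith
  have hupper : ∀ s ∈ Ioo (0:ℝ) 1, gap g l m b s ≤ η + C₂ * s := by
    intro s hs
    have hb0 : 0 < b := ha0.trans hb.1
    have e1 := gap_eq (g := g) (l := l) (m := m) hb0.ne' (b * s)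
    rw [mul_div_cancel_left₀ _ hb0.ne'] at e1
    rw [e1, ← hη]
    have hbs0 : 0 < b * s := mul_pos hb0 hs.1
    have hbs : b * s ≤ σ * s := mul_le_mul_of_nonneg_right hA.mem.2.le hs.1.le
    have hG := hg.primG_pos (a := b * s)
      ⟨hbs0, (mul_le_of_le_one_right hb0.le hs.2.le).trans hA.mem.2.le⟩
    have := mul_pos hl hG
    have := mul_le_mul_of_nonneg_left hbs hm.le
    have e2 : primF g m l (b * s) = l * primG g (b * s) - m * (b * s) := rfl
    rw [e2, hC₂]
    linarith
  have hlower : ∀ s ∈ Ico s₁ 1, c₃ * (1 - s) ≤ gap g l m b s := by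
    intro s hs
    have h1 := hA.le_gap hg (s := s) ⟨hs₁0.le.trans hs.1, hs.2.le⟩
    refine le_trans ?_ h1
    have h2 : a * φ / 2 ≤ b * reaction g m l b := by
      rw [mul_div_assoc]
      exact mul_le_mul hb.1.le (hxr b hb').le (by linarith) (ha0.trans hb.1).le
    have hs1 : 0 < 1 - s := sub_pos.2 hs.2
    have h3 : s₁ * (a * φ / 2) ≤ s * (b * reaction g m l b) :=
      mul_le_mul hs.1 h2 (by positivity) (hs₁0.le.trans hs.1)
    have h4 := mul_le_mul_of_nonneg_right h3 hs1.le
    rw [hc₃]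
    linarith
  -- pointwise estimate
  have hpt : ∀ s ∈ Ioo (0:ℝ) 1, b * kern (gap g l m b s) - a * kern (gap g l m a s) ≤
      d / b * (b * kern (gap g l m b s)) + (a * d * C₄) * (1 / √(s * (1 - s))) -
        (a * (φ / 2) * d) * (kernD (η + C₂ * s) - K₃) := by
    intro s hs
    have hs1 : 0 < 1 - s := sub_pos.2 hs.2
    have hgb := hA.gap_pos hg hs
    have hga := h.gap_pos hg hs
    have ht := kern_tangent hgb hga
    have hb0 : 0 < b := ha0.trans hb.1
    have hkd := kernD_pos hgb
    have hmain : -(kernD (gap g l m b s) * (gap g l m b s - gap g l m a s)) ≤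
        d * C₄ * (1 / √(s * (1 - s))) - φ / 2 * d * (kernD (η + C₂ * s) - K₃) := by
      have hnn : 0 ≤ d * C₄ * (1 / √(s * (1 - s))) := by positivity
      rcases lt_or_ge s s₁ with hlt | hge
      · have h1 := hD' s ⟨hs.1, hlt⟩
        have hpos : 0 < η + C₂ * s := by have := hs.1; positivity
        have h2 := kernD_strictAntiOn.antitoneOn (mem_Ioi.2 hgb) (mem_Ioi.2 hpos) (hupper s hs)
        have h3 : kernD (η + C₂ * s) * (φ / 2 * d) ≤
            kernD (gap g l m b s) * (gap g l m b s - gap g l m a s) :=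
          mul_le_mul h2 h1 (by positivity) hkd.le
        have h4 : 0 ≤ φ / 2 * d * K₃ := by positivity
        linarith
      · have h1 := hD s hs
        have hsq : 0 < √(1 - s) := Real.sqrt_pos.2 hs1
        have hsc : 0 < √c₃ := Real.sqrt_pos.2 hc₃0
        have hlow := hlower s ⟨hge, hs.2⟩
        have hcp : 0 < c₃ * (1 - s) := by positivity
        have h2 : kernD (gap g l m b s) ≤ 1 / (c₃ * (1 - s) * √(c₃ * (1 - s))) :=
          (kernD_strictAntiOn.antitoneOn (mem_Ioi.2 hcp) (mem_Ioi.2 hgb) hlow).trans (kernD_le hcp)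
        have h3 : kernD (gap g l m b s) * (C * (1 - s) * d) ≤ d * C₄ * (1 / √(1 - s)) := by
          refine (mul_le_mul_of_nonneg_right h2 (by positivity)).trans (le_of_eq ?_)
          rw [Real.sqrt_mul hc₃0.le, hC₄]
          field_simp
        have h4 : 1 / √(1 - s) ≤ 1 / √(s * (1 - s)) := by
          apply one_div_le_one_div_of_le (Real.sqrt_pos.2 (mul_pos hs.1 hs1))
          exact Real.sqrt_le_sqrt (mul_le_of_le_one_left hs1.le hs.2.le)
        have h5 : d * C₄ * (1 / √(1 - s)) ≤ d * C₄ * (1 / √(s * (1 - s))) :=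
          mul_le_mul_of_nonneg_left h4 (by positivity)
        have h6 : kernD (η + C₂ * s) ≤ K₃ := by
          apply kernD_strictAntiOn.antitoneOn (mem_Ioi.2 (by positivity))
            (mem_Ioi.2 (by have := hs.1; positivity))
          have := mul_le_mul_of_nonneg_left hge hC₂0.le
          linarith
        have h7 : 0 ≤ φ / 2 * d * (K₃ - kernD (η + C₂ * s)) :=
          mul_nonneg (by positivity) (sub_nonneg.2 h6)
        have h8 := mul_le_mul_of_nonneg_left h1 hkd.le
        linarith
    have h9 := mul_le_mul_of_nonneg_left hmain ha0.le
    have e1 : d / b * (b * kern (gap g l m b s)) = d * kern (gap g l m b s) := by field_simp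
    rw [e1]
    have e2 : b = d + a := by rw [hd]; ring
    have h10 := mul_le_mul_of_nonneg_left ht ha0.le
    have e3 : b * kern (gap g l m b s) =
        d * kern (gap g l m b s) + a * kern (gap g l m b s) := by
      rw [hd]; ring
    rw [e3]
    linarith
  have hint1 := hA.integrableOn hg
  have hint2 := h.integrableOn hg
  have hint3 := integrableOn_one_div_sqrt_mul.const_mul (a * d * C₄)
  have hint4 : MeasureTheory.IntegrableOn
      (fun s => (a * (φ / 2) * d) * (kernD (η + C₂ * s) - K₃)) (Ioo 0 1) :=
    (hkD.1.sub (MeasureTheory.integrable_const _)).const_mul _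
  have hint5 : MeasureTheory.IntegrableOn (fun s => d / b * (b * kern (gap g l m b s)) +
      a * d * C₄ * (1 / √(s * (1 - s)))) (Ioo 0 1) := (hint1.const_mul (d / b)).add hint3
  have hfin := MeasureTheory.setIntegral_mono_on (hint1.sub hint2)
    (hint5.sub hint4) measurableSet_Ioo hpt
  simp only [Pi.sub_apply] at hfin
  have hTb : timeMap g l m b = ∫ s in Ioo (0:ℝ) 1, b * kern (gap g l m b s) := rfl
  have hTa : timeMap g l m a = ∫ s in Ioo (0:ℝ) 1, a * kern (gap g l m a s) := rfl
  rw [MeasureTheory.integral_sub hint1 hint2, MeasureTheory.integral_sub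
    hint5 hint4, MeasureTheory.integral_add
    (hint1.const_mul (d / b)) hint3, ← hTb, ← hTa, MeasureTheory.integral_const_mul, ← hTb,
    MeasureTheory.integral_const_mul, MeasureTheory.integral_const_mul, integral_one_div_sqrt_mul,
    MeasureTheory.integral_sub hkD.1 (MeasureTheory.integrable_const _), hkD.2,
    MeasureTheory.setIntegral_const] at hfin
  simp only [MeasureTheory.measureReal_def, Real.volume_Ioo, sub_zero, ENNReal.ofReal_one,
    ENNReal.toReal_one, one_smul] at hfin
  have hT : d / b * timeMap g l m b ≤ d * (1 + Real.pi / √(a * φ)) := by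
    have hb0 : 0 < b := ha0.trans hb.1
    have h1 := hA.timeMap_le hg
    have h2 : a * φ ≤ 2 * (b * reaction g m l b) := by
      have := mul_le_mul hb.1.le (hxr b hb').le (by linarith) (ha0.trans hb.1).le
      linarith
    have h3 : Real.pi / √(2 * (b * reaction g m l b)) ≤ Real.pi / √(a * φ) := by
      apply div_le_div_of_nonneg_left Real.pi_pos.le (Real.sqrt_pos.2 (by positivity))
      exact Real.sqrt_le_sqrt h2
    calc d / b * timeMap g l m b ≤ d / b * (b * (1 + Real.pi / √(2 * (b * reaction g m l b)))) :=
          mul_le_mul_of_nonneg_left h1 (by positivity)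
      _ = d * (1 + Real.pi / √(2 * (b * reaction g m l b))) := by field_simp
      _ ≤ d * (1 + Real.pi / √(a * φ)) :=
          mul_le_mul_of_nonneg_left (by linarith) hd0.le
  have hk2 : kern (η + C₂) ≤ kern C₂ :=
    kern_strictAntiOn.antitoneOn (mem_Ioi.2 hC₂0) (mem_Ioi.2 (by positivity)) (by linarith)
  have hk3 : (kern η - kern C₂) / C₂ ≤ (kern η - kern (η + C₂)) / C₂ := by gcongr
  have h11 := mul_le_mul_of_nonneg_left hk3 (by positivity : 0 ≤ a * (φ / 2))
  have h12 : B < a * (φ / 2) * ((kern η - kern (η + C₂)) / C₂) := hbk.trans_le h11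
  have h13 := mul_lt_mul_of_pos_left h12 hd0
  rw [hB] at h13
  linarith

end


/-! ### Level sets of the time map, their starting and turning points. -/

/-- `(l, a)` lies on the level set `timeMap = L`. -/
structure OnCurve (g : ℝ → ℝ) (σ L m l a : ℝ) : Prop where
  adm : Adm g σ l m a
  time : timeMap g l m a = L

/-- `(l, a)` is the starting point of the bifurcation curve, where `primF` vanishes. -/
structure IsStart (g : ℝ → ℝ) (c L m l a : ℝ) : Prop where
  l_pos : 0 < l
  mem : a ∈ Ioo 0 c
  eq : l * (primG g a / a) = m
  time : timeMap g l m a = L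

/-- `(l, a)` is the leftmost point of the bifurcation curve. -/
structure IsTurn (g : ℝ → ℝ) (σ L m l a : ℝ) : Prop where
  onCurve : OnCurve g σ L m l a
  lt : ∀ l' a', OnCurve g σ L m l' a' → a' ≠ a → l < l'

section

variable {g : ℝ → ℝ} {σ l m a b c L l' m' a' : ℝ} {ι : Type*} {F : Filter ι} {li mi ai : ι → ℝ}

theorem OnCurve.unique (h : OnCurve g σ L m l a) (h' : OnCurve g σ L m l' a)
    (hg : IsLogisticGrowth g σ) : l = l' :=
  h.adm.l_eq_of_timeMap_eq h'.adm hg (h.time.trans h'.time.symm)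

theorem OnCurve.lt_L (h : OnCurve g σ L m l a) (hg : IsLogisticGrowth g σ) : a < L :=
  h.time ▸ h.adm.lt_timeMap hg

theorem OnCurve.lt_of_timeMap_lt (h : OnCurve g σ L m l a) (hg : IsLogisticGrowth g σ)
    (h' : Adm g σ l' m a) (hlt : timeMap g l' m a < L) : l < l' := by
  by_contra hle
  have := h'.timeMap_le_of_le_l hg (not_lt.1 hle)
  rw [h.time] at this
  linarith

/-- `Adm.timeMap_le` is solved for the reaction. Together with `OnCurve.lt_l` it confines `l` to a
compact interval depending continuously on `a` and `m`, which gives the compactness needed for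
continuity. -/
theorem OnCurve.l_le (h : OnCurve g σ L m l a) (hg : IsLogisticGrowth g σ) :
    l ≤ (a * Real.pi ^ 2 / (2 * (L - a) ^ 2) + m) / g a := by
  have hL := sub_pos.2 (h.lt_L hg)
  have ha := h.adm.mem.1
  have hga := hg.pos h.adm.mem.1 h.adm.mem.2
  have hr := h.adm.reaction_pos
  have h1 := h.adm.timeMap_le hg
  rw [h.time] at h1
  have hp : 0 < 2 * (a * reaction g m l a) := by positivity
  have hs := Real.sqrt_pos.2 hp
  have h2 : √(2 * (a * reaction g m l a)) * (L - a) ≤ a * Real.pi := by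
    have : L - a ≤ a * Real.pi / √(2 * (a * reaction g m l a)) := by
      rw [mul_add, mul_one, ← mul_div_assoc] at h1; linarith
    rw [le_div_iff₀ hs] at this
    linarith
  have h3 : 2 * (a * reaction g m l a) * (L - a) ^ 2 ≤ a ^ 2 * Real.pi ^ 2 := by
    calc 2 * (a * reaction g m l a) * (L - a) ^ 2 =
        (√(2 * (a * reaction g m l a)) * (L - a)) ^ 2 := by rw [mul_pow, Real.sq_sqrt hp.le]
      _ ≤ (a * Real.pi) ^ 2 := by gcongr
      _ = _ := by ring
  have h4 : reaction g m l a ≤ a * Real.pi ^ 2 / (2 * (L - a) ^ 2) := by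
    rw [le_div_iff₀ (by positivity)]
    refine le_of_mul_le_mul_left ?_ ha
    linarith
  rw [le_div_iff₀ hga]
  unfold reaction at h4
  linarith

theorem OnCurve.lt_l (h : OnCurve g σ L m l a) (hg : IsLogisticGrowth g σ) : m / g a < l := by
  have := h.adm.reaction_pos
  rw [div_lt_iff₀ (hg.pos h.adm.mem.1 h.adm.mem.2)]
  unfold reaction at this
  linarith

theorem OnCurve.of_tendsto [F.NeBot] (hg : IsLogisticGrowth g σ) (hl : 0 < l) (ha : a ∈ Ioo 0 σ)
    (hli : Tendsto li F (𝓝 l)) (hmi : Tendsto mi F (𝓝 m))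
    (hai : Tendsto ai F (𝓝 a)) (hi : ∀ᶠ i in F, OnCurve g σ L (mi i) (li i) (ai i)) :
    OnCurve g σ L m l a := by
  have hA := Adm.of_tendsto hg hl ha hli hmi hai (hi.mono fun i h => h.adm)
    (hi.mono fun i h => h.time.le)
  refine ⟨hA, tendsto_nhds_unique (hA.tendsto_timeMap hg hli hmi hai (hi.mono fun i h => h.adm)) ?_⟩
  exact tendsto_const_nhds.congr' (hi.mono fun i h => h.time.symm)

theorem OnCurve.tendsto (h : OnCurve g σ L m l a) (hg : IsLogisticGrowth g σ) (hm : 0 < m)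
    (hmi : Tendsto mi F (𝓝 m)) (hai : Tendsto ai F (𝓝 a))
    (hi : ∀ᶠ i in F, OnCurve g σ L (mi i) (li i) (ai i)) : Tendsto li F (𝓝 l) := by
  have ha := h.adm.mem
  have hga := hg.pos ha.1 ha.2
  have hgt : Tendsto (fun i => g (ai i)) F (𝓝 (g a)) := (hg.continuousAt ha.1).tendsto.comp hai
  have hLa := sub_pos.2 (h.lt_L hg)
  have hlow : Tendsto (fun i => mi i / g (ai i)) F (𝓝 (m / g a)) := hmi.div hgt hga.ne'
  have hup : Tendsto (fun i => (ai i * Real.pi ^ 2 / (2 * (L - ai i) ^ 2) + mi i) / g (ai i)) F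
      (𝓝 ((a * Real.pi ^ 2 / (2 * (L - a) ^ 2) + m) / g a)) := by
    refine Tendsto.div (Tendsto.add (Tendsto.div (hai.mul_const _)
      (((hai.const_sub L).pow 2).const_mul 2) (by positivity)) hmi) hgt hga.ne'
  have hmg : 0 < m / g a := by positivity
  refine IsCompact.tendsto_nhds_of_unique_ultrafilter (K := Icc (m / g a / 2)
    ((a * Real.pi ^ 2 / (2 * (L - a) ^ 2) + m) / g a + 1)) isCompact_Icc ?_ ?_
  · filter_upwards [hi, hlow.eventually (lt_mem_nhds (half_lt_self hmg)),
      hup.eventually (gt_mem_nhds (lt_add_one _))] with i h1 h2 h3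
    exact ⟨h2.le.trans (h1.lt_l hg).le, (h1.l_le hg).trans h3.le⟩
  · intro U hU x hx hUx
    have := OnCurve.of_tendsto hg (by have := hx.1; linarith : 0 < x) ha hUx (hmi.mono_left hU)
      (hai.mono_left hU) (hi.filter_mono hU)
    exact this.unique h hg

theorem Adm.exists_onCurve (h : Adm g σ l m a) (hg : IsLogisticGrowth g σ)
    (hT : L ≤ timeMap g l m a) (ha : a < L) : ∃ l', l ≤ l' ∧ OnCurve g σ L m l' a := by
  have hcont : ContinuousOn (fun x => timeMap g x m a) (Ici l) := fun x hx =>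
    (h.mono_l hg hx).tendsto_timeMap hg (tendsto_id.mono_left nhdsWithin_le_nhds)
      tendsto_const_nhds tendsto_const_nhds
      (eventually_mem_nhdsWithin.mono fun y hy => h.mono_l hg hy)
  have hga := hg.pos h.mem.1 h.mem.2
  have ha0 := h.mem.1
  have h1 : Tendsto (fun x => a * (1 + Real.pi / √(2 * (a * reaction g m x a)))) atTop
      (𝓝 (a * (1 + 0))) := by
    refine (Tendsto.const_add 1 ?_).const_mul a
    refine tendsto_const_nhds.div_atTop (Real.tendsto_sqrt_atTop.comp ?_)
    refine ((tendsto_atTop_add_const_right _ (-m)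
      (tendsto_id.atTop_mul_const hga)).const_mul_atTop ha0).const_mul_atTop two_pos
  rw [add_zero, mul_one] at h1
  obtain ⟨x, hx1, hx2⟩ := ((h1.eventually (gt_mem_nhds ha)).and (eventually_ge_atTop l)).exists
  have hx3 : timeMap g x m a ≤ L := ((h.mono_l hg hx2).timeMap_le hg).trans hx1.le
  obtain ⟨y, hy, hy'⟩ := isPreconnected_Ici.intermediate_value (mem_Ici.2 hx2) self_mem_Ici hcont
    ⟨hx3, hT⟩
  exact ⟨y, hy, h.mono_l hg hy, hy'⟩

/-- At the larger of `l₁` and `l₂` both end points have time map at most `L`. Strict quasiconvexity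
makes the time map at `a` smaller than `L`, and monotonicity in `l` concludes. -/
theorem OnCurve.lt_max {l₁ l₂ a₁ a₂ : ℝ} (h : OnCurve g σ L m l a) (h₁ : OnCurve g σ L m l₁ a₁)
    (h₂ : OnCurve g σ L m l₂ a₂) (hg : IsLogisticGrowth g σ) (ha : a ∈ Ioo a₁ a₂) :
    l < max l₁ l₂ := by
  have hA₁ := h₁.adm.mono_l hg (le_max_left l₁ l₂)
  have hA₂ := h₂.adm.mono_l hg (le_max_right l₁ l₂)
  refine h.lt_of_timeMap_lt hg (hA₁.between hA₂ hg ha).1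
    ((hA₁.timeMap_lt_max hA₂ hg ha).trans_le (max_le ?_ ?_))
  · exact (h₁.adm.timeMap_le_of_le_l hg (le_max_left l₁ l₂)).trans h₁.time.le
  · exact (h₂.adm.timeMap_le_of_le_l hg (le_max_right l₁ l₂)).trans h₂.time.le

/-- A continuous, strictly quasiconvex function which blows up at the right end of its domain
first strictly decreases and then strictly increases. -/
theorem exists_unimodal {f : ℝ → ℝ} {p q : ℝ} (hpq : p < q) (hf : ContinuousOn f (Ico p q))
    (htop : Tendsto f (𝓝[<] q) atTop)
    (hqc : ∀ x ∈ Ico p q, ∀ z ∈ Ico p q, ∀ y ∈ Ioo x z, f y < max (f x) (f z)) :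
    ∃ t ∈ Ico p q, StrictAntiOn f (Icc p t) ∧ StrictMonoOn f (Ico t q) := by
  -- Beyond `r` the function exceeds `f p`, so the minimum over the compact interval `[p, r']` is
  -- global.
  obtain ⟨r, hr, hrt⟩ := mem_nhdsLT_iff_exists_Ioo_subset.1 (htop.eventually_gt_atTop (f p))
  obtain ⟨r', hr1, hr2⟩ := exists_between (max_lt hr hpq)
  have hrp : p < r' := (le_max_right _ _).trans_lt hr1
  have hrr : r < r' := (le_max_left _ _).trans_lt hr1
  obtain ⟨t, ht, hmin⟩ := isCompact_Icc.exists_isMinOn (nonempty_Icc.2 hrp.le)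
    (hf.mono fun x hx => ⟨hx.1, hx.2.trans_lt hr2⟩)
  have hmin' : ∀ x ∈ Ico p q, f t ≤ f x := by
    intro x hx
    rcases le_total x r' with h | h
    · exact hmin ⟨hx.1, h⟩
    · exact (hmin (left_mem_Icc.2 hrp.le)).trans (hrt ⟨hrr.trans_le h, hx.2⟩).le
  have htm : t ∈ Ico p q := ⟨ht.1, ht.2.trans_lt hr2⟩
  have hne : ∀ x ∈ Ico p q, x ≠ t → f t < f x := by
    intro x hx hxt
    refine lt_of_le_of_ne (hmin' x hx) fun he => ?_
    rcases lt_or_gt_of_ne hxt with h | h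
    · obtain ⟨y, hy⟩ := exists_between h
      have h1 := hqc x hx t htm y hy
      rw [← he, max_self] at h1
      exact (hmin' y ⟨hx.1.trans hy.1.le, hy.2.trans htm.2⟩).not_gt h1
    · obtain ⟨y, hy⟩ := exists_between h
      have h1 := hqc t htm x hx y hy
      rw [← he, max_self] at h1
      exact (hmin' y ⟨htm.1.trans hy.1.le, hy.2.trans hx.2⟩).not_gt h1
  refine ⟨t, htm, fun x hx y hy hxy => ?_, fun x hx y hy hxy => ?_⟩
  · have hxq : x ∈ Ico p q := ⟨hx.1, hx.2.trans_lt htm.2⟩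
    rcases eq_or_lt_of_le hy.2 with h | h
    · rw [h] at hxy ⊢; exact hne x hxq hxy.ne
    · have h1 := hqc x hxq t htm y ⟨hxy, h⟩
      rwa [max_eq_left (hmin' x hxq)] at h1
  · have hyq : y ∈ Ico p q := ⟨htm.1.trans hy.1, hy.2⟩
    rcases eq_or_lt_of_le hx.1 with h | h
    · rw [← h] at hxy ⊢; exact hne y hyq hxy.ne'
    · have h1 := hqc t htm y hyq x ⟨h, hxy⟩
      rwa [max_eq_right (hmin' y hyq)] at h1

/-- The gap never exceeds `l G(σ)`. Hence bounded `l` keeps the time map above a fixed multiple,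
larger than one, of `a`, and small `l` makes it large. -/
theorem Adm.mul_kern_le_timeMap (h : Adm g σ l m a) (hg : IsLogisticGrowth g σ) (hm : 0 ≤ m) :
    a * kern (l * primG g σ) ≤ timeMap g l m a := by
  have ha0 := h.mem.1
  have hl := h.l_pos
  have hGσ := hg.primG_pos (right_mem_Ioc.2 hg.sigma_pos)
  have h2 := MeasureTheory.setIntegral_mono_on (f := fun _ => a * kern (l * primG g σ))
    (μ := MeasureTheory.volume) (s := Ioo (0:ℝ) 1) (MeasureTheory.integrable_const _)
    (h.integrableOn hg) measurableSet_Ioo fun s hs => by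
      have hgp := h.gap_pos hg hs
      have has : a * s ∈ Ioc 0 σ := ⟨mul_pos ha0 hs.1,
        (mul_le_of_le_one_right ha0.le hs.2.le).trans h.mem.2.le⟩
      refine mul_le_mul_of_nonneg_left (kern_strictAntiOn.antitoneOn (mem_Ioi.2 hgp)
        (mem_Ioi.2 (by positivity)) ?_) ha0.le
      have e1 := hg.primG_sub_pos (right_mem_Ioc.2 hg.sigma_pos) (s := a / σ)
        ⟨by have := hg.sigma_pos; positivity, (div_lt_one hg.sigma_pos).2 h.mem.2⟩
      rw [mul_div_cancel₀ _ hg.sigma_pos.ne'] at e1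
      have e2 := hg.primG_pos has
      have e3 : l * (primG g a - primG g (a * s)) ≤ l * primG g σ :=
        mul_le_mul_of_nonneg_left (by linarith) hl.le
      have e4 : 0 ≤ m * (a * (1 - s)) :=
        mul_nonneg hm (mul_nonneg ha0.le (sub_nonneg.2 hs.2.le))
      unfold gap
      linarith
  simpa [timeMap] using h2

/-- On the curve `l` tends to infinity as `a` tends to `min σ L`. -/
theorem eventually_lt_of_onCurve (hg : IsLogisticGrowth g σ) (hL : 0 < L) (hm : 0 < m) (B : ℝ) :
    ∀ᶠ a in 𝓝[<] (min σ L), ∀ l, OnCurve g σ L m l a → B < l := by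
  set K := max B 1 with hK
  have hK0 : 0 < K := one_pos.trans_le (le_max_right _ _)
  suffices ∀ᶠ a in 𝓝[<] (min σ L), ∀ l, OnCurve g σ L m l a → K < l from
    this.mono fun a h l hl => (le_max_left _ _).trans_lt (h l hl)
  -- If `σ ≤ L`, then `l > m/g(a)` with `g(a) → 0`. If `L < σ`, a bounded `l` would give a time map
  -- of at least `k a` with `k > 1`, which exceeds `L` near `a = L`.
  rcases le_or_gt σ L with h | h
  · rw [min_eq_left h]
    have h1 : Tendsto (fun a => K * g a) (𝓝[<] σ) (𝓝 (K * g σ)) :=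
      ((hg.continuousAt hg.sigma_pos).tendsto.mono_left nhdsWithin_le_nhds).const_mul K
    rw [hg.map_sigma, mul_zero] at h1
    filter_upwards [h1.eventually (gt_mem_nhds hm)] with a ha l hl
    have h2 := hl.lt_l hg
    have hga := hg.pos hl.adm.mem.1 hl.adm.mem.2
    rw [div_lt_iff₀ hga] at h2
    exact lt_of_mul_lt_mul_right (ha.trans h2) hga.le
  · rw [min_eq_right h.le]
    have hGσ := hg.primG_pos (right_mem_Ioc.2 hg.sigma_pos)
    set k := kern (K * primG g σ) with hk
    have hk1 : 1 < k := one_lt_kern (by positivity)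
    have h1 : Tendsto (fun a => a * k) (𝓝[<] L) (𝓝 (L * k)) :=
      (tendsto_id.mono_left nhdsWithin_le_nhds).mul_const k
    filter_upwards [h1.eventually (lt_mem_nhds (lt_mul_of_one_lt_right hL hk1))] with a ha l hl
    by_contra hle
    have hlK : l ≤ K := not_lt.1 hle
    have h2 := (hl.adm.mono_l hg hlK).mul_kern_le_timeMap hg hm.le
    have h3 := hl.adm.timeMap_le_of_le_l hg hlK
    rw [hl.time] at h3
    linarith

end


/-! ### The starting point and the shape of the curve for fixed `μ`. -/

section

variable {g : ℝ → ℝ} {σ l m a b c L l' m' a' κ : ℝ} {ι : Type*} {F : Filter ι} {li mi ai : ι → ℝ}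

theorem tendsto_mean_zero (hg : IsLogisticGrowth g σ) (hc : IsCStar g σ c) :
    Tendsto (fun a => primG g a / a) (𝓝[>] 0) (𝓝[>] 0) := by
  have hg0 : Tendsto g (𝓝[>] 0) (𝓝 0) := by
    have := ((hg.continuousOn 0 self_mem_Ici).mono Ioi_subset_Ici_self).tendsto
    rwa [hg.map_zero] at this
  apply tendsto_nhdsWithin_of_tendsto_nhds_of_eventually_within
  · refine tendsto_of_tendsto_of_tendsto_of_le_of_le' tendsto_const_nhds hg0 ?_ ?_
    · filter_upwards [Ioo_mem_nhdsGT hc.mem.1] with a ha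
      exact (hc.mean_pos hg ⟨ha.1, ha.2.le⟩).le
    · filter_upwards [Ioo_mem_nhdsGT hc.mem.1] with a ha using (hc.mean_lt hg ha).le
  · filter_upwards [Ioo_mem_nhdsGT hc.mem.1] with a ha
    exact hc.mean_pos hg ⟨ha.1, ha.2.le⟩

theorem continuousAt_mean (hg : IsLogisticGrowth g σ) (ha : 0 < a) :
    ContinuousAt (fun a => primG g a / a) a := (hg.hasDerivAt_mean ha).continuousAt

theorem IsStart.adm (h : IsStart g c L m l a) (hg : IsLogisticGrowth g σ) (hc : IsCStar g σ c) :
    Adm g σ l m a := h.eq ▸ hc.adm_branch hg h.l_pos h.mem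

theorem IsStart.onCurve (h : IsStart g c L m l a) (hg : IsLogisticGrowth g σ)
    (hc : IsCStar g σ c) : OnCurve g σ L m l a := ⟨h.adm hg hc, h.time⟩

theorem IsStart.primF_eq (h : IsStart g c L m l a) : primF g m l a = 0 := by
  have := h.eq
  have ha := h.mem.1
  unfold primF
  rw [← this]
  field_simp
  ring

/-- For fixed `m` the branch has `l = m/M(a)`, which decreases in `a`; both monotonicities of
`IsCStar.branch_lt` then act in the same direction. -/
theorem IsCStar.branch_lt_of_mean (hc : IsCStar g σ c) (hg : IsLogisticGrowth g σ) (hm : 0 < m)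
    (ha : 0 < a) (hab : a < b) (hb : b < c) :
    timeMap g (m / (primG g a / a)) m a < timeMap g (m / (primG g b / b)) m b := by
  have h1 := hc.mean_pos hg ⟨ha, (hab.trans hb).le⟩
  have h2 := hc.mean_pos hg ⟨ha.trans hab, hb.le⟩
  have h3 := hc.mean_strictMonoOn hg ⟨ha, (hab.trans hb).le⟩ ⟨ha.trans hab, hb.le⟩ hab
  have h4 := hc.branch_lt hg (l := m / (primG g a / a)) (l' := m / (primG g b / b)) (by positivity)
    (div_le_div_of_nonneg_left hm.le h1 h3.le) ha hab.le hb (Or.inr hab)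
  rwa [div_mul_cancel₀ _ h1.ne', div_mul_cancel₀ _ h2.ne'] at h4

theorem IsCStar.eventually_branch_lt (hc : IsCStar g σ c) (hg : IsLogisticGrowth g σ) (hL : 0 < L)
    (hm : 0 < m) : ∀ᶠ a in 𝓝[>] 0, timeMap g (m / (primG g a / a)) m a < L := by
  have hM := tendsto_mean_zero hg hc
  have hid : Tendsto (fun a : ℝ => a) (𝓝[>] 0) (𝓝 0) := tendsto_id.mono_left nhdsWithin_le_nhds
  have hc0 := hc.mem.1
  have hMc := hc.mean_pos hg (right_mem_Ioc.2 hc0)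
  have h1 : Tendsto (fun a => m / (primG g a / a)) (𝓝[>] 0) atTop := by
    simp_rw [div_eq_mul_inv m]
    exact (tendsto_inv_nhdsGT_zero.comp hM).const_mul_atTop hm
  have h2 : Tendsto (fun a => (primG g c / c - primG g a / a) / (c - a)) (𝓝[>] 0)
      (𝓝 ((primG g c / c - 0) / (c - 0))) :=
    ((hM.mono_right nhdsWithin_le_nhds).const_sub _).div (hid.const_sub _) (by simpa using hc0.ne')
  rw [sub_zero, sub_zero] at h2
  have h3 := ((h1.atTop_mul_pos (by positivity) h2).const_mul_atTop (two_pos (α := ℝ)))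
  have h4 := hid.add (((tendsto_const_nhds (x := (1:ℝ))).div_atTop
    (Real.tendsto_sqrt_atTop.comp h3)).mul_const Real.pi)
  rw [zero_mul, add_zero] at h4
  filter_upwards [h4.eventually (gt_mem_nhds hL), Ioo_mem_nhdsGT hc0] with a ha hac
  have hMa := hc.mean_pos hg ⟨hac.1, hac.2.le⟩
  have h5 := hc.branch_upper hg (l := m / (primG g a / a)) (by positivity) hac hac.2 le_rfl
  rw [div_mul_cancel₀ _ hMa.ne'] at h5
  exact h5.trans_lt ha

theorem IsCStar.exists_isStart (hc : IsCStar g σ c) (hg : IsLogisticGrowth g σ) (hL : 0 < L)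
    (hm : 0 < m) : ∃ l a, IsStart g c L m l a := by
  have hc0 := hc.mem.1
  have hpos : ∀ a ∈ Ioc 0 c, 0 < primG g a / a := fun a ha => hc.mean_pos hg ha
  have hadm : ∀ a ∈ Ioo 0 c, Adm g σ (m / (primG g a / a)) m a := by
    intro a ha
    have h := hpos a ⟨ha.1, ha.2.le⟩
    have h1 := hc.adm_branch hg (l := m / (primG g a / a)) (by positivity) ha
    rwa [div_mul_cancel₀ _ h.ne'] at h1
  have hcont : ContinuousOn (fun a => timeMap g (m / (primG g a / a)) m a) (Ioo 0 c) := by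
    intro a ha
    refine (hadm a ha).tendsto_timeMap hg ?_ tendsto_const_nhds
      (tendsto_id.mono_left nhdsWithin_le_nhds)
      (eventually_mem_nhdsWithin.mono fun y hy => hadm y hy)
    exact tendsto_const_nhds.div ((continuousAt_mean hg ha.1).tendsto.mono_left nhdsWithin_le_nhds)
      (hpos a ⟨ha.1, ha.2.le⟩).ne'
  obtain ⟨a₁, h1, ha₁⟩ := ((hc.eventually_branch_lt hg hL hm).and (Ioo_mem_nhdsGT hc0)).exists
  -- Otherwise the limit point at height `c` would be admissible, although the reaction vanishes
  -- there because `M(c) = g(c)`.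
  obtain ⟨a₂, ha₂, h2⟩ : ∃ a ∈ Ioo 0 c, L ≤ timeMap g (m / (primG g a / a)) m a := by
    by_contra! hcon
    have h3 := Adm.of_tendsto (F := 𝓝[<] c) (li := fun a => m / (primG g a / a))
      (mi := fun _ => m) (ai := id) (B := L) hg
      (div_pos hm (hpos c (right_mem_Ioc.2 hc0))) hc.mem
      (tendsto_const_nhds.div ((continuousAt_mean hg hc0).tendsto.mono_left nhdsWithin_le_nhds)
        (hpos c (right_mem_Ioc.2 hc0)).ne') tendsto_const_nhds
      (tendsto_id.mono_left nhdsWithin_le_nhds)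
      (by filter_upwards [Ioo_mem_nhdsLT hc0] with a ha using hadm a ha)
      (by filter_upwards [Ioo_mem_nhdsLT hc0] with a ha using (hcon a ha).le)
    have h4 := h3.reaction_pos
    unfold reaction at h4
    rw [hc.value, div_mul_cancel₀ _ (hg.pos hc.mem.1 hc.mem.2).ne', sub_self] at h4
    exact h4.false
  obtain ⟨a, ha, he⟩ := isPreconnected_Ioo.intermediate_value ha₁ ha₂ hcont ⟨h1.le, h2⟩
  have h := hpos a ⟨ha.1, ha.2.le⟩
  exact ⟨_, a, div_pos hm h, ha, div_mul_cancel₀ _ h.ne', he⟩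

theorem IsStart.l_eq (h : IsStart g c L m l a) (hg : IsLogisticGrowth g σ) (hc : IsCStar g σ c) :
    l = m / (primG g a / a) := by
  rw [← h.eq, mul_div_cancel_right₀ _ (hc.mean_pos hg ⟨h.mem.1, h.mem.2.le⟩).ne']

/-- If `a' ≤ a`, then `M(a') ≤ M(a)` and `m < m'` force `l < l'`, and `IsCStar.branch_lt` would
separate two time maps that both equal `L`. -/
theorem IsStart.a_lt (h : IsStart g c L m l a) (h' : IsStart g c L m' l' a')
    (hg : IsLogisticGrowth g σ) (hc : IsCStar g σ c) (hm : m < m') : a < a' := by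
  by_contra! hle
  have hM := (hc.mean_strictMonoOn hg).monotoneOn ⟨h'.mem.1, h'.mem.2.le⟩ ⟨h.mem.1, h.mem.2.le⟩ hle
  have hp := hc.mean_pos hg ⟨h'.mem.1, h'.mem.2.le⟩
  have hl : l < l' := by
    by_contra! hl
    have := mul_le_mul hl hM hp.le h.l_pos.le
    rw [h.eq, h'.eq] at this
    linarith
  have := hc.branch_lt hg h.l_pos hl.le h'.mem.1 hle h.mem.2 (Or.inl hl)
  rw [h.eq, h'.eq, h.time, h'.time] at this
  exact this.false

theorem IsStart.l_lt (h : IsStart g c L m l a) (h' : IsStart g c L m' l' a')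
    (hg : IsLogisticGrowth g σ) (hc : IsCStar g σ c) (hm : m < m') : l < l' := by
  by_contra! hle
  have hlt := h.a_lt h' hg hc hm
  have := hc.branch_lt hg h'.l_pos hle h.mem.1 hlt.le h'.mem.2 (Or.inr hlt)
  rw [h.eq, h'.eq, h.time, h'.time] at this
  exact this.false

theorem IsStart.a_unique (h : IsStart g c L m l a) (h' : IsStart g c L m l' a')
    (hg : IsLogisticGrowth g σ) (hc : IsCStar g σ c) (hm : 0 < m) : a = a' := by
  have h1 := h.time
  have h2 := h'.time
  rw [h.l_eq hg hc] at h1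
  rw [h'.l_eq hg hc] at h2
  rcases lt_trichotomy a a' with hl | hl | hl
  · have := hc.branch_lt_of_mean hg hm h.mem.1 hl h'.mem.2
    linarith
  · exact hl
  · have := hc.branch_lt_of_mean hg hm h'.mem.1 hl h.mem.2
    linarith

/-- Existence of points of the curve to the right of the starting point. -/
theorem IsStart.exists_onCurve (h : IsStart g c L m l a) (hg : IsLogisticGrowth g σ)
    (hc : IsCStar g σ c) (hm : 0 < m) (hb : b ∈ Ico a (min σ L)) : ∃ l', OnCurve g σ L m l' b := by
  have hb0 : 0 < b := h.mem.1.trans_le hb.1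
  have hbσ : b < σ := hb.2.trans_le (min_le_left _ _)
  have hbL : b < L := hb.2.trans_le (min_le_right _ _)
  rcases lt_or_ge b c with hbc | hbc
  · rcases eq_or_lt_of_le hb.1 with he | hab
    · exact ⟨l, he ▸ h.onCurve hg hc⟩
    have h1 := hc.branch_lt_of_mean hg hm h.mem.1 hab hbc
    rw [← h.l_eq hg hc, h.time] at h1
    have hM := hc.mean_pos hg ⟨hb0, hbc.le⟩
    have h2 := hc.adm_branch hg (l := m / (primG g b / b)) (by positivity) ⟨hb0, hbc⟩
    rw [div_mul_cancel₀ _ hM.ne'] at h2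
    obtain ⟨l', -, h'⟩ := h2.exists_onCurve hg h1.le hbL
    exact ⟨l', h'⟩
  · have hgb := hg.pos hb0 hbσ
    have hadm : ∀ x, m / g b < x → Adm g σ x m b := by
      intro x hx
      have hx' := (div_lt_iff₀ hgb).1 hx
      have hx0 : 0 < x := (div_pos hm hgb).trans hx
      refine ⟨hx0, ⟨hb0, hbσ⟩, ?_, ?_⟩
      · have h1 := mul_le_mul_of_nonneg_left (hc.le_primG hg ⟨hbc, hbσ⟩) hx0.le
        have h2 := mul_le_mul_of_nonneg_right hx'.le hb0.le
        unfold primF; linarith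
      · unfold reaction; linarith
    -- From `c*` on, each `x > m/g(b)` is admissible. If the time map stayed below `L`, the limit `x
    -- = m/g(b)` would be admissible with zero reaction.
    obtain ⟨x, hx, hT⟩ : ∃ x, m / g b < x ∧ L ≤ timeMap g x m b := by
      by_contra! hcon
      have h3 := Adm.of_tendsto (F := 𝓝[>] (m / g b)) (li := id)
        (mi := fun _ => m) (ai := fun _ => b) (B := L) hg (div_pos hm hgb) ⟨hb0, hbσ⟩
        (tendsto_id.mono_left nhdsWithin_le_nhds) tendsto_const_nhds tendsto_const_nhds
        (by filter_upwards [self_mem_nhdsWithin] with x hx using hadm x hx)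
        (by filter_upwards [self_mem_nhdsWithin] with x hx using (hcon x hx).le)
      have h4 := h3.reaction_pos
      unfold reaction at h4
      rw [div_mul_cancel₀ _ hgb.ne', sub_self] at h4
      exact h4.false
    obtain ⟨l', -, h'⟩ := (hadm x hx).exists_onCurve hg hT hbL
    exact ⟨l', h'⟩

/-- Below the starting height, `F ≥ 0` forces `l' ≥ m/M(a')`, where the time map is already smaller
than `L`. -/
theorem IsStart.le_of_onCurve (h : IsStart g c L m l a) (hg : IsLogisticGrowth g σ)
    (hc : IsCStar g σ c) (hm : 0 < m) (h' : OnCurve g σ L m l' a') : a' ∈ Ico a (min σ L) := by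
  refine ⟨?_, lt_min h'.adm.mem.2 (h'.lt_L hg)⟩
  by_contra! hlt
  have h1 := hc.branch_lt_of_mean hg hm h'.adm.mem.1 hlt h.mem.2
  rw [← h.l_eq hg hc, h.time] at h1
  have hM := hc.mean_pos hg ⟨h'.adm.mem.1, (hlt.trans h.mem.2).le⟩
  have ha' := h'.adm.mem.1
  have h2 := hc.adm_branch hg (l := m / (primG g a' / a')) (by positivity)
    ⟨h'.adm.mem.1, hlt.trans h.mem.2⟩
  rw [div_mul_cancel₀ _ hM.ne'] at h2
  have h3 := h'.lt_of_timeMap_lt hg h2 h1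
  have h4 := h'.adm.primF_nonneg
  unfold primF at h4
  rw [lt_div_iff₀ hM, ← mul_div_assoc, div_lt_iff₀ ha'] at h3
  linarith

theorem IsStart.exists_lt (h : IsStart g c L m l a) (hg : IsLogisticGrowth g σ)
    (hc : IsCStar g σ c) (hm : 0 < m) : ∃ l' a', a < a' ∧ OnCurve g σ L m l' a' ∧ l' < l := by
  obtain ⟨b, hab, hA, hT⟩ := (h.adm hg hc).exists_timeMap_lt hg hm h.primF_eq
  rw [h.time] at hT
  obtain ⟨l', hl'⟩ := h.exists_onCurve hg hc hm
    ⟨hab.le, lt_min hA.mem.2 ((hA.lt_timeMap hg).trans hT)⟩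
  exact ⟨l', b, hab, hl', hl'.lt_of_timeMap_lt hg hA hT⟩

/-- The reaction is strictly concave, equals `-m` at `0` and at `σ`, and is positive at `a`; its two
zeros therefore enclose `a`. -/
theorem IsStart.isTheta (h : IsStart g c L m l a) (hg : IsLogisticGrowth g σ)
    (hc : IsCStar g σ c) (hm : 0 < m) : IsTheta g σ m l a := by
  have hA := h.adm hg hc
  have ha := hA.mem
  have hl := h.l_pos
  have hcr : ContinuousOn (reaction g m l) (Icc 0 σ) :=
    ((hg.continuousOn.mono Icc_subset_Ici_self).const_smul l).sub continuousOn_const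
  have hr0 : reaction g m l 0 = -m := by unfold reaction; rw [hg.map_zero]; ring
  have hrσ : reaction g m l σ = -m := by unfold reaction; rw [hg.map_sigma]; ring
  obtain ⟨z, hz, hz0⟩ := intermediate_value_Icc ha.1.le (hcr.mono (Icc_subset_Icc_right ha.2.le))
    (show (0:ℝ) ∈ Icc _ _ from ⟨by rw [hr0]; linarith, hA.reaction_pos.le⟩)
  obtain ⟨b, hb, hb0⟩ := intermediate_value_Icc' ha.2.le (hcr.mono (Icc_subset_Icc_left ha.1.le))
    (show (0:ℝ) ∈ Icc _ _ from ⟨by rw [hrσ]; linarith, hA.reaction_pos.le⟩)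
  have hza : z < a := lt_of_le_of_ne hz.2 fun he => by
    have := hA.reaction_pos; rw [← he, hz0] at this; exact this.false
  have hab : a < b := lt_of_le_of_ne hb.1 fun he => by
    have := hA.reaction_pos; rw [he, hb0] at this; exact this.false
  have hzp : 0 < z := lt_of_le_of_ne hz.1 fun he => by
    rw [← he, hr0] at hz0; linarith
  have hbσ : b < σ := lt_of_le_of_ne hb.2 fun he => by
    rw [he, hrσ] at hb0; linarith
  have hsc : StrictConcaveOn ℝ (Icc 0 σ) (reaction g m l) := by
    refine ⟨convex_Icc _ _, fun x hx y hy hxy p q hp hq hpq => ?_⟩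
    have h1 := mul_lt_mul_of_pos_left (hg.strictConcaveOn.2 hx hy hxy hp hq hpq) hl
    simp only [smul_eq_mul, reaction] at h1 ⊢
    have : p * m + q * m = m := by rw [← add_mul, hpq, one_mul]
    linarith
  have key : ∀ x ∈ Icc 0 σ, ∀ y ∈ Icc 0 σ, ∀ u ∈ Ioo x y,
      min (reaction g m l x) (reaction g m l y) < reaction g m l u := by
    intro x hx y hy u hu
    have h1 : u ∈ openSegment ℝ x y := by
      rw [openSegment_eq_Ioo (hu.1.trans hu.2)]; exact hu
    exact hsc.lt_on_openSegment hx hy (hu.1.trans hu.2).ne h1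
  have hzm : z ∈ Icc 0 σ := ⟨hzp.le, (hza.trans ha.2).le⟩
  have hbm : b ∈ Icc 0 σ := ⟨(ha.1.trans hab).le, hbσ.le⟩
  refine ⟨z, b, ⟨hzp, hza.trans hab, hbσ, fun u hu => ?_, hz0, fun u hu => ?_, hb0,
    fun u hu => ?_⟩, ⟨hza, hab⟩, h.primF_eq⟩
  · by_contra! hcon
    have h1 := key u ⟨hu.1.le, hu.2.le.trans hzm.2⟩ b hbm z ⟨hu.2, hza.trans hab⟩
    rw [hz0, hb0, min_eq_right hcon] at h1
    exact h1.false
  · have h1 := key z hzm b hbm u hu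
    rwa [hz0, hb0, min_self] at h1
  · by_contra! hcon
    have h1 := key z hzm u ⟨hbm.1.trans hu.1.le, hu.2.le⟩ b ⟨hza.trans hab, hu.1⟩
    rw [hz0, hb0, min_eq_left hcon] at h1
    exact h1.false

theorem IsStart.div_lt (h : IsStart g c L m l a) (hg : IsLogisticGrowth g σ)
    (hc : IsCStar g σ c) (hm : 0 < m) : m / g c < l := by
  rw [h.l_eq hg hc, ← hc.value]
  have hM := hc.mean_strictMonoOn hg ⟨h.mem.1, h.mem.2.le⟩ (right_mem_Ioc.2 hc.mem.1) h.mem.2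
  exact div_lt_div_of_pos_left hm (hc.mean_pos hg ⟨h.mem.1, h.mem.2.le⟩) hM

theorem IsStart.isSubsetShaped (h : IsStart g c L m l a) (hg : IsLogisticGrowth g σ)
    (hc : IsCStar g σ c) (hL : 0 < L) (hm : 0 < m) :
    ∃ l' a', IsTurn g σ L m l' a' ∧ a < a' ∧
      IsSubsetShaped (bifurcationCurve g L m) (l, a) (l', a') (min σ L) := by
  choose! Λ hΛ using fun b (hb : b ∈ Ico a (min σ L)) => h.exists_onCurve hg hc hm hb
  have haI := h.le_of_onCurve hg hc hm (h.onCurve hg hc)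
  have hΛa : Λ a = l := (hΛ a haI).unique (h.onCurve hg hc) hg
  have hcont : ContinuousOn Λ (Ico a (min σ L)) := fun b hb =>
    (hΛ b hb).tendsto hg hm tendsto_const_nhds (tendsto_id.mono_left nhdsWithin_le_nhds)
      (eventually_mem_nhdsWithin.mono fun y hy => hΛ y hy)
  have htop : Tendsto Λ (𝓝[<] (min σ L)) atTop := by
    refine tendsto_atTop.2 fun B => ?_
    filter_upwards [eventually_lt_of_onCurve hg hL hm B, Ioo_mem_nhdsLT haI.2] with b hb hbI
    exact (hb _ (hΛ b ⟨hbI.1.le, hbI.2⟩)).le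
  obtain ⟨t, ht, hanti, hmono⟩ := exists_unimodal haI.2 hcont htop
    fun x hx z hz y hy => (hΛ y ⟨hx.1.trans hy.1.le, hy.2.trans hz.2⟩).lt_max (hΛ x hx) (hΛ z hz)
      hg hy
  -- The minimum is not at the starting point, since the curve has points further left above it.
  have hat : a < t := by
    refine lt_of_le_of_ne ht.1 fun he => ?_
    obtain ⟨l', a', haa, h', hl'⟩ := h.exists_lt hg hc hm
    have haI' := h.le_of_onCurve hg hc hm h'
    have := hmono ⟨he.ge, haI.2⟩ ⟨he ▸ haI'.1, haI'.2⟩ haa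
    rw [hΛa, (hΛ a' haI').unique h' hg] at this
    linarith
  refine ⟨Λ t, t, ⟨hΛ t ht, fun l' a' h' hne => ?_⟩, hat, Λ, hat, ht.2, ?_, hcont, hΛa, rfl,
    hanti, hmono, htop⟩
  · have haI' := h.le_of_onCurve hg hc hm h'
    rw [← (hΛ a' haI').unique h' hg]
    rcases lt_or_gt_of_ne hne with hlt | hlt
    · exact hanti ⟨haI'.1, hlt.le⟩ (right_mem_Icc.2 ht.1) hlt
    · exact hmono (left_mem_Ico.2 ht.2) ⟨hlt.le, haI'.2⟩ hlt
  · ext p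
    rw [mem_bifurcationCurve_iff hg hL hm]
    constructor
    · rintro ⟨h1, h2⟩
      have h3 : OnCurve g σ L m p.1 p.2 := ⟨h1, h2⟩
      have h4 := h.le_of_onCurve hg hc hm h3
      exact ⟨p.2, h4, Prod.ext ((hΛ _ h4).unique h3 hg) rfl⟩
    · rintro ⟨b, hb, rfl⟩
      exact ⟨(hΛ b hb).adm, (hΛ b hb).time⟩

end


/-! ### The `a`-derivative of the time map and the location of the turning point. -/

/-- The variation of `primF` weighted as in the `a`-derivative of the time map. -/
noncomputable def gapQ (g : ℝ → ℝ) (l m a s : ℝ) : ℝ :=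
  a * (reaction g m l a - s * reaction g m l (a * s))

/-- The `a`-derivative of the time map. -/
noncomputable def timeMapD (g : ℝ → ℝ) (l m a : ℝ) : ℝ :=
  ∫ s in Ioo (0:ℝ) 1, (kern (gap g l m a s) - kernD (gap g l m a s) * gapQ g l m a s)

section

variable {g : ℝ → ℝ} {σ l m a b c L l' m' a' κ : ℝ} {ι : Type*} {F : Filter ι} {li mi ai : ι → ℝ}

/-- All three quantities are of order `(1 - s)^(-1/2)`; the weight `1/√(s(1 - s))` is used because
its integrability is already known. -/
theorem exists_kern_bounds (hκ : 0 < κ) : ∃ C, 0 < C ∧ ∀ s ∈ Ioo (0:ℝ) 1, ∀ x, κ * (1 - s) ≤ x →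
    kern x ≤ C * (1 / √(s * (1 - s))) ∧ kernD x * (1 - s) ≤ C * (1 / √(s * (1 - s))) ∧
    kernDD x * (1 - s) ^ 2 ≤ C * (1 / √(s * (1 - s))) := by
  have hk := Real.sqrt_pos.2 hκ
  have hk2 := Real.sqrt_pos.2 (mul_pos two_pos hκ)
  refine ⟨(1 + 1 / √(2 * κ)) + 1 / (κ * √κ) + 3 / (κ ^ 2 * √κ), by positivity, fun s hs x hx => ?_⟩
  have hs1 : 0 < 1 - s := sub_pos.2 hs.2
  have hp : 0 < κ * (1 - s) := mul_pos hκ hs1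
  have hx0 := hp.trans_le hx
  have hr := Real.sqrt_pos.2 hs1
  have hw0 : 0 < s * (1 - s) := mul_pos hs.1 hs1
  have hw1 : 1 / √(1 - s) ≤ 1 / √(s * (1 - s)) :=
    one_div_le_one_div_of_le (Real.sqrt_pos.2 hw0)
      (Real.sqrt_le_sqrt (mul_le_of_le_one_left hs1.le hs.2.le))
  have hw2 : 1 ≤ 1 / √(1 - s) := by
    rw [le_div_iff₀ hr, one_mul]
    exact Real.sqrt_le_one.2 (by linarith [hs.1])
  set w := 1 / √(s * (1 - s)) with hw
  have hwp : 0 < w := by linarith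
  have hsq : √(κ * (1 - s)) = √κ * √(1 - s) := Real.sqrt_mul hκ.le _
  have hc1 : 0 < 1 / √(2 * κ) := by positivity
  have hc2 : 0 < 1 / (κ * √κ) := by positivity
  have hc3 : 0 < 3 / (κ ^ 2 * √κ) := by positivity
  refine ⟨?_, ?_, ?_⟩
  · have h1 := (kern_strictAntiOn.antitoneOn (mem_Ioi.2 hp) (mem_Ioi.2 hx0) hx).trans (kern_le hp)
    have h2 : 1 / √(2 * (κ * (1 - s))) = 1 / √(2 * κ) * (1 / √(1 - s)) := by
      rw [← mul_assoc, Real.sqrt_mul (by positivity)]; field_simp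
    rw [h2] at h1
    have h3 := mul_le_mul_of_nonneg_left hw1 hc1.le
    have h4 := mul_pos hc2 hwp
    have h5 := mul_pos hc3 hwp
    linarith
  · have h1 := (kernD_strictAntiOn.antitoneOn (mem_Ioi.2 hp) (mem_Ioi.2 hx0) hx).trans (kernD_le hp)
    have h2 : 1 / (κ * (1 - s) * √(κ * (1 - s))) * (1 - s) =
        1 / (κ * √κ) * (1 / √(1 - s)) := by
      rw [hsq]; field_simp
    have h3 := mul_le_mul_of_nonneg_left hw1 hc2.le
    have h4 := mul_pos hc1 hwp
    have h5 := mul_pos hc3 hwp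
    have h6 := mul_le_mul_of_nonneg_right h1 hs1.le
    rw [h2] at h6
    linarith
  · have h1 : kernDD x ≤ 3 / ((κ * (1 - s)) ^ 2 * √(κ * (1 - s))) :=
      (kernDD_le hx0).trans (by gcongr)
    have h2 : 3 / ((κ * (1 - s)) ^ 2 * √(κ * (1 - s))) * (1 - s) ^ 2 =
        3 / (κ ^ 2 * √κ) * (1 / √(1 - s)) := by
      rw [hsq]; field_simp
    have h3 := mul_le_mul_of_nonneg_left hw1 hc3.le
    have h4 := mul_pos hc1 hwp
    have h5 := mul_pos hc2 hwp
    have h6 := mul_le_mul_of_nonneg_right h1 (sq_nonneg (1 - s))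
    rw [h2] at h6
    linarith

/-- Strict positivity of `F(a)` improves the lower bound on the gap from `s(1 - s)` to `1 - s`,
uniformly near the given parameters, and so removes the singularity at `s = 0`. -/
theorem Adm.eventually_le_gap (h : Adm g σ l m a) (hg : IsLogisticGrowth g σ)
    (hF : 0 < primF g m l a)
    (hli : Tendsto li F (𝓝 l)) (hmi : Tendsto mi F (𝓝 m)) (hai : Tendsto ai F (𝓝 a)) :
    ∃ κ, 0 < κ ∧ ∀ᶠ i in F, Adm g σ (li i) (mi i) (ai i) ∧
      ∀ s ∈ Ioo (0:ℝ) 1, κ * (1 - s) ≤ gap g (li i) (mi i) (ai i) s := by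
  have h1 := tendsto_primF hg h.mem.1 hli hmi hai
  have h2 := hai.mul (tendsto_reaction hg h.mem.1 hli hmi hai)
  have h3 : 0 < min (primF g m l a) (a * reaction g m l a) := lt_min hF h.mul_reaction_pos
  have h4 := half_lt_self h3
  refine ⟨min (primF g m l a) (a * reaction g m l a) / 2, half_pos h3, ?_⟩
  filter_upwards [Adm.eventually hg h hF hli hmi hai,
    h1.eventually (lt_mem_nhds (h4.trans_le (min_le_left _ _))),
    h2.eventually (lt_mem_nhds (h4.trans_le (min_le_right _ _)))] with i hi h5 h6
  refine ⟨hi.1, fun s hs => ?_⟩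
  refine le_trans ?_ (_root_.le_gap hg hi.1.l_pos.le hi.1.mem' (Ioo_subset_Icc_self hs))
  rw [mul_comm]
  have hs1 : 0 < 1 - s := sub_pos.2 hs.2
  apply mul_le_mul_of_nonneg_left _ hs1.le
  have h7 := mul_le_mul_of_nonneg_left h5.le hs1.le
  have h8 := mul_le_mul_of_nonneg_left h6.le hs.1.le
  linarith

theorem exists_abs_reaction_sub_le (hg : IsLogisticGrowth g σ) (hl : 0 < l) (m : ℝ) {x : ℝ}
    (hx : x ∈ Ioo 0 σ) : ∃ K, 0 < K ∧ ∀ b ∈ Ioc 0 x, ∀ s ∈ Ioo (0:ℝ) 1,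
      |reaction g m l b - s * reaction g m l (b * s)| ≤ K * (1 - s) := by
  obtain ⟨G, hG⟩ := isCompact_Icc.exists_bound_of_continuousOn
    (hg.continuousOn.mono (Icc_subset_Ici_self : Icc 0 σ ⊆ Ici 0))
  have hG0 : 0 ≤ G := (norm_nonneg _).trans (hG 0 (left_mem_Icc.2 hg.sigma_pos.le))
  have hσ := hg.sigma_pos
  refine ⟨l * (σ * |deriv g x|) + 2 * l * G + |m| + 1, by positivity, fun b hb s hs => ?_⟩
  have hs1 : 0 < 1 - s := sub_pos.2 hs.2
  have hbm : b ∈ Ioo 0 σ := ⟨hb.1, hb.2.trans_lt hx.2⟩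
  have e1 := mul_nonneg hl.le (mul_nonneg hσ.le (abs_nonneg (deriv g x)))
  have e2 := mul_nonneg hl.le hG0
  have e3 := abs_nonneg m
  rw [abs_le]
  constructor
  · have h1 := reaction_sub_lower (m := m) hg hl hbm hx hb.2 hs
    have h2 : (l * (σ * |deriv g x|) + m) * (1 - s) ≤
        (l * (σ * |deriv g x|) + 2 * l * G + |m| + 1) * (1 - s) :=
      mul_le_mul_of_nonneg_right (by have := le_abs_self m; linarith) hs1.le
    linarith
  · have h1 := mul_le_mul_of_nonneg_left
      (hg.mul_le ⟨hb.1.le, hbm.2.le⟩ (Ioo_subset_Icc_self hs)) hs.1.le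
    have h2 := (le_abs_self _).trans (hG b ⟨hb.1.le, hbm.2.le⟩)
    have h3 : 0 ≤ g b := hg.nonneg ⟨hb.1.le, hbm.2.le⟩
    have h4 : g b - s * g (b * s) ≤ 2 * G * (1 - s) := by
      have h5 : (1 + s) * g b ≤ 2 * G := mul_le_mul (by linarith [hs.2]) h2 h3 two_pos.le
      have h6 := mul_le_mul_of_nonneg_right h5 hs1.le
      linarith
    have h7 := mul_le_mul_of_nonneg_left h4 hl.le
    have h8 := mul_le_mul_of_nonneg_right (neg_abs_le m) hs1.le
    have h9 := mul_nonneg e1 hs1.le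
    unfold reaction
    linarith

theorem continuousOn_reaction_sub (hg : IsLogisticGrowth g σ) (ha : 0 < a) :
    ContinuousOn (fun s => reaction g m l a - s * reaction g m l (a * s)) (Ioo 0 1) := by
  have h1 : ContinuousOn (fun s => g (a * s)) (Ioo 0 1) :=
    hg.continuousOn.comp (by fun_prop) fun s hs => mul_nonneg ha.le hs.1.le
  exact continuousOn_const.sub (continuousOn_id.mul ((h1.const_smul l).sub continuousOn_const))

theorem continuousOn_gapQ (hg : IsLogisticGrowth g σ) (ha : 0 < a) :
    ContinuousOn (gapQ g l m a) (Ioo 0 1) := (continuousOn_reaction_sub hg ha).const_smul a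

theorem ContinuousOn.kern_comp {d : ℝ → ℝ} {S : Set ℝ} (hd : ContinuousOn d S)
    (h0 : ∀ s ∈ S, 0 < d s) : ContinuousOn (fun s => kern (d s)) S := continuousOn_kern.comp hd h0

theorem ContinuousOn.kernD_comp {d : ℝ → ℝ} {S : Set ℝ} (hd : ContinuousOn d S)
    (h0 : ∀ s ∈ S, 0 < d s) : ContinuousOn (fun s => kernD (d s)) S :=
  continuousOn_kernD.comp hd h0

theorem ContinuousOn.kernDD_comp {d : ℝ → ℝ} {S : Set ℝ} (hd : ContinuousOn d S)
    (h0 : ∀ s ∈ S, 0 < d s) : ContinuousOn (fun s => kernDD (d s)) S :=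
  continuousOn_kernDD.comp hd h0

theorem continuousOn_gap_Ioo (hg : IsLogisticGrowth g σ) (ha : 0 < a) :
    ContinuousOn (gap g l m a) (Ioo 0 1) :=
  (continuousOn_gap hg ha.le).mono fun _ hs => hs.1.le

/-- Differentiation under the integral. If `F(a) = 0` with `m > 0`, the gap is linear at `s = 0` and
`kernD` of it behaves like `s^(-3/2)`, so `0 < F(a)` is essential. -/
theorem Adm.hasDerivAt_timeMap (h : Adm g σ l m a) (hg : IsLogisticGrowth g σ)
    (hF : 0 < primF g m l a) :
    MeasureTheory.IntegrableOn
      (fun s => kern (gap g l m a s) - kernD (gap g l m a s) * gapQ g l m a s) (Ioo 0 1) ∧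
    HasDerivAt (fun a => timeMap g l m a) (timeMapD g l m a) a := by
  obtain ⟨κ, hκ, hev⟩ : ∃ κ, 0 < κ ∧ ∀ᶠ b in 𝓝 a, Adm g σ l m b ∧
      ∀ s ∈ Ioo (0:ℝ) 1, κ * (1 - s) ≤ gap g l m b s :=
    h.eventually_le_gap hg hF tendsto_const_nhds tendsto_const_nhds tendsto_id
  obtain ⟨C, hC, hCb⟩ := exists_kern_bounds hκ
  obtain ⟨x, hax, hxσ⟩ := exists_between h.mem.2
  obtain ⟨K, hK, hKb⟩ := exists_abs_reaction_sub_le hg h.l_pos m ⟨h.mem.1.trans hax, hxσ⟩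
  have hS := hev.and (eventually_le_nhds hax)
  have hmeas : ∀ b, Adm g σ l m b → MeasureTheory.AEStronglyMeasurable
      (fun s => b * kern (gap g l m b s)) (MeasureTheory.volume.restrict (Ioo 0 1)) :=
    fun b hb => (hb.continuousOn_kern_gap hg).aestronglyMeasurable measurableSet_Ioo
  have hpos : ∀ s ∈ Ioo (0:ℝ) 1, 0 < gap g l m a s := fun s hs => h.gap_pos hg hs
  have := hasDerivAt_integral_of_dominated_loc_of_deriv_le
    (μ := MeasureTheory.volume.restrict (Ioo (0:ℝ) 1)) (x₀ := a)
    (F := fun b s => b * kern (gap g l m b s))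
    (F' := fun b s => kern (gap g l m b s) - kernD (gap g l m b s) * gapQ g l m b s)
    (bound := fun s => (C + σ * K * C) * (1 / √(s * (1 - s)))) hS
    (hS.mono fun b hb => hmeas b hb.1.1) (h.integrableOn hg)
    ((((continuousOn_gap_Ioo hg h.mem.1).kern_comp hpos).sub
      (((continuousOn_gap_Ioo hg h.mem.1).kernD_comp hpos).mul
        (continuousOn_gapQ hg h.mem.1))).aestronglyMeasurable measurableSet_Ioo)
    ?_ (integrableOn_one_div_sqrt_mul.const_mul _) ?_
  · exact this
  · filter_upwards [MeasureTheory.ae_restrict_mem measurableSet_Ioo] with s hs b hb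
    obtain ⟨h1, h2, -⟩ := hCb s hs _ (hb.1.2 s hs)
    have hgp := hb.1.1.gap_pos hg hs
    have h3 := hKb b ⟨hb.1.1.mem.1, hb.2⟩ s hs
    have hk := kern_pos hgp
    have hkD := kernD_pos hgp
    have hb0 := hb.1.1.mem.1
    set w := 1 / √(s * (1 - s))
    have h4 : |kernD (gap g l m b s) * gapQ g l m b s| ≤ σ * K * C * w := by
      unfold gapQ
      rw [abs_mul, abs_mul, abs_of_pos hkD, abs_of_pos hb0]
      calc kernD (gap g l m b s) * (b * |reaction g m l b - s * reaction g m l (b * s)|)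
          ≤ kernD (gap g l m b s) * (σ * (K * (1 - s))) := by
            have := hg.sigma_pos
            gcongr
            exact hb.1.1.mem.2.le
        _ = σ * K * (kernD (gap g l m b s) * (1 - s)) := by ring
        _ ≤ σ * K * (C * w) := by have := hg.sigma_pos; gcongr
        _ = _ := by ring
    rw [Real.norm_eq_abs]
    refine (abs_sub _ _).trans ?_
    rw [abs_of_pos hk]
    linarith
  · filter_upwards [MeasureTheory.ae_restrict_mem measurableSet_Ioo] with s hs b hb
    have hgp := hb.1.1.gap_pos hg hs
    have h1 := (hasDerivAt_id' b).fun_mul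
      ((hasDerivAt_kern hgp).comp b (hasDerivAt_gap_left hg hb.1.1.mem.1 hs.1))
    refine h1.congr_deriv ?_
    simp only [Function.comp, gapQ]
    ring

/-- A turning point with `F = 0` would be the starting point, from which the curve moves further
left. -/
theorem IsTurn.primF_pos (h : IsTurn g σ L m l a) (hg : IsLogisticGrowth g σ)
    (hc : IsCStar g σ c) (hm : 0 < m) : 0 < primF g m l a := by
  have hA := h.onCurve.adm
  refine lt_of_le_of_ne hA.primF_nonneg fun he => ?_
  have ha := hA.mem.1
  have hl := hA.l_pos
  have h1 : l * primG g a = m * a := by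
    unfold primF at he; linarith
  have h2 := hA.reaction_pos
  unfold reaction at h2
  have h3 : a < c := by
    by_contra! hca
    have h4 := mul_le_mul_of_nonneg_left (hc.le_primG hg ⟨hca, hA.mem.2⟩) hl.le
    have h5 := mul_pos h2 ha
    linarith
  have hs : IsStart g c L m l a := ⟨hl, ⟨ha, h3⟩, by rw [← mul_div_assoc, h1]; field_simp,
    h.onCurve.time⟩
  obtain ⟨l', a', haa, h', hll⟩ := hs.exists_lt hg hc hm
  have := h.lt l' a' h' haa.ne'
  linarith

theorem OnCurve.eventually_exists (h : OnCurve g σ L m l a) (hg : IsLogisticGrowth g σ)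
    (hc : IsCStar g σ c) (hL : 0 < L) (hm : 0 < m) (hF : 0 < primF g m l a) :
    ∀ᶠ b in 𝓝 a, Adm g σ l m b ∧ ∃ l', OnCurve g σ L m l' b := by
  obtain ⟨ls, as, hs⟩ := hc.exists_isStart hg hL hm
  have h1 := hs.le_of_onCurve hg hc hm h
  have h2 : as < a := by
    refine lt_of_le_of_ne h1.1 fun he => ?_
    subst he
    rw [h.unique (hs.onCurve hg hc) hg, hs.primF_eq] at hF
    exact hF.false
  filter_upwards [Adm.eventually hg h.adm hF (F := 𝓝 a) (li := fun _ => l)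
    (mi := fun _ => m) (ai := id) tendsto_const_nhds tendsto_const_nhds tendsto_id,
    Ioo_mem_nhds h2 h1.2] with b hb hbI
  exact ⟨hb.1, hs.exists_onCurve hg hc hm ⟨hbI.1.le, hbI.2⟩⟩

theorem IsTurn.timeMapD_eq_zero (h : IsTurn g σ L m l a) (hg : IsLogisticGrowth g σ)
    (hc : IsCStar g σ c) (hL : 0 < L) (hm : 0 < m) : timeMapD g l m a = 0 := by
  have hF := h.primF_pos hg hc hm
  have hmin : IsLocalMin (fun a => timeMap g l m a) a := by
    filter_upwards [h.onCurve.eventually_exists hg hc hL hm hF] with b ⟨hb, l', hl'⟩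
    rw [h.onCurve.time]
    by_contra! hlt
    have h1 := hl'.lt_of_timeMap_lt hg hb hlt
    by_cases hba : b = a
    · subst hba
      rw [hl'.unique h.onCurve hg] at h1
      exact h1.false
    · exact (h.lt l' b hl' hba).not_gt h1
  exact hmin.hasDerivAt_eq_zero (h.onCurve.adm.hasDerivAt_timeMap hg hF).2

/-- A negative derivative puts the curve at smaller `l` just above `a'`. A minimum at or below
height `a'` would then contradict strict quasiconvexity. -/
theorem IsTurn.lt_of_timeMapD_neg (h : IsTurn g σ L m l a) (hg : IsLogisticGrowth g σ)
    (hc : IsCStar g σ c) (hL : 0 < L) (hm : 0 < m) (h' : OnCurve g σ L m l' a')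
    (hF : 0 < primF g m l' a') (hD : timeMapD g l' m a' < 0) : a' < a := by
  by_contra! hle
  have h1 : ∀ᶠ b in 𝓝[>] a', timeMap g l' m b < timeMap g l' m a' := by
    have h3 := (hasDerivAt_iff_tendsto_slope.1 (h'.adm.hasDerivAt_timeMap hg hF).2).mono_left
      (nhdsWithin_mono a' fun x (hx : x ∈ Ioi a') => ne_of_gt hx)
    filter_upwards [h3.eventually (gt_mem_nhds hD), self_mem_nhdsWithin] with b hb hb'
    rw [slope_def_field, div_lt_iff₀ (sub_pos.2 hb'), zero_mul] at hb
    linarith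
  obtain ⟨b, ⟨hb1, hb2⟩, hbA, l'', hl''⟩ := ((h1.and self_mem_nhdsWithin).and
    ((h'.eventually_exists hg hc hL hm hF).filter_mono nhdsWithin_le_nhds)).exists
  rw [h'.time] at hb1
  have h4 := hl''.lt_of_timeMap_lt hg hbA hb1
  have hb2 : a' < b := hb2
  rcases eq_or_lt_of_le hle with he | hlt
  · subst he
    have := h.lt _ _ hl'' hb2.ne'
    rw [h.onCurve.unique h' hg] at this
    linarith
  · have h5 := h'.lt_max h.onCurve hl'' hg ⟨hlt, hb2⟩
    have h6 := h.lt _ _ h' hlt.ne'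
    rcases lt_max_iff.1 h5 with h7 | h7 <;> linarith

/-- The derivative `g - u g'` increases because `g` is concave. By `gapQ_eq`, `2 gap - gapQ` is an
increment of `H(u) = l (2G(u) - u g(u)) - m u`, which is therefore convex. -/
theorem convexOn_two_primG_sub (hg : IsLogisticGrowth g σ) :
    ConvexOn ℝ (Icc 0 σ) (fun u => 2 * primG g u - u * g u) := by
  have hd : ∀ u ∈ Ioo 0 σ, HasDerivAt (fun u => 2 * primG g u - u * g u) (g u - u * deriv g u) u := by
    intro u hu
    refine (((hg.hasDerivAt_primG hu.1).const_mul 2).fun_sub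
      ((hasDerivAt_id' u).fun_mul (hg.hasDerivAt hu.1))).congr_deriv ?_
    ring
  apply MonotoneOn.convexOn_of_deriv (convex_Icc _ _)
  · exact ((hg.continuousOn_primG.mono Icc_subset_Ici_self).const_smul (2:ℝ)).sub
      (continuousOn_id.mul (hg.continuousOn.mono Icc_subset_Ici_self))
  · rw [interior_Icc]
    exact fun u hu => (hd u hu).differentiableAt.differentiableWithinAt
  · rw [interior_Icc]
    intro u hu v hv huv
    rw [(hd u hu).deriv, (hd v hv).deriv]
    have h1 := hg.tangent hv (Ioo_subset_Icc_self hu)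
    have h2 := mul_le_mul_of_nonneg_left (hg.deriv_strictAntiOn.antitoneOn hu hv huv) hu.1.le
    linarith

theorem two_primG_sub_le (hg : IsLogisticGrowth g σ) (ha : a ∈ Ioo 0 σ) {s : ℝ}
    (hs : s ∈ Icc (0:ℝ) 1) :
    2 * primG g (a * s) - a * s * g (a * s) ≤ s * (2 * primG g a - a * g a) := by
  have h := (convexOn_two_primG_sub hg).2 (left_mem_Icc.2 hg.sigma_pos.le) (Ioo_subset_Icc_self ha)
    (sub_nonneg.2 hs.2) hs.1 (by ring)
  simpa [hg.map_zero, IsLogisticGrowth.primG_zero, mul_comm s a] using h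

theorem gapQ_eq (g : ℝ → ℝ) (l m a s : ℝ) : gapQ g l m a s =
    2 * gap g l m a s - (l * (2 * primG g a - a * g a) - m * a -
      (l * (2 * primG g (a * s) - a * s * g (a * s)) - m * (a * s))) := by
  unfold gapQ gap reaction; ring

/-- From `c*` on, `a f(a) ≤ F(a)`, so `2F(a) - a f(a) ≥ 0` and `gapQ ≤ 2x` for the gap `x`; since
`2x < (1 + x)(x² + 2x)`, the integrand is positive. Turning points thus lie below `c*`. -/
theorem timeMapD_pos (h : Adm g σ l m a) (hg : IsLogisticGrowth g σ) (hc : IsCStar g σ c)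
    (hca : c ≤ a) : 0 < primF g m l a ∧ 0 < timeMapD g l m a := by
  have ha := h.mem.1
  have h1 := mul_le_mul_of_nonneg_left (hc.le_primG hg ⟨hca, h.mem.2⟩) h.l_pos.le
  have h2 := h.mul_reaction_pos
  have hF : 0 < primF g m l a := by
    unfold primF; unfold reaction at h2; linarith
  refine ⟨hF, ?_⟩
  have h3 := setIntegral_Ioo_lt (f := fun _ => 0) (MeasureTheory.integrable_const _)
    (h.hasDerivAt_timeMap hg hF).1 fun s hs => by
      have hx := h.gap_pos hg hs
      have h4 := mul_le_mul_of_nonneg_left (two_primG_sub_le hg h.mem (Ioo_subset_Icc_self hs))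
        h.l_pos.le
      have h5 : 0 ≤ (1 - s) * (l * (2 * primG g a - a * g a) - m * a) := by
        apply mul_nonneg (sub_nonneg.2 hs.2.le)
        unfold primF at hF; unfold reaction at h2; linarith
      have hQ : gapQ g l m a s ≤ 2 * gap g l m a s := by
        rw [gapQ_eq]; linarith
      have hkD := kernD_pos hx
      rw [kern_eq_kernD_mul hx, ← mul_sub]
      apply mul_pos hkD
      have : 0 < gap g l m a s ^ 3 + 3 * gap g l m a s ^ 2 := by positivity
      linarith
  simpa [timeMapD] using h3

theorem IsTurn.lt_c (h : IsTurn g σ L m l a) (hg : IsLogisticGrowth g σ)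
    (hc : IsCStar g σ c) (hL : 0 < L) (hm : 0 < m) : a < c := by
  by_contra! hca
  have h1 := (timeMapD_pos h.onCurve.adm hg hc hca).2
  rw [h.timeMapD_eq_zero hg hc hL hm] at h1
  exact h1.false

end


/-! ### Pointwise inequalities between the gap, its variation and the reaction. -/

section

variable {g : ℝ → ℝ} {σ l m a : ℝ}

/-- Replacing `g` by its tangent at `u = as` bounds the gap `Δ` from above by integration over `[u,
a]`, and from below by integration over `[0, u]` together with `F(a) ≥ 0`. The claim is equivalent
to `Δ (u - B) ≤ u f(u) B`; the upper bound serves for `B ≤ u`, the lower one for `u ≤ B`. -/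
theorem Adm.gapQ_sub_two_gap_mul_le (h : Adm g σ l m a) (hg : IsLogisticGrowth g σ) {s : ℝ}
    (hs : s ∈ Ioo (0:ℝ) 1) :
    (gapQ g l m a s - 2 * gap g l m a s) * (1 - s) ≤
      reaction g m l a * (a * (1 - s)) - gap g l m a s := by
  have ha := h.mem.1
  have hl := h.l_pos
  have hs1 : 0 < 1 - s := sub_pos.2 hs.2
  set u := a * s with hu
  set B := a * (1 - s) with hB
  have hu0 : 0 < u := mul_pos ha hs.1
  have hB0 : 0 < B := mul_pos ha hs1
  have haB : a = u + B := by rw [hu, hB]; ring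
  have huσ : u ∈ Ioo 0 σ := ⟨hu0, (mul_lt_of_lt_one_right ha hs.2).trans h.mem.2⟩
  set f := reaction g m l u with hf
  set p := l * deriv g u with hp
  have tang : ∀ v ∈ Icc 0 σ, ∀ w ∈ Icc 0 σ, v ≤ w → primG g w - primG g v ≤
      g u * (w - v) + deriv g u * ((w - u) ^ 2 - (v - u) ^ 2) / 2 := by
    intro v hv w hw hvw
    rw [hg.primG_sub hv.1 hw.1]
    have h1 : ∫ t in v..w, (g u + deriv g u * (t - u)) =
        g u * (w - v) + deriv g u * ((w - u) ^ 2 - (v - u) ^ 2) / 2 := by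
      have hd : ∀ t ∈ uIcc v w, HasDerivAt (fun t => g u * t + deriv g u * (t - u) ^ 2 / 2)
          (g u + deriv g u * (t - u)) t := by
        intro t _
        have h2 := (((hasDerivAt_id' t).sub_const u).fun_pow 2).const_mul (deriv g u)
        refine (((hasDerivAt_id' t).const_mul (g u)).fun_add (h2.div_const 2)).congr_deriv ?_
        simp only [Nat.cast_ofNat, Nat.add_one_sub_one, pow_one]
        ring
      rw [intervalIntegral.integral_eq_sub_of_hasDerivAt hd
        ((Continuous.intervalIntegrable (by fun_prop)) _ _)]
      ring
    rw [← h1]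
    refine intervalIntegral.integral_mono_on hvw (hg.intervalIntegrable hv.1 hw.1)
      ((Continuous.intervalIntegrable (by fun_prop)) _ _) fun t ht => ?_
    exact hg.tangent huσ ⟨hv.1.trans ht.1, ht.2.trans hw.2⟩
  have hua : u ≤ a := by linarith
  have huI : u ∈ Icc 0 σ := Ioo_subset_Icc_self huσ
  have haI : a ∈ Icc 0 σ := Ioo_subset_Icc_self h.mem
  have h0I : (0:ℝ) ∈ Icc 0 σ := left_mem_Icc.2 hg.sigma_pos.le
  have h1 := mul_le_mul_of_nonneg_left (tang u huI a haI hua) hl.le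
  have h2 := mul_le_mul_of_nonneg_left (tang 0 h0I u huI hu0.le) hl.le
  rw [IsLogisticGrowth.primG_zero] at h2
  set Δ := gap g l m a s with hΔ
  have hΔe : Δ = l * (primG g a - primG g u) - m * B := rfl
  have hup : Δ ≤ f * B + p * B ^ 2 / 2 := by
    rw [hΔe, hf, hp]
    unfold reaction
    have : a - u = B := by linarith
    rw [this] at h1
    linarith
  have hF := h.primF_nonneg
  have hlow : -(f * u - p * u ^ 2 / 2) ≤ Δ := by
    have e1 : primF g m l a = Δ + (l * primG g u - m * u) := by
      rw [hΔe]; unfold primF; rw [haB]; ring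
    rw [hf, hp]
    unfold reaction
    linarith
  have hslope : 0 ≤ f - p * (u - B) / 2 := by
    have e1 : 0 ≤ (u + B) * (f - p * (u - B) / 2) := by linarith
    exact nonneg_of_mul_nonneg_right e1 (by linarith)
  have key : Δ * (u - B) ≤ u * f * B := by
    rcases le_total B u with hc | hc
    · have e1 := mul_le_mul_of_nonneg_right hup (sub_nonneg.2 hc)
      have e2 := mul_nonneg (sq_nonneg B) hslope
      linarith
    · have e1 := mul_le_mul_of_nonneg_right hlow (sub_nonneg.2 hc)
      have e2 := mul_nonneg (sq_nonneg u) hslope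
      linarith
  have hQ : gapQ g l m a s = a * reaction g m l a - u * f := by unfold gapQ; rw [hf, hu]; ring
  have hfin : a * ((gapQ g l m a s - 2 * Δ) * (1 - s)) ≤ a * (reaction g m l a * B - Δ) := by
    have e1 : a * ((gapQ g l m a s - 2 * Δ) * (1 - s)) = (gapQ g l m a s - 2 * Δ) * B := by
      rw [hB]; ring
    rw [e1, hQ]
    have e2 : a * (reaction g m l a * B - Δ) - (a * reaction g m l a - u * f - 2 * Δ) * B =
        u * f * B - Δ * (u - B) + (2 * B - B - (a - u)) * Δ := by ring
    have e3 : (2 * B - B - (a - u)) * Δ = 0 := by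
      have : 2 * B - B - (a - u) = 0 := by linarith
      rw [this, zero_mul]
    linarith
  exact le_of_mul_le_mul_left hfin ha

theorem Adm.gapQ_le (h : Adm g σ l m a) (hg : IsLogisticGrowth g σ) {s : ℝ}
    (hs : s ∈ Ioo (0:ℝ) 1) :
    gapQ g l m a s ≤ reaction g m l a * (a * (1 - s)) + 2 * gap g l m a s := by
  have h1 := mul_le_mul_of_nonneg_left (two_primG_sub_le hg h.mem (Ioo_subset_Icc_self hs))
    h.l_pos.le
  have h2 := mul_nonneg h.primF_nonneg (sub_nonneg.2 hs.2.le)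
  rw [gapQ_eq]
  unfold primF at h2
  unfold reaction
  linarith

/-- The hypothesis says that the mean of the reaction over `[as, a]` is at most its value at `a`; by
concavity this forces `g(as) ≤ g(a)`. -/
theorem Adm.le_gapQ (h : Adm g σ l m a) (hg : IsLogisticGrowth g σ) {s : ℝ}
    (hs : s ∈ Ioo (0:ℝ) 1) (hle : gap g l m a s ≤ reaction g m l a * (a * (1 - s))) :
    reaction g m l a * (a * (1 - s)) ≤ gapQ g l m a s := by
  have ha := h.mem.1
  have has : 0 < a * s := mul_pos ha hs.1
  have has' : a * s < a := mul_lt_of_lt_one_right ha hs.2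
  suffices hga : g (a * s) ≤ g a by
    have := mul_le_mul_of_nonneg_left (mul_le_mul_of_nonneg_left hga h.l_pos.le) has.le
    unfold gapQ reaction
    linarith
  by_contra! hlt
  have h1 : ∫ t in (a * s)..a, g a < ∫ t in (a * s)..a, g t := by
    have hsub : Icc (a * s) a ⊆ Icc 0 σ := Icc_subset_Icc has.le h.mem.2.le
    refine intervalIntegral.integral_lt_integral_of_continuousOn_of_le_of_exists_lt has'
      continuousOn_const (hg.continuousOn.mono (hsub.trans Icc_subset_Ici_self)) ?_
      ⟨a * s, left_mem_Icc.2 has'.le, hlt⟩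
    intro t ht
    have h2 := hg.concaveOn.min_le_of_mem_Icc (hsub (left_mem_Icc.2 has'.le))
      (hsub (right_mem_Icc.2 has'.le)) ⟨ht.1.le, ht.2⟩
    rwa [min_eq_right hlt.le] at h2
  rw [← hg.primG_sub has.le ha.le, intervalIntegral.integral_const, smul_eq_mul] at h1
  have h2 := mul_lt_mul_of_pos_left h1 h.l_pos
  unfold gap reaction at hle
  linarith

end

/-- This and the next two lemmas are the extreme cases of `cubic_neg`, with `t` standing for `t - p`
there. Multiplication by `8(y + 1)` completes the square in `t`, and `h1` says that the discriminant
is negative. -/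
theorem quad_case_left {y t p : ℝ} (hy : 1 ≤ y) (hp : 0 < p) (hp1 : p < 1) :
    3 * y * t * (1 + p) < (y + 1) * (p ^ 2 + 3 * p * t + 2 * t ^ 2 + y ^ 2 + y - 1 - p) := by
  have h1 : 9 * (y - p) ^ 2 < 8 * (y + 1) ^ 2 * (p ^ 2 - p + y ^ 2 + y - 1) := by
    have e1 : (y - p) ^ 2 ≤ y ^ 2 := by gcongr <;> linarith
    have e2 : 3 * y ^ 2 / 4 ≤ p ^ 2 - p + y ^ 2 + y - 1 := by
      nlinarith [sq_nonneg (p - 1 / 2), sq_nonneg (y - 1)]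
    have e3 : (4:ℝ) ≤ (y + 1) ^ 2 := by nlinarith
    have e4 := mul_le_mul e3 e2 (by positivity) (by positivity)
    nlinarith
  have h2 : 0 < 8 * (y + 1) * ((y + 1) * (p ^ 2 + 3 * p * t + 2 * t ^ 2 + y ^ 2 + y - 1 - p) -
      3 * y * t * (1 + p)) := by
    have := sq_nonneg (4 * (y + 1) * t - 3 * (y - p))
    linarith
  linarith [(mul_pos_iff_of_pos_left (by linarith : 0 < 8 * (y + 1))).1 h2]

theorem quad_case_mid {y t p : ℝ} (hy : 1 ≤ y) :
    3 * y * t * p < (y + 1) * ((p + t) * (p - 1) + 2 * (p + t) * t + y ^ 2 + y - p) := by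
  have h1 : (3 * p - y - 1) ^ 2 < 8 * (y + 1) ^ 2 * ((p - 1) ^ 2 + y ^ 2 + y - 1) := by
    have e2 : 0 ≤ (p - 1) ^ 2 + y ^ 2 + y - 1 := by nlinarith
    have e3 : (4:ℝ) ≤ (y + 1) ^ 2 := by nlinarith
    have e4 := mul_le_mul_of_nonneg_right e3 e2
    nlinarith [sq_nonneg (3 * (p - 1) + (y - 2))]
  have h2 : 0 < 8 * (y + 1) * ((y + 1) * ((p + t) * (p - 1) + 2 * (p + t) * t + y ^ 2 + y - p) -
      3 * y * t * p) := by
    have := sq_nonneg (4 * (y + 1) * t + (3 * p - y - 1))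
    linarith
  linarith [(mul_pos_iff_of_pos_left (by linarith : 0 < 8 * (y + 1))).1 h2]

theorem quad_case_right {y t p : ℝ} (hy : 1 ≤ y) (hp1 : 1 ≤ p) :
    3 * y * t * (p + 2) < (y + 1) * (p ^ 2 + 3 * p * t + 2 * t ^ 2 + t + y ^ 2 + y - 2) := by
  have h1 : (3 * p + 1 - 5 * y) ^ 2 < 8 * (y + 1) ^ 2 * (p ^ 2 + y ^ 2 + y - 2) := by
    have e2 : 0 ≤ p ^ 2 + y ^ 2 + y - 2 := by nlinarith
    have e3 : (4:ℝ) ≤ (y + 1) ^ 2 := by nlinarith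
    have e4 := mul_le_mul_of_nonneg_right e3 e2
    nlinarith
  have h2 : 0 < 8 * (y + 1) * ((y + 1) * (p ^ 2 + 3 * p * t + 2 * t ^ 2 + t + y ^ 2 + y - 2) -
      3 * y * t * (p + 2)) := by
    have := sq_nonneg (4 * (y + 1) * t + (3 * p + 1 - 5 * y))
    linarith
  linarith [(mul_pos_iff_of_pos_left (by linarith : 0 < 8 * (y + 1))).1 h2]

/-- The expression is affine in `q`. For `p < 1` its slope in `q` is nonnegative, so `q = 1 + p` is
the worst case; for `p ≥ 1` it suffices to check `q = p` and `q = p + 2`. -/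
theorem cubic_neg {y t p q : ℝ} (hy : 1 ≤ y) (ht : 1 ≤ t) (hp : 0 < p)
    (h1 : p < 1 → q ≤ 1 + p) (h2 : 1 ≤ p → p ≤ q) (h3 : q ≤ p + 2) :
    3 * y * (t - p) * q - (y + 1) * (t * (q - 1) + y * (y + 1) - q + 2 * t * (t - p)) < 0 := by
  rcases lt_or_ge p 1 with hlt | hge
  · have e1 := quad_case_left (t := t - p) hy hp hlt
    have e2 : 0 ≤ (3 * y * (t - p) - (y + 1) * (t - 1)) * (1 + p - q) := by
      apply mul_nonneg _ (sub_nonneg.2 (h1 hlt))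
      have a1 : 0 ≤ (t - p) * (2 * y - 1) := mul_nonneg (by linarith) (by linarith)
      have a2 : 0 ≤ (y + 1) * (1 - p) := mul_nonneg (by linarith) (by linarith)
      linarith
    linarith
  · have e1 := quad_case_mid (t := t - p) (p := p) hy
    have e2 := quad_case_right (t := t - p) hy hge
    have e3 := mul_le_mul_of_nonneg_left e1.le (sub_nonneg.2 h3)
    have e4 := mul_le_mul_of_nonneg_left e2.le (sub_nonneg.2 (h2 hge))
    rcases eq_or_lt_of_le h3 with he | hlt
    · subst he; linarith
    · have e5 := mul_lt_mul_of_pos_left e1 (sub_pos.2 hlt)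
      nlinarith


/-! ### Integrals weighted by `kernD`, and the comparison at a critical point. -/

section

variable {g : ℝ → ℝ} {σ l m a L κ K : ℝ} {ι : Type*} {F : Filter ι} {li mi : ι → ℝ}

/-- The integral of a weight against `kernD` along the gap function. -/
noncomputable def kernInt (g : ℝ → ℝ) (l m a : ℝ) (φ : ℝ → ℝ) : ℝ :=
  ∫ s in Ioo (0:ℝ) 1, kernD (gap g l m a s) * φ s

/-- The coefficient of `l` in `gap`. -/
noncomputable def gapA (g : ℝ → ℝ) (a s : ℝ) : ℝ := primG g a - primG g (a * s)

/-- The coefficient of `-m` in `gap`. -/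
noncomputable def gapB (a s : ℝ) : ℝ := a * (1 - s)

theorem gap_eq_gapA_sub_gapB (g : ℝ → ℝ) (l m a s : ℝ) :
    gap g l m a s = l * gapA g a s - m * gapB a s := rfl

theorem gapQ_eq_sub_gapB (g : ℝ → ℝ) (l m a s : ℝ) :
    gapQ g l m a s = l * gapQ g 1 0 a s - m * gapB a s := by
  unfold gapQ gapB reaction; ring

theorem continuousOn_gapA (hg : IsLogisticGrowth g σ) (ha : 0 < a) :
    ContinuousOn (gapA g a) (Ioo 0 1) :=
  continuousOn_const.sub (hg.continuousOn_primG.comp (by fun_prop)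
    fun s hs => mul_nonneg ha.le hs.1.le)

theorem continuousOn_gapB : ContinuousOn (gapB a) (Ioo 0 1) := by
  unfold gapB; fun_prop

theorem gapB_pos (ha : 0 < a) {s : ℝ} (hs : s ∈ Ioo (0:ℝ) 1) : 0 < gapB a s :=
  mul_pos ha (sub_pos.2 hs.2)

theorem gapA_pos (hg : IsLogisticGrowth g σ) (ha : a ∈ Ioo 0 σ) {s : ℝ} (hs : s ∈ Ioo (0:ℝ) 1) :
    0 < gapA g a s := hg.primG_sub_pos ⟨ha.1, ha.2.le⟩ ⟨hs.1.le, hs.2⟩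

/-- A common bound for the coefficients of the gap function and of `gapQ`. -/
theorem exists_gap_bounds (hg : IsLogisticGrowth g σ) (ha : a ∈ Ioo 0 σ) :
    ∃ K, 0 < K ∧ ∀ s ∈ Ioo (0:ℝ) 1, |gapA g a s| ≤ K * (1 - s) ∧ |gapB a s| ≤ K * (1 - s) ∧
      |gapQ g 1 0 a s| ≤ K * (1 - s) := by
  obtain ⟨K, hK, hb⟩ := exists_abs_reaction_sub_le hg one_pos 0 ha
  have ha0 := ha.1
  have hga := hg.pos ha.1 ha.2
  have e1 : 0 < a * (g a + |deriv g a| * a) := by positivity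
  have e2 : 0 < a * K := by positivity
  refine ⟨a * (g a + |deriv g a| * a) + a + a * K, by positivity, fun s hs => ?_⟩
  have hs1 : 0 < 1 - s := sub_pos.2 hs.2
  refine ⟨?_, ?_, ?_⟩
  · rw [abs_of_pos (gapA_pos hg ha hs)]
    refine (hg.primG_sub_upper ha (Ioo_subset_Icc_self hs)).trans ?_
    have h1 : |deriv g a| * (a * (1 - s)) ≤ |deriv g a| * a :=
      mul_le_mul_of_nonneg_left (mul_le_of_le_one_right ha0.le (by linarith [hs.1])) (abs_nonneg _)
    have h2 := mul_le_mul_of_nonneg_left (add_le_add_right h1 (g a)) (mul_pos ha0 hs1).le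
    have h3 := mul_pos e2 hs1
    have h4 := mul_pos ha0 hs1
    linarith
  · rw [abs_of_pos (gapB_pos ha0 hs)]
    unfold gapB
    exact mul_le_mul_of_nonneg_right (by linarith) hs1.le
  · unfold gapQ
    rw [abs_mul, abs_of_pos ha0]
    have h1 := mul_le_mul_of_nonneg_left (hb a (right_mem_Ioc.2 ha0) s hs) ha0.le
    have h3 := mul_pos e1 hs1
    have h4 := mul_pos ha0 hs1
    linarith

theorem integrableOn_kernD_mul {d φ : ℝ → ℝ} (hκ : 0 < κ) (hd : ContinuousOn d (Ioo 0 1))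
    (hφ : ContinuousOn φ (Ioo 0 1)) (hdk : ∀ s ∈ Ioo (0:ℝ) 1, κ * (1 - s) ≤ d s)
    (hb : ∀ s ∈ Ioo (0:ℝ) 1, |φ s| ≤ K * (1 - s)) :
    MeasureTheory.IntegrableOn (fun s => kernD (d s) * φ s) (Ioo 0 1) := by
  obtain ⟨C, hC, hCb⟩ := exists_kern_bounds hκ
  have hpos : ∀ s ∈ Ioo (0:ℝ) 1, 0 < d s := fun s hs =>
    (mul_pos hκ (sub_pos.2 hs.2)).trans_le (hdk s hs)
  refine (integrableOn_one_div_sqrt_mul.const_mul (|K| * C)).mono'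
    (((hd.kernD_comp hpos).mul hφ).aestronglyMeasurable measurableSet_Ioo) ?_
  filter_upwards [MeasureTheory.ae_restrict_mem measurableSet_Ioo] with s hs
  have hk := kernD_pos (hpos s hs)
  rw [norm_mul, Real.norm_eq_abs, Real.norm_eq_abs, abs_of_pos hk]
  calc kernD (d s) * |φ s| ≤ kernD (d s) * (|K| * (1 - s)) := by
        refine mul_le_mul_of_nonneg_left ((hb s hs).trans ?_) hk.le
        exact mul_le_mul_of_nonneg_right (le_abs_self K) (sub_pos.2 hs.2).le
    _ = |K| * (kernD (d s) * (1 - s)) := by ring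
    _ ≤ |K| * (C * (1 / √(s * (1 - s)))) :=
        mul_le_mul_of_nonneg_left (hCb s hs _ (hdk s hs)).2.1 (abs_nonneg _)
    _ = _ := by ring

theorem Adm.exists_le_gap (h : Adm g σ l m a) (hg : IsLogisticGrowth g σ)
    (hF : 0 < primF g m l a) : ∃ κ, 0 < κ ∧ ∀ s ∈ Ioo (0:ℝ) 1, κ * (1 - s) ≤ gap g l m a s := by
  obtain ⟨κ, hκ, hev⟩ := h.eventually_le_gap hg hF (F := pure ()) (li := fun _ => l)
    (mi := fun _ => m) (ai := fun _ => a) tendsto_const_nhds tendsto_const_nhds tendsto_const_nhds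
  exact ⟨κ, hκ, (eventually_pure.1 hev).2⟩

theorem Adm.integrableOn_kernD (h : Adm g σ l m a) (hg : IsLogisticGrowth g σ)
    (hF : 0 < primF g m l a) {φ : ℝ → ℝ} (hφ : ContinuousOn φ (Ioo 0 1))
    (hb : ∀ s ∈ Ioo (0:ℝ) 1, |φ s| ≤ K * (1 - s)) :
    MeasureTheory.IntegrableOn (fun s => kernD (gap g l m a s) * φ s) (Ioo 0 1) := by
  obtain ⟨κ, hκ, hk⟩ := h.exists_le_gap hg hF
  exact integrableOn_kernD_mul hκ (continuousOn_gap_Ioo hg h.mem.1) hφ hk hb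

theorem Adm.kernInt_pos (h : Adm g σ l m a) (hg : IsLogisticGrowth g σ)
    (hF : 0 < primF g m l a) {φ : ℝ → ℝ} (hφ : ContinuousOn φ (Ioo 0 1))
    (hb : ∀ s ∈ Ioo (0:ℝ) 1, |φ s| ≤ K * (1 - s)) (h0 : ∀ s ∈ Ioo (0:ℝ) 1, 0 < φ s) :
    0 < kernInt g l m a φ := by
  have := setIntegral_Ioo_lt (f := fun _ => 0) (MeasureTheory.integrable_const _)
    (h.integrableOn_kernD hg hF hφ hb) fun s hs => mul_pos (kernD_pos (h.gap_pos hg hs)) (h0 s hs)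
  simpa [kernInt] using this

theorem Adm.tendsto_kernInt [F.IsCountablyGenerated] (h : Adm g σ l m a)
    (hg : IsLogisticGrowth g σ) (hF : 0 < primF g m l a)
    (hli : Tendsto li F (𝓝 l)) (hmi : Tendsto mi F (𝓝 m)) {φ : ℝ → ℝ}
    (hφ : ContinuousOn φ (Ioo 0 1)) (hb : ∀ s ∈ Ioo (0:ℝ) 1, |φ s| ≤ K * (1 - s)) :
    Tendsto (fun i => kernInt g (li i) (mi i) a φ) F (𝓝 (kernInt g l m a φ)) := by
  obtain ⟨κ, hκ, hev⟩ := h.eventually_le_gap hg hF hli hmi (tendsto_const_nhds (x := a))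
  obtain ⟨C, hC, hCb⟩ := exists_kern_bounds hκ
  refine MeasureTheory.tendsto_integral_filter_of_dominated_convergence
    (fun s => |K| * C * (1 / √(s * (1 - s)))) ?_ ?_ (integrableOn_one_div_sqrt_mul.const_mul _) ?_
  · filter_upwards [hev] with i hi
    exact (((continuousOn_gap_Ioo hg h.mem.1).kernD_comp
      fun s hs => hi.1.gap_pos hg hs).mul hφ).aestronglyMeasurable measurableSet_Ioo
  · filter_upwards [hev] with i hi
    filter_upwards [MeasureTheory.ae_restrict_mem measurableSet_Ioo] with s hs
    have hk := kernD_pos (hi.1.gap_pos hg hs)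
    rw [norm_mul, Real.norm_eq_abs, Real.norm_eq_abs, abs_of_pos hk]
    calc kernD (gap g (li i) (mi i) a s) * |φ s|
        ≤ kernD (gap g (li i) (mi i) a s) * (|K| * (1 - s)) := by
          refine mul_le_mul_of_nonneg_left ((hb s hs).trans ?_) hk.le
          exact mul_le_mul_of_nonneg_right (le_abs_self K) (sub_pos.2 hs.2).le
      _ = |K| * (kernD (gap g (li i) (mi i) a s) * (1 - s)) := by ring
      _ ≤ |K| * (C * (1 / √(s * (1 - s)))) :=
          mul_le_mul_of_nonneg_left (hCb s hs _ (hi.2 s hs)).2.1 (abs_nonneg _)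
      _ = _ := by ring
  · filter_upwards [MeasureTheory.ae_restrict_mem measurableSet_Ioo] with s hs
    refine Tendsto.mul_const _ ?_
    exact ((hasDerivAt_kernD (h.gap_pos hg hs)).continuousAt.tendsto).comp
      (tendsto_gap hg h.mem.1 hs.1 hli hmi tendsto_const_nhds)

/-- With `H` convex, `gapQ - 2 gap` is `H(as) - H(a)`; once positive at `t`, it is positive for
every smaller `s`. -/
theorem Adm.gapQ_sub_pos_of_lt (h : Adm g σ l m a) (hg : IsLogisticGrowth g σ) {s t : ℝ}
    (hs : s ∈ Ioo (0:ℝ) 1) (ht : t ∈ Ioo (0:ℝ) 1) (hst : s < t)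
    (hpos : 0 < gapQ g l m a t - 2 * gap g l m a t) :
    0 < gapQ g l m a s - 2 * gap g l m a s := by
  have ha := h.mem.1
  have hs1 : 0 < 1 - s := sub_pos.2 hs.2
  have ht1 : 0 < 1 - t := sub_pos.2 ht.2
  have has : a * s ∈ Icc 0 σ :=
    ⟨(mul_pos ha hs.1).le, (mul_le_of_le_one_right ha.le hs.2.le).trans h.mem.2.le⟩
  have hc := (convexOn_two_primG_sub hg).2 has (Ioo_subset_Icc_self h.mem)
    (div_pos ht1 hs1).le (div_pos (sub_pos.2 hst) hs1).le
    (by rw [← add_div]; rw [div_eq_one_iff_eq hs1.ne']; ring)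
  have he : ((1 - t) / (1 - s)) • (a * s) + ((t - s) / (1 - s)) • a = a * t := by
    simp only [smul_eq_mul]; field_simp; ring
  rw [he] at hc
  simp only [smul_eq_mul] at hc
  rw [gapQ_eq] at hpos ⊢
  have h1 := mul_le_mul_of_nonneg_left hc h.l_pos.le
  set p := (1 - t) / (1 - s) with hp
  have hp0 : 0 < p := div_pos ht1 hs1
  have hq : (t - s) / (1 - s) = 1 - p := by rw [hp]; field_simp; ring
  rw [hq] at h1 he
  have h2 : a * t = p * (a * s) + (1 - p) * a := by rw [← he]; simp
  have h3 : 0 < p * (l * (2 * primG g (a * s) - a * s * g (a * s)) - m * (a * s) -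
      (l * (2 * primG g a - a * g a) - m * a)) := by
    have h5 : m * (a * t) = m * (p * (a * s) + (1 - p) * a) := congrArg (m * ·) h2
    linarith
  have h4 := (mul_pos_iff_of_pos_left hp0).1 h3
  linarith

/-- `gapQ - 2 gap` changes sign at most once, from plus to minus. The number `b` is `1 - s` at the
change, so passing from `b` to the weight `1 - s` favours the positive part. -/
theorem Adm.exists_gapQ_sub_mul_le (h : Adm g σ l m a) (hg : IsLogisticGrowth g σ) :
    ∃ b, 0 ≤ b ∧ ∀ s ∈ Ioo (0:ℝ) 1, b * (gapQ g l m a s - 2 * gap g l m a s) ≤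
      (gapQ g l m a s - 2 * gap g l m a s) * (1 - s) := by
  set S := {s ∈ Ioo (0:ℝ) 1 | 0 < gapQ g l m a s - 2 * gap g l m a s} with hS
  rcases S.eq_empty_or_nonempty with he | hne
  · refine ⟨1, zero_le_one, fun s hs => ?_⟩
    have h1 : gapQ g l m a s - 2 * gap g l m a s ≤ 0 := by
      by_contra! hcon
      have : s ∈ S := ⟨hs, hcon⟩
      rw [he] at this
      exact this
    have := mul_nonneg (neg_nonneg.2 h1) hs.1.le
    linarith
  · have hbdd : BddAbove S := ⟨1, fun s hs => hs.1.2.le⟩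
    refine ⟨1 - sSup S, ?_, fun s hs => ?_⟩
    · exact sub_nonneg.2 (csSup_le hne fun s hs => hs.1.2.le)
    rcases lt_or_ge s (sSup S) with hlt | hge
    · obtain ⟨t, ht, hst⟩ := exists_lt_of_lt_csSup hne hlt
      have h1 := h.gapQ_sub_pos_of_lt hg hs ht.1 hst ht.2
      rw [mul_comm]
      exact mul_le_mul_of_nonneg_left (by linarith) h1.le
    · rcases eq_or_lt_of_le hge with heq | hgt
      · rw [heq, mul_comm]
      have h1 : gapQ g l m a s - 2 * gap g l m a s ≤ 0 := by
        by_contra! hcon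
        exact (le_csSup hbdd ⟨hs, hcon⟩).not_gt hgt
      have := mul_nonneg (neg_nonneg.2 h1) (sub_nonneg.2 hge)
      linarith

theorem Adm.abs_gap_le (h : Adm g σ l m a) (hg : IsLogisticGrowth g σ) : ∃ K, 0 < K ∧
    ∀ s ∈ Ioo (0:ℝ) 1, |gap g l m a s| ≤ K * (1 - s) ∧ |gapB a s| ≤ K * (1 - s) ∧
      |gapA g a s| ≤ K * (1 - s) ∧ |gapQ g l m a s| ≤ K * (1 - s) := by
  obtain ⟨K, hK, hb⟩ := exists_gap_bounds hg h.mem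
  have hl := h.l_pos
  refine ⟨(l + |m| + 1) * K, by positivity, fun s hs => ?_⟩
  obtain ⟨h1, h2, h3⟩ := hb s hs
  have hs1 : 0 < 1 - s := sub_pos.2 hs.2
  have e1 : 0 ≤ l * (K * (1 - s)) := by positivity
  have e2 : 0 ≤ |m| * (K * (1 - s)) := by positivity
  have e3 : 0 ≤ K * (1 - s) := by positivity
  refine ⟨?_, by linarith, by linarith, ?_⟩
  · rw [gap_eq_gapA_sub_gapB]
    refine (abs_sub _ _).trans ?_
    rw [abs_mul, abs_mul, abs_of_pos hl]
    have := mul_le_mul_of_nonneg_left h1 hl.le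
    have := mul_le_mul_of_nonneg_left h2 (abs_nonneg m)
    linarith
  · rw [gapQ_eq_sub_gapB]
    refine (abs_sub _ _).trans ?_
    rw [abs_mul, abs_mul, abs_of_pos hl]
    have := mul_le_mul_of_nonneg_left h3 hl.le
    have := mul_le_mul_of_nonneg_left h2 (abs_nonneg m)
    linarith

/-- For `timeMapD = 0` the function `gapQ - (1 + x)(x² + 2x)` has zero integral against `kernD`,
where `x` is the gap. It is at most `gapQ - 2x`, and `b` times the latter is at most `f(a) gapB -
x`; integration gives the claim. -/
theorem Adm.kernInt_gap_le (h : Adm g σ l m a) (hg : IsLogisticGrowth g σ)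
    (hF : 0 < primF g m l a) (hE : timeMapD g l m a = 0) :
    kernInt g l m a (gap g l m a) ≤ reaction g m l a * kernInt g l m a (gapB a) := by
  have ha := h.mem.1
  obtain ⟨K, hK, hb⟩ := h.abs_gap_le hg
  have hcg := continuousOn_gap_Ioo (l := l) (m := m) hg ha
  have hcQ := continuousOn_gapQ (l := l) (m := m) hg ha
  have hix := h.integrableOn_kernD hg hF hcg fun s hs => (hb s hs).1
  have hiB := h.integrableOn_kernD hg hF continuousOn_gapB fun s hs => (hb s hs).2.1
  have hiQ := h.integrableOn_kernD hg hF hcQ fun s hs => (hb s hs).2.2.2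
  have hik : MeasureTheory.IntegrableOn (fun s => kern (gap g l m a s)) (Ioo 0 1) := by
    refine ((h.hasDerivAt_timeMap hg hF).1.add hiQ).congr_fun (fun s _ => ?_) measurableSet_Ioo
    simp
  obtain ⟨b, hb0, hbl⟩ := h.exists_gapQ_sub_mul_le hg
  have h1 := MeasureTheory.setIntegral_mono_on
    (f := fun s => b * (kernD (gap g l m a s) * gapQ g l m a s - kern (gap g l m a s)))
    (g := fun s => reaction g m l a * (kernD (gap g l m a s) * gapB a s) -
      kernD (gap g l m a s) * gap g l m a s)
    ((hiQ.sub hik).const_mul b) ((hiB.const_mul _).sub hix) measurableSet_Ioo fun s hs => by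
      have hx := h.gap_pos hg hs
      have hk := kernD_pos hx
      have h2 := (hbl s hs).trans (h.gapQ_sub_two_gap_mul_le hg hs)
      have h3 : 2 * gap g l m a s ≤ (1 + gap g l m a s) * (gap g l m a s ^ 2 + 2 * gap g l m a s) := by
        have : 0 < gap g l m a s ^ 3 + 3 * gap g l m a s ^ 2 := by positivity
        linarith
      have h4 := mul_le_mul_of_nonneg_left h3 hb0
      have h5 : b * (gapQ g l m a s - (1 + gap g l m a s) * (gap g l m a s ^ 2 + 2 * gap g l m a s)) ≤
          reaction g m l a * gapB a s - gap g l m a s := by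
        unfold gapB; linarith
      have h6 := mul_le_mul_of_nonneg_left h5 hk.le
      rw [kern_eq_kernD_mul hx]
      linarith
  rw [MeasureTheory.integral_const_mul, MeasureTheory.integral_sub hiQ hik,
    MeasureTheory.integral_sub (hiB.const_mul _) hix, MeasureTheory.integral_const_mul] at h1
  have h2 : timeMapD g l m a = (∫ s in Ioo (0:ℝ) 1, kern (gap g l m a s)) -
      ∫ s in Ioo (0:ℝ) 1, kernD (gap g l m a s) * gapQ g l m a s := by
    unfold timeMapD
    exact MeasureTheory.integral_sub hik hiQ
  rw [hE] at h2
  have h3 : (∫ s in Ioo (0:ℝ) 1, kernD (gap g l m a s) * gapQ g l m a s) -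
      ∫ s in Ioo (0:ℝ) 1, kern (gap g l m a s) = 0 := by linarith
  rw [h3, mul_zero] at h1
  unfold kernInt
  linarith

/-- Scaling by `x` leads to `cubic_neg` with `y = 1 + x`, `t = φ/ρ`, `p = φB/x` and `q = Q/x`. -/
theorem integrand_neg {x B Q ρ φ : ℝ} (hx : 0 < x) (hB : 0 < B) (hρ : 0 < ρ) (hφ : ρ ≤ φ)
    (h1 : φ * B < x → Q ≤ x + φ * B) (h2 : x ≤ φ * B → φ * B ≤ Q) (h3 : Q ≤ φ * B + 2 * x) :
    3 * (1 + x) / (x ^ 2 + 2 * x) * (x - ρ * B) * Q - (Q - x) - 2 * (φ / ρ) * (x - ρ * B) -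
      ρ / φ * ((1 + x) * (x ^ 2 + 2 * x) - Q) < 0 := by
  have hφ0 := hρ.trans_le hφ
  have hc := cubic_neg (y := 1 + x) (t := φ / ρ) (p := φ * B / x) (q := Q / x) (by linarith)
    ((one_le_div hρ).2 hφ) (by positivity)
    (fun h => by
      rw [div_lt_one hx] at h
      rw [div_le_iff₀ hx, add_mul, div_mul_cancel₀ _ hx.ne', one_mul]; exact h1 h)
    (fun h => by
      rw [one_le_div hx] at h
      exact div_le_div_of_nonneg_right (h2 h) hx.le)
    (by rw [div_le_iff₀ hx, add_mul, div_mul_cancel₀ _ hx.ne']; exact h3)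
  have he : 3 * (1 + x) / (x ^ 2 + 2 * x) * (x - ρ * B) * Q - (Q - x) -
      2 * (φ / ρ) * (x - ρ * B) - ρ / φ * ((1 + x) * (x ^ 2 + 2 * x) - Q) =
      x / (φ / ρ * (x + 2)) * (3 * (1 + x) * (φ / ρ - φ * B / x) * (Q / x) -
        (1 + x + 1) * (φ / ρ * (Q / x - 1) + (1 + x) * (1 + x + 1) - Q / x +
          2 * (φ / ρ) * (φ / ρ - φ * B / x))) := by
    have : x ^ 2 + 2 * x = x * (x + 2) := by ring
    rw [this]
    field_simp
    ring
  rw [he]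
  exact mul_neg_of_pos_of_neg (by positivity) hc

/-- When `timeMapD` vanishes and `ρ` is the ratio of the weighted integrals of `gap` and `gapB`, the
right-hand side has zero integral. The multipliers `2φ/ρ - 2` and `ρ/φ`, with `φ` the reaction at
`a`, make the inequality hold for each `s`. -/
theorem Adm.pointwise_neg (h : Adm g σ l m a) (hg : IsLogisticGrowth g σ) {ρ : ℝ} (hρ : 0 < ρ)
    (hφ : ρ ≤ reaction g m l a) {s : ℝ} (hs : s ∈ Ioo (0:ℝ) 1) :
    kernDD (gap g l m a s) * (gap g l m a s - ρ * gapB a s) * gapQ g l m a s -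
        kernD (gap g l m a s) * (gap g l m a s - ρ * gapB a s) -
        kernD (gap g l m a s) * (gapQ g l m a s - ρ * gapB a s) <
      (2 * (reaction g m l a / ρ) - 2) * (kernD (gap g l m a s) * gap g l m a s) -
        (2 * (reaction g m l a / ρ) - 2) * ρ * (kernD (gap g l m a s) * gapB a s) +
        ρ / reaction g m l a *
          (kern (gap g l m a s) - kernD (gap g l m a s) * gapQ g l m a s) := by
  have hx := h.gap_pos hg hs
  have hB := gapB_pos h.mem.1 hs
  have ha1 := h.gapQ_sub_two_gap_mul_le hg hs
  have hn := integrand_neg (Q := gapQ g l m a s) hx hB hρ hφ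
    (fun hlt => by
      have hs1 : 0 < 1 - s := sub_pos.2 hs.2
      by_contra! hcon
      rcases le_or_gt 0 (gapQ g l m a s - 2 * gap g l m a s) with h0 | h0
      · have := mul_nonneg h0 hs1.le
        unfold gapB at hlt
        linarith
      · have := mul_nonneg (neg_nonneg.2 h0.le) hs.1.le
        unfold gapB at hlt hcon
        linarith)
    (fun hle => h.le_gapQ hg hs hle) (h.gapQ_le hg hs)
  have hk := mul_neg_of_pos_of_neg (kernD_pos hx) hn
  rw [kernDD_eq_kernD_mul hx, kern_eq_kernD_mul hx]
  have hP := kern_arg_pos hx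
  linarith

end


/-! ### Following the curve at a fixed height as `μ` varies. -/

/-- A family of points of the bifurcation curves with a common second coordinate `a`. -/
structure LevelFamily (g : ℝ → ℝ) (σ L a : ℝ) (U : Set ℝ) (Λ : ℝ → ℝ) : Prop where
  isOpen : IsOpen U
  pos : ∀ m ∈ U, 0 < m
  onCurve : ∀ m ∈ U, OnCurve g σ L m (Λ m) a
  primF_pos : ∀ m ∈ U, 0 < primF g m (Λ m) a

/-- The derivative of `Λ` for a `LevelFamily`. -/
noncomputable def levelSlope (g : ℝ → ℝ) (a l m : ℝ) : ℝ :=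
  kernInt g l m a (gapB a) / kernInt g l m a (gapA g a)

section

variable {g Λ : ℝ → ℝ} {σ l m a L : ℝ} {U : Set ℝ}

/-- Difference quotients lie between `r x` and `r y`, so continuity of `r` suffices. This
differentiates `Λ` implicitly without partial derivatives of the time map. -/
theorem hasDerivAt_of_slope_between {f r : ℝ → ℝ} {x : ℝ}
    (h : ∀ᶠ y in 𝓝 x, (y - x) * r x ≤ f y - f x ∧ f y - f x ≤ (y - x) * r y)
    (hr : ContinuousAt r x) : HasDerivAt f (r x) x := by
  rw [hasDerivAt_iff_tendsto_slope, tendsto_iff_norm_sub_tendsto_zero]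
  have h0 : Tendsto (fun y => ‖r y - r x‖) (𝓝[≠] x) (𝓝 0) :=
    (tendsto_iff_norm_sub_tendsto_zero.1 hr.tendsto).mono_left nhdsWithin_le_nhds
  refine squeeze_zero' (Eventually.of_forall fun _ => norm_nonneg _) ?_ h0
  filter_upwards [h.filter_mono nhdsWithin_le_nhds, self_mem_nhdsWithin] with y hy hne
  rw [slope_def_field, Real.norm_eq_abs, Real.norm_eq_abs]
  rcases lt_or_gt_of_ne (show y ≠ x from hne) with hlt | hgt
  · have hd := sub_neg.2 hlt
    have h1 : (f y - f x) / (y - x) ≤ r x := by rw [div_le_iff_of_neg hd]; linarith [hy.1]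
    have h2 : r y ≤ (f y - f x) / (y - x) := by rw [le_div_iff_of_neg hd]; linarith [hy.2]
    rw [abs_of_nonpos (by linarith), abs_of_nonpos (by linarith)]
    linarith
  · have hd := sub_pos.2 hgt
    have h1 : (f y - f x) / (y - x) ≤ r y := by rw [div_le_iff₀ hd]; linarith [hy.2]
    have h2 : r x ≤ (f y - f x) / (y - x) := by rw [le_div_iff₀ hd]; linarith [hy.1]
    rw [abs_of_nonneg (by linarith), abs_of_nonneg (by linarith)]
    linarith

/-- A function which vanishes at `p` and has negative derivative at each of its zeros is negative
to the right of `p`. -/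
theorem neg_of_deriv_neg_at_zeros {e e' : ℝ → ℝ} {p q : ℝ} (hpq : p < q)
    (hd : ∀ x ∈ Icc p q, HasDerivAt e (e' x) x) (hp : e p = 0)
    (hneg : ∀ x ∈ Icc p q, e x = 0 → e' x < 0) : e q < 0 := by
  have hle : ∀ x ∈ Icc p q, e x ≤ 0 := by
    have := image_le_of_deriv_right_lt_deriv_boundary (f := e) (f' := e') (a := p) (b := q)
      (B := fun _ => 0) (B' := fun _ => 0)
      (fun x hx => (hd x hx).continuousAt.continuousWithinAt)
      (fun x hx => (hd x ⟨hx.1, hx.2.le⟩).hasDerivWithinAt) hp.le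
      (fun x => hasDerivAt_const x 0) (fun x hx h => hneg x ⟨hx.1, hx.2.le⟩ h)
    exact fun x hx => this hx
  refine lt_of_le_of_ne (hle q (right_mem_Icc.2 hpq.le)) fun hq => ?_
  have h1 := hneg q (right_mem_Icc.2 hpq.le) hq
  have h3 := (hasDerivAt_iff_tendsto_slope.1 (hd q (right_mem_Icc.2 hpq.le))).mono_left
      (nhdsWithin_mono q fun x (hx : x ∈ Iio q) => ne_of_lt hx)
  obtain ⟨x, hx, hxI⟩ := ((h3.eventually (gt_mem_nhds h1)).and (Ioo_mem_nhdsLT hpq)).exists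
  rw [slope_def_field, div_lt_iff_of_neg (sub_neg.2 hxI.2), zero_mul, hq, sub_zero] at hx
  exact (hle x ⟨hxI.1.le, hxI.2.le⟩).not_gt hx

namespace LevelFamily

theorem continuousAt (h : LevelFamily g σ L a U Λ) (hg : IsLogisticGrowth g σ) (hm : m ∈ U) :
    ContinuousAt Λ m := by
  refine (h.onCurve m hm).tendsto hg (h.pos m hm) tendsto_id tendsto_const_nhds ?_
  filter_upwards [h.isOpen.mem_nhds hm] with x hx using h.onCurve x hx

theorem continuousAt_kernInt (h : LevelFamily g σ L a U Λ) (hg : IsLogisticGrowth g σ)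
    (hm : m ∈ U) {φ : ℝ → ℝ} {K : ℝ} (hφ : ContinuousOn φ (Ioo 0 1))
    (hb : ∀ s ∈ Ioo (0:ℝ) 1, |φ s| ≤ K * (1 - s)) :
    ContinuousAt (fun m => kernInt g (Λ m) m a φ) m :=
  (h.onCurve m hm).adm.tendsto_kernInt hg (h.primF_pos m hm) (h.continuousAt hg hm) tendsto_id hφ hb

theorem kernInt_gapA_pos (h : LevelFamily g σ L a U Λ) (hg : IsLogisticGrowth g σ) (hm : m ∈ U) :
    0 < kernInt g (Λ m) m a (gapA g a) := by
  have hA := (h.onCurve m hm).adm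
  obtain ⟨K, -, hb⟩ := exists_gap_bounds hg hA.mem
  exact hA.kernInt_pos hg (h.primF_pos m hm) (continuousOn_gapA hg hA.mem.1)
    (fun s hs => (hb s hs).1) fun s hs => gapA_pos hg hA.mem hs

theorem kernInt_gapB_pos (h : LevelFamily g σ L a U Λ) (hg : IsLogisticGrowth g σ) (hm : m ∈ U) :
    0 < kernInt g (Λ m) m a (gapB a) := by
  have hA := (h.onCurve m hm).adm
  obtain ⟨K, -, hb⟩ := exists_gap_bounds hg hA.mem
  exact hA.kernInt_pos hg (h.primF_pos m hm) continuousOn_gapB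
    (fun s hs => (hb s hs).2.1) fun s hs => gapB_pos hA.mem.1 hs

theorem levelSlope_pos (h : LevelFamily g σ L a U Λ) (hg : IsLogisticGrowth g σ) (hm : m ∈ U) :
    0 < levelSlope g a (Λ m) m := div_pos (h.kernInt_gapB_pos hg hm) (h.kernInt_gapA_pos hg hm)

theorem continuousAt_levelSlope (h : LevelFamily g σ L a U Λ) (hg : IsLogisticGrowth g σ)
    (hm : m ∈ U) : ContinuousAt (fun m => levelSlope g a (Λ m) m) m := by
  have hA := (h.onCurve m hm).adm
  obtain ⟨K, -, hb⟩ := exists_gap_bounds hg hA.mem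
  exact (h.continuousAt_kernInt hg hm continuousOn_gapB fun s hs => (hb s hs).2.1).div
    (h.continuousAt_kernInt hg hm (continuousOn_gapA hg hA.mem.1) fun s hs => (hb s hs).1)
    (h.kernInt_gapA_pos hg hm).ne'

theorem integrableOn_kern (h : LevelFamily g σ L a U Λ) (hg : IsLogisticGrowth g σ) (hm : m ∈ U) :
    MeasureTheory.IntegrableOn (fun s => kern (gap g (Λ m) m a s)) (Ioo 0 1) ∧
    ∫ s in Ioo (0:ℝ) 1, kern (gap g (Λ m) m a s) = L / a := by
  have hA := (h.onCurve m hm).adm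
  have ha := hA.mem.1
  have h1 : MeasureTheory.IntegrableOn (fun s => kern (gap g (Λ m) m a s)) (Ioo 0 1) := by
    have h2 : MeasureTheory.IntegrableOn (fun s => 1 / a * (a * kern (gap g (Λ m) m a s)))
      (Ioo 0 1) := (hA.integrableOn hg).const_mul (1 / a)
    exact h2.congr_fun (fun s _ => by field_simp) measurableSet_Ioo
  refine ⟨h1, ?_⟩
  have h2 := (h.onCurve m hm).time
  unfold timeMap at h2
  rw [MeasureTheory.integral_const_mul] at h2
  rw [eq_div_iff ha.ne', mul_comm]
  exact h2

/-- The tangent inequality for the convex kernel is integrated; since both time maps equal `L`, the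
difference of the kernels integrates to zero. Exchanging `m` and `n` gives the opposite bound. -/
theorem mul_levelSlope_le (h : LevelFamily g σ L a U Λ) (hg : IsLogisticGrowth g σ) {n : ℝ}
    (hm : m ∈ U) (hn : n ∈ U) : (n - m) * levelSlope g a (Λ m) m ≤ Λ n - Λ m := by
  have hA := (h.onCurve m hm).adm
  have hF := h.primF_pos m hm
  obtain ⟨K, -, hb⟩ := exists_gap_bounds hg hA.mem
  have hiA := hA.integrableOn_kernD hg hF (continuousOn_gapA hg hA.mem.1) fun s hs => (hb s hs).1
  have hiB := hA.integrableOn_kernD hg hF continuousOn_gapB fun s hs => (hb s hs).2.1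
  obtain ⟨hi1, he1⟩ := h.integrableOn_kern hg hm
  obtain ⟨hi2, he2⟩ := h.integrableOn_kern hg hn
  have h1 := MeasureTheory.setIntegral_mono_on
    (f := fun s => (n - m) * (kernD (gap g (Λ m) m a s) * gapB a s) -
      (Λ n - Λ m) * (kernD (gap g (Λ m) m a s) * gapA g a s))
    (g := fun s => kern (gap g (Λ n) n a s) - kern (gap g (Λ m) m a s))
    ((hiB.const_mul _).sub (hiA.const_mul _)) (hi2.sub hi1) measurableSet_Ioo fun s hs => by
      have h2 := kern_tangent (hA.gap_pos hg hs) ((h.onCurve n hn).adm.gap_pos hg hs)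
      have h3 : gap g (Λ n) n a s - gap g (Λ m) m a s =
          (Λ n - Λ m) * gapA g a s - (n - m) * gapB a s := by
        simp only [gap_eq_gapA_sub_gapB]; ring
      rw [h3] at h2
      linarith
  rw [MeasureTheory.integral_sub (hiB.const_mul _) (hiA.const_mul _),
    MeasureTheory.integral_const_mul, MeasureTheory.integral_const_mul,
    MeasureTheory.integral_sub hi2 hi1, he1, he2, sub_self] at h1
  have hp := h.kernInt_gapA_pos hg hm
  unfold levelSlope
  rw [← mul_div_assoc, div_le_iff₀ hp]
  unfold kernInt
  linarith

theorem hasDerivAt (h : LevelFamily g σ L a U Λ) (hg : IsLogisticGrowth g σ) (hm : m ∈ U) :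
    HasDerivAt Λ (levelSlope g a (Λ m) m) m := by
  refine hasDerivAt_of_slope_between (r := fun m => levelSlope g a (Λ m) m) ?_
    (h.continuousAt_levelSlope hg hm)
  filter_upwards [h.isOpen.mem_nhds hm] with n hn
  refine ⟨h.mul_levelSlope_le hg hm hn, ?_⟩
  have := h.mul_levelSlope_le hg hn hm
  linarith

/-- The integrand of the derivative of `timeMapD` along a `LevelFamily`. -/
noncomputable def integrand (g Λ : ℝ → ℝ) (a m s : ℝ) : ℝ :=
  kernDD (gap g (Λ m) m a s) * (levelSlope g a (Λ m) m * gapA g a s - gapB a s) *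
      gapQ g (Λ m) m a s -
    kernD (gap g (Λ m) m a s) * (levelSlope g a (Λ m) m * gapA g a s - gapB a s) -
    kernD (gap g (Λ m) m a s) * (levelSlope g a (Λ m) m * gapQ g 1 0 a s - gapB a s)

theorem hasDerivAt_timeMapD (h : LevelFamily g σ L a U Λ) (hg : IsLogisticGrowth g σ)
    (hm : m ∈ U) :
    MeasureTheory.IntegrableOn (integrand g Λ a m) (Ioo 0 1) ∧
    HasDerivAt (fun m => timeMapD g (Λ m) m a) (∫ s in Ioo (0:ℝ) 1, integrand g Λ a m s) m := by
  have hA := (h.onCurve m hm).adm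
  have ha := hA.mem.1
  have hΛc := h.continuousAt hg hm
  obtain ⟨κ, hκ, hev⟩ : ∃ κ, 0 < κ ∧ ∀ᶠ n in 𝓝 m, Adm g σ (Λ n) n a ∧
      ∀ s ∈ Ioo (0:ℝ) 1, κ * (1 - s) ≤ gap g (Λ n) n a s :=
    hA.eventually_le_gap hg (h.primF_pos m hm) hΛc tendsto_id tendsto_const_nhds
  obtain ⟨C, hC, hCb⟩ := exists_kern_bounds hκ
  obtain ⟨K, hK, hb⟩ := exists_gap_bounds hg hA.mem
  obtain ⟨M, hM, hΛM, hmM, hrM⟩ : ∃ M, 0 < M ∧ (∀ᶠ n in 𝓝 m, |Λ n| ≤ M) ∧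
      (∀ᶠ n in 𝓝 m, |n| ≤ M) ∧ ∀ᶠ n in 𝓝 m, |levelSlope g a (Λ n) n| ≤ M := by
    have e1 := abs_nonneg (Λ m)
    have e2 := abs_nonneg m
    have e3 := abs_nonneg (levelSlope g a (Λ m) m)
    refine ⟨|Λ m| + |m| + |levelSlope g a (Λ m) m| + 1, by positivity, ?_, ?_, ?_⟩
    · exact (hΛc.abs.eventually (gt_mem_nhds (by linarith))).mono fun _ hn => le_of_lt hn
    · exact (continuous_abs.continuousAt.eventually (gt_mem_nhds (by linarith))).mono
        fun _ hn => le_of_lt hn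
    · exact ((h.continuousAt_levelSlope hg hm).abs.eventually
        (gt_mem_nhds (by linarith))).mono fun _ hn => le_of_lt hn
  have hS := (((hev.and (h.isOpen.mem_nhds hm)).and hΛM).and hmM).and hrM
  have hcA := continuousOn_gapA hg ha
  have hcB := continuousOn_gapB (a := a)
  have hcQ := continuousOn_gapQ (l := 1) (m := 0) hg ha
  have hcg : ∀ n, Adm g σ (Λ n) n a → ContinuousOn
      (fun s => kern (gap g (Λ n) n a s) - kernD (gap g (Λ n) n a s) * gapQ g (Λ n) n a s)
      (Ioo 0 1) := fun n hn =>
    ((continuousOn_gap_Ioo hg ha).kern_comp fun s hs => hn.gap_pos hg hs).sub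
      (((continuousOn_gap_Ioo hg ha).kernD_comp fun s hs => hn.gap_pos hg hs).mul
        (continuousOn_gapQ hg ha))
  refine hasDerivAt_integral_of_dominated_loc_of_deriv_le
    (μ := MeasureTheory.volume.restrict (Ioo (0:ℝ) 1)) (x₀ := m)
    (F := fun n s => kern (gap g (Λ n) n a s) - kernD (gap g (Λ n) n a s) * gapQ g (Λ n) n a s)
    (F' := fun n s => integrand g Λ a n s)
    (bound := fun s => (((M + 1) * K) * (2 * M * K) * C + 2 * (((M + 1) * K) * C)) *
      (1 / √(s * (1 - s)))) hS
    (hS.mono fun n hn => (hcg n hn.1.1.1.1.1).aestronglyMeasurable measurableSet_Ioo)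
    (hA.hasDerivAt_timeMap hg (h.primF_pos m hm)).1 ?_
    ?_ (integrableOn_one_div_sqrt_mul.const_mul _) ?_
  · have hcx := (continuousOn_gap_Ioo (l := Λ m) (m := m) hg ha)
    have hkd := hcx.kernD_comp fun s hs => hA.gap_pos hg hs
    have hkdd := hcx.kernDD_comp fun s hs => hA.gap_pos hg hs
    have hx' := (hcA.const_smul (levelSlope g a (Λ m) m)).sub hcB
    exact (((hkdd.mul hx').mul (continuousOn_gapQ hg ha)).sub (hkd.mul hx')).sub
      (hkd.mul ((hcQ.const_smul (levelSlope g a (Λ m) m)).sub hcB)) |>.aestronglyMeasurable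
      measurableSet_Ioo
  · filter_upwards [MeasureTheory.ae_restrict_mem measurableSet_Ioo] with s hs n hn
    obtain ⟨⟨⟨⟨⟨hnA, hnk⟩, -⟩, hn1⟩, hn2⟩, hn3⟩ := hn
    obtain ⟨-, hd1, hd2⟩ := hCb s hs _ (hnk s hs)
    obtain ⟨b1, b2, b3⟩ := hb s hs
    have hgp := hnA.gap_pos hg hs
    have hs1 : 0 < 1 - s := sub_pos.2 hs.2
    have hkD := kernD_pos hgp
    have hkDD := kernDD_pos hgp
    set w := 1 / √(s * (1 - s))
    have hx' : |levelSlope g a (Λ n) n * gapA g a s - gapB a s| ≤ (M + 1) * K * (1 - s) := by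
      refine (abs_sub _ _).trans ?_
      rw [abs_mul]
      have := mul_le_mul hn3 b1 (abs_nonneg _) hM.le
      linarith
    have hq' : |levelSlope g a (Λ n) n * gapQ g 1 0 a s - gapB a s| ≤ (M + 1) * K * (1 - s) := by
      refine (abs_sub _ _).trans ?_
      rw [abs_mul]
      have := mul_le_mul hn3 b3 (abs_nonneg _) hM.le
      linarith
    have hq : |gapQ g (Λ n) n a s| ≤ 2 * M * K * (1 - s) := by
      rw [gapQ_eq_sub_gapB]
      refine (abs_sub _ _).trans ?_
      rw [abs_mul, abs_mul]
      have e1 := mul_le_mul hn1 b3 (abs_nonneg _) hM.le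
      have e2 := mul_le_mul hn2 b2 (abs_nonneg _) hM.le
      linarith
    have t1 : |kernDD (gap g (Λ n) n a s) * (levelSlope g a (Λ n) n * gapA g a s - gapB a s) *
        gapQ g (Λ n) n a s| ≤ ((M + 1) * K) * (2 * M * K) * (C * w) := by
      rw [abs_mul, abs_mul, abs_of_pos hkDD]
      calc _ ≤ kernDD (gap g (Λ n) n a s) * ((M + 1) * K * (1 - s)) * (2 * M * K * (1 - s)) := by
            gcongr
        _ = ((M + 1) * K) * (2 * M * K) * (kernDD (gap g (Λ n) n a s) * (1 - s) ^ 2) := by ring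
        _ ≤ _ := mul_le_mul_of_nonneg_left hd2 (by positivity)
    have t2 : ∀ z, |z| ≤ (M + 1) * K * (1 - s) →
        |kernD (gap g (Λ n) n a s) * z| ≤ (M + 1) * K * (C * w) := by
      intro z hz
      rw [abs_mul, abs_of_pos hkD]
      calc _ ≤ kernD (gap g (Λ n) n a s) * ((M + 1) * K * (1 - s)) := by gcongr
        _ = (M + 1) * K * (kernD (gap g (Λ n) n a s) * (1 - s)) := by ring
        _ ≤ _ := mul_le_mul_of_nonneg_left hd1 (by positivity)
    rw [Real.norm_eq_abs]
    unfold integrand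
    have u1 := abs_sub (kernDD (gap g (Λ n) n a s) *
      (levelSlope g a (Λ n) n * gapA g a s - gapB a s) * gapQ g (Λ n) n a s -
      kernD (gap g (Λ n) n a s) * (levelSlope g a (Λ n) n * gapA g a s - gapB a s))
      (kernD (gap g (Λ n) n a s) * (levelSlope g a (Λ n) n * gapQ g 1 0 a s - gapB a s))
    have u2 := abs_sub (kernDD (gap g (Λ n) n a s) *
      (levelSlope g a (Λ n) n * gapA g a s - gapB a s) * gapQ g (Λ n) n a s)
      (kernD (gap g (Λ n) n a s) * (levelSlope g a (Λ n) n * gapA g a s - gapB a s))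
    have u3 := t2 _ hx'
    have u4 := t2 _ hq'
    linarith
  · filter_upwards [MeasureTheory.ae_restrict_mem measurableSet_Ioo] with s hs n hn
    obtain ⟨⟨⟨⟨⟨hnA, -⟩, hnU⟩, -⟩, -⟩, -⟩ := hn
    have hgp := hnA.gap_pos hg hs
    have hΛ := h.hasDerivAt hg hnU
    have hx : HasDerivAt (fun n => gap g (Λ n) n a s)
        (levelSlope g a (Λ n) n * gapA g a s - gapB a s) n := by
      refine ((hΛ.mul_const (gapA g a s)).fun_sub
        ((hasDerivAt_id' n).mul_const (gapB a s))).congr_deriv ?_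
      ring
    have hQ : HasDerivAt (fun n => gapQ g (Λ n) n a s)
        (levelSlope g a (Λ n) n * gapQ g 1 0 a s - gapB a s) n := by
      simp only [gapQ_eq_sub_gapB g (Λ _) _ a s]
      refine ((hΛ.mul_const (gapQ g 1 0 a s)).fun_sub
        ((hasDerivAt_id' n).mul_const (gapB a s))).congr_deriv ?_
      ring
    have h1 := ((hasDerivAt_kern hgp).comp n hx).fun_sub
      (((hasDerivAt_kernD hgp).comp n hx).fun_mul hQ)
    refine h1.congr_deriv ?_
    unfold integrand
    simp only [Function.comp]
    ring

theorem integral_integrand_neg (h : LevelFamily g σ L a U Λ) (hg : IsLogisticGrowth g σ)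
    (hm : m ∈ U) (hE : timeMapD g (Λ m) m a = 0) :
    ∫ s in Ioo (0:ℝ) 1, integrand g Λ a m s < 0 := by
  have hA := (h.onCurve m hm).adm
  have hF := h.primF_pos m hm
  have ha := hA.mem.1
  have hl := hA.l_pos
  obtain ⟨K, hK, hb⟩ := hA.abs_gap_le hg
  have hix := hA.integrableOn_kernD hg hF (continuousOn_gap_Ioo hg ha) fun s hs => (hb s hs).1
  have hiB := hA.integrableOn_kernD hg hF continuousOn_gapB fun s hs => (hb s hs).2.1
  have hiA := hA.integrableOn_kernD hg hF (continuousOn_gapA hg ha) fun s hs => (hb s hs).2.2.1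
  have hIA := h.kernInt_gapA_pos hg hm
  have hIB := h.kernInt_gapB_pos hg hm
  have hIx := hA.kernInt_pos hg hF (continuousOn_gap_Ioo hg ha) (fun s hs => (hb s hs).1)
    fun s hs => hA.gap_pos hg hs
  have hr := h.levelSlope_pos hg hm
  set r := levelSlope g a (Λ m) m with hr_def
  have hIxe : kernInt g (Λ m) m a (gap g (Λ m) m a) =
      Λ m * kernInt g (Λ m) m a (gapA g a) - m * kernInt g (Λ m) m a (gapB a) := by
    unfold kernInt
    rw [← MeasureTheory.integral_const_mul, ← MeasureTheory.integral_const_mul,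
      ← MeasureTheory.integral_sub (hiA.const_mul _) (hiB.const_mul _)]
    congr 1
    ext s
    nth_rewrite 2 [gap_eq_gapA_sub_gapB]
    ring
  -- This `ρ` makes `gap - ρ gapB` integrate to zero against `kernD`.
  set ρ := kernInt g (Λ m) m a (gap g (Λ m) m a) / kernInt g (Λ m) m a (gapB a) with hρ_def
  have hρ : 0 < ρ := div_pos hIx hIB
  -- Hence the `m`-derivatives of `gap` and `gapQ` along the family are `r/Λ` times `gap - ρ gapB`
  -- and `gapQ - ρ gapB`, the combinations in `Adm.pointwise_neg`.
  have hlr : Λ m = r * (ρ + m) := by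
    rw [hρ_def, hIxe, hr_def]
    unfold levelSlope
    field_simp
    ring
  have hφ : ρ ≤ reaction g m (Λ m) a := by
    rw [hρ_def, div_le_iff₀ hIB]
    exact hA.kernInt_gap_le hg hF hE
  set c := 2 * (reaction g m (Λ m) a / ρ) - 2 with hc
  set d := ρ / reaction g m (Λ m) a with hd
  have hiE := (hA.hasDerivAt_timeMap hg hF).1
  have hi2 : MeasureTheory.IntegrableOn (fun s => c * (kernD (gap g (Λ m) m a s) * gap g (Λ m) m a s) -
      c * ρ * (kernD (gap g (Λ m) m a s) * gapB a s)) (Ioo 0 1) :=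
    (hix.const_mul c).sub (hiB.const_mul (c * ρ))
  have hih := hi2.add (hiE.const_mul d)
  have hrl : 0 < r / Λ m := div_pos hr hl
  have hmain := setIntegral_Ioo_lt (h.hasDerivAt_timeMapD hg hm).1 (hih.const_mul (r / Λ m))
    fun s hs => by
      have h1 := mul_lt_mul_of_pos_left (hA.pointwise_neg hg hρ hφ hs) hrl
      have h2 : r * gapA g a s - gapB a s =
          r / Λ m * (gap g (Λ m) m a s - ρ * gapB a s) := by
        rw [gap_eq_gapA_sub_gapB, div_mul_eq_mul_div, eq_div_iff hl.ne']
        have : gapB a s * Λ m = gapB a s * (r * (ρ + m)) := by rw [← hlr]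
        linarith
      have h3 : r * gapQ g 1 0 a s - gapB a s =
          r / Λ m * (gapQ g (Λ m) m a s - ρ * gapB a s) := by
        rw [gapQ_eq_sub_gapB g (Λ m) m a s, div_mul_eq_mul_div, eq_div_iff hl.ne']
        have : gapB a s * Λ m = gapB a s * (r * (ρ + m)) := by rw [← hlr]
        linarith
      unfold integrand
      rw [← hr_def, h2, h3]
      refine lt_of_eq_of_lt ?_ h1
      ring
  -- The majorant integrates to zero, by the choice of `ρ` and by `timeMapD = 0`.
  refine hmain.trans_le (le_of_eq ?_)
  rw [MeasureTheory.integral_const_mul]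
  simp only [Pi.add_apply]
  rw [MeasureTheory.integral_add hi2 (hiE.const_mul d), MeasureTheory.integral_sub (hix.const_mul c) (hiB.const_mul (c * ρ)),
    MeasureTheory.integral_const_mul, MeasureTheory.integral_const_mul,
    MeasureTheory.integral_const_mul]
  have e1 : ∫ s in Ioo (0:ℝ) 1, (kern (gap g (Λ m) m a s) -
      kernD (gap g (Λ m) m a s) * gapQ g (Λ m) m a s) = 0 := hE
  have e2 : (∫ s in Ioo (0:ℝ) 1, kernD (gap g (Λ m) m a s) * gap g (Λ m) m a s) =
      ρ * ∫ s in Ioo (0:ℝ) 1, kernD (gap g (Λ m) m a s) * gapB a s := by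
    change kernInt g (Λ m) m a (gap g (Λ m) m a) = ρ * kernInt g (Λ m) m a (gapB a)
    rw [hρ_def, div_mul_cancel₀ _ hIB.ne']
  rw [e1, e2]
  ring

theorem timeMapD_neg (h : LevelFamily g σ L a U Λ) (hg : IsLogisticGrowth g σ) {p q : ℝ}
    (hpq : p < q) (hU : Icc p q ⊆ U) (hE : timeMapD g (Λ p) p a = 0) :
    timeMapD g (Λ q) q a < 0 :=
  neg_of_deriv_neg_at_zeros (e := fun m => timeMapD g (Λ m) m a) hpq
    (fun _ hx => (h.hasDerivAt_timeMapD hg (hU hx)).2) hE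
    fun _ hx h0 => h.integral_integrand_neg hg (hU hx) h0

end LevelFamily

end


/-! ### Monotonicity and continuity in `μ`. -/

section

variable {g : ℝ → ℝ} {σ l m a b c L l' m' a' : ℝ} {ι : Type*} {F : Filter ι} {li mi ai : ι → ℝ}

theorem IsTurn.le (h : IsTurn g σ L m l a) (h' : OnCurve g σ L m l' a')
    (hg : IsLogisticGrowth g σ) : l ≤ l' := by
  by_cases hne : a' = a
  · subst hne; exact (h.onCurve.unique h' hg).le
  · exact (h.lt _ _ h' hne).le

theorem IsStart.lt_of_isTurn (h : IsStart g c L m l a) (h' : IsTurn g σ L m l' a')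
    (hg : IsLogisticGrowth g σ) (hc : IsCStar g σ c) (hm : 0 < m) : a < a' := by
  refine lt_of_le_of_ne (h.le_of_onCurve hg hc hm h'.onCurve).1 fun he => ?_
  subst he
  have := h'.primF_pos hg hc hm
  rw [h'.onCurve.unique (h.onCurve hg hc) hg, h.primF_eq] at this
  exact this.false

theorem IsStart.primF_pos (h : IsStart g c L m l a) (h' : OnCurve g σ L m l' a')
    (hg : IsLogisticGrowth g σ) (hc : IsCStar g σ c) (hlt : a < a') : 0 < primF g m l' a' := by
  rcases lt_or_ge a' c with hac | hac
  · by_contra! hle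
    have h0 := le_antisymm hle h'.adm.primF_nonneg
    have ha := h'.adm.mem.1
    have hs : IsStart g c L m l' a' := ⟨h'.adm.l_pos, ⟨ha, hac⟩, by
      rw [← mul_div_assoc, div_eq_iff ha.ne']; unfold primF at h0; linarith, h'.time⟩
    have hm : 0 < m := by
      rw [← h.eq]; exact mul_pos h.l_pos (hc.mean_pos hg ⟨h.mem.1, h.mem.2.le⟩)
    exact hlt.ne (h.a_unique hs hg hc hm)
  · exact (timeMapD_pos h'.adm hg hc hac).1

/-- Monotonicity traps the heights between those for `m/2` and `2m`; uniqueness of the starting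
point identifies every limit. -/
theorem IsStart.tendsto (h : IsStart g c L m l a) (hg : IsLogisticGrowth g σ)
    (hc : IsCStar g σ c) (hL : 0 < L) (hm : 0 < m) (hmi : Tendsto mi F (𝓝 m))
    (hi : ∀ᶠ i in F, IsStart g c L (mi i) (li i) (ai i)) :
    Tendsto li F (𝓝 l) ∧ Tendsto ai F (𝓝 a) := by
  obtain ⟨l₁, a₁, h₁⟩ := hc.exists_isStart hg hL (half_pos hm)
  obtain ⟨l₂, a₂, h₂⟩ := hc.exists_isStart hg hL (mul_pos two_pos hm)
  have hM : ∀ {x : ℝ}, x ∈ Ioo 0 c → primG g x / x ≠ 0 := fun hx =>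
    (hc.mean_pos hg ⟨hx.1, hx.2.le⟩).ne'
  have key : ∀ (U : Filter ι) (x : ℝ), U ≤ F → x ∈ Ioo 0 c → Tendsto ai U (𝓝 x) →
      Tendsto li U (𝓝 (m / (primG g x / x))) := by
    intro U x hU hx hUx
    refine ((hmi.mono_left hU).div ((continuousAt_mean hg hx.1).tendsto.comp hUx) (hM hx)).congr' ?_
    exact (hi.filter_mono hU).mono fun i h => (h.l_eq hg hc).symm
  have ha : Tendsto ai F (𝓝 a) := by
    refine IsCompact.tendsto_nhds_of_unique_ultrafilter (K := Icc a₁ a₂) isCompact_Icc ?_ ?_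
    · filter_upwards [hi, hmi.eventually (lt_mem_nhds (half_lt_self hm)),
        hmi.eventually (gt_mem_nhds (by linarith : m < 2 * m))] with i h3 h4 h5
      exact ⟨(h₁.a_lt h3 hg hc h4).le, (h3.a_lt h₂ hg hc h5).le⟩
    · intro U hU x hx hUx
      have hxc : x ∈ Ioo 0 c := ⟨h₁.mem.1.trans_le hx.1, hx.2.trans_lt h₂.mem.2⟩
      have hpos := div_pos hm (hc.mean_pos hg ⟨hxc.1, hxc.2.le⟩)
      have h3 := OnCurve.of_tendsto hg hpos ⟨hxc.1, hxc.2.trans hc.mem.2⟩ (key U x hU hxc hUx)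
        (hmi.mono_left hU) hUx ((hi.filter_mono hU).mono fun i h => h.onCurve hg hc)
      exact (h.a_unique ⟨hpos, hxc, div_mul_cancel₀ _ (hM hxc), h3.time⟩ hg hc hm).symm
  refine ⟨?_, ha⟩
  rw [h.l_eq hg hc]
  exact key F a le_rfl h.mem ha

/-- If `a' ≤ a`, the height `a` is available for all parameters in `[m, m']`. The `a`-derivative
vanishes there at `m`, hence is negative at `m'`, and this places the turn of `m'` strictly above
`a`. -/
theorem IsTurn.a_lt (h : IsTurn g σ L m l a) (h' : IsTurn g σ L m' l' a')
    (hg : IsLogisticGrowth g σ) (hc : IsCStar g σ c) (hL : 0 < L) (hm : 0 < m) (hmm : m < m') :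
    a < a' := by
  by_contra! hle
  have hm' := hm.trans hmm
  choose! lb ab hb using fun n (hn : 0 < n) => hc.exists_isStart hg hL hn
  have hac := (hb m hm).le_of_onCurve hg hc hm h.onCurve
  have hlt : ab m' < a := ((hb m' hm').lt_of_isTurn h' hg hc hm').trans_le hle
  set U := {n : ℝ | 0 < n ∧ ab n < a} with hU
  choose! Λ hΛ using fun n (hn : n ∈ U) =>
    (hb n hn.1).exists_onCurve hg hc hn.1 (b := a) ⟨hn.2.le, hac.2⟩
  have hfam : LevelFamily g σ L a U Λ := by
    refine ⟨?_, fun n hn => hn.1, hΛ, fun n hn => (hb n hn.1).primF_pos (hΛ n hn) hg hc hn.2⟩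
    rw [isOpen_iff_mem_nhds]
    intro n hn
    have hev : ∀ᶠ x in 𝓝 n, 0 < x := lt_mem_nhds hn.1
    have ht := ((hb n hn.1).tendsto hg hc hL hn.1 (F := 𝓝 n) (mi := fun x => x) (li := lb) (ai := ab)
      tendsto_id (hev.mono fun x hx => hb x hx)).2
    filter_upwards [hev, ht.eventually (gt_mem_nhds hn.2)] with x h1 h2 using ⟨h1, h2⟩
  have hsub : Icc m m' ⊆ U := by
    intro n hn
    have hn0 := hm.trans_le hn.1
    refine ⟨hn0, ?_⟩
    rcases eq_or_lt_of_le hn.2 with he | h1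
    · rw [he]; exact hlt
    · exact ((hb n hn0).a_lt (hb m' hm') hg hc h1).trans hlt
  have hmU := hsub (left_mem_Icc.2 hmm.le)
  have hmU' := hsub (right_mem_Icc.2 hmm.le)
  have hE : timeMapD g (Λ m) m a = 0 := by
    rw [(hΛ m hmU).unique h.onCurve hg]
    exact h.timeMapD_eq_zero hg hc hL hm
  have hneg := hfam.timeMapD_neg hg hmm hsub hE
  have := h'.lt_of_timeMapD_neg hg hc hL hm' (hΛ m' hmU') (hfam.primF_pos m' hmU') hneg
  linarith

/-- The time map increases with `m`, so at height `a'` the curve for `m` lies left of `(l', a')`,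
and `l` is the least value on that curve. -/
theorem IsTurn.l_lt (h : IsTurn g σ L m l a) (h' : IsTurn g σ L m' l' a')
    (hg : IsLogisticGrowth g σ) (hc : IsCStar g σ c) (hL : 0 < L) (hm : 0 < m) (hmm : m < m') :
    l < l' := by
  have hm' := hm.trans hmm
  obtain ⟨l₁, a₁, h₁⟩ := hc.exists_isStart hg hL hm
  obtain ⟨l₂, a₂, h₂⟩ := hc.exists_isStart hg hL hm'
  have h3 := h₂.le_of_onCurve hg hc hm' h'.onCurve
  obtain ⟨l₃, h4⟩ := h₁.exists_onCurve hg hc hm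
    ⟨(h₁.a_lt h₂ hg hc hmm).le.trans h3.1, h3.2⟩
  refine (h.le h4 hg).trans_lt (h4.lt_of_timeMap_lt hg (h'.onCurve.adm.anti_m hmm.le) ?_)
  rw [← h'.onCurve.time]
  exact h'.onCurve.adm.timeMap_lt_of_lt_m hg hmm

theorem IsStart.exists_isTurn (h : IsStart g c L m l a) (hg : IsLogisticGrowth g σ)
    (hc : IsCStar g σ c) (hL : 0 < L) (hm : 0 < m) : ∃ l' a', IsTurn g σ L m l' a' :=
  let ⟨l', a', h', _⟩ := h.isSubsetShaped hg hc hL hm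
  ⟨l', a', h'⟩

theorem IsTurn.tendsto (h : IsTurn g σ L m l a) (hg : IsLogisticGrowth g σ)
    (hc : IsCStar g σ c) (hL : 0 < L) (hm : 0 < m) (hmi : Tendsto mi F (𝓝 m))
    (hi : ∀ᶠ i in F, IsTurn g σ L (mi i) (li i) (ai i)) :
    Tendsto li F (𝓝 l) ∧ Tendsto ai F (𝓝 a) := by
  choose! lb ab hb using fun n (hn : 0 < n) => hc.exists_isStart hg hL hn
  obtain ⟨l₁, a₁, h₁⟩ := (hb _ (half_pos hm)).exists_isTurn hg hc hL (half_pos hm)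
  obtain ⟨l₂, a₂, h₂⟩ := (hb _ (mul_pos two_pos hm)).exists_isTurn hg hc hL (mul_pos two_pos hm)
  have hmp : ∀ᶠ i in F, 0 < mi i := hmi.eventually (lt_mem_nhds hm)
  have hab := ((hb m hm).tendsto hg hc hL hm hmi (li := fun i => lb (mi i))
    (ai := fun i => ab (mi i)) (hmp.mono fun i hi => hb _ hi)).2
  have haL := ((hb m hm).le_of_onCurve hg hc hm h.onCurve).2
  have hev := hab.eventually (gt_mem_nhds ((hb m hm).lt_of_isTurn h hg hc hm))
  have hex : ∀ᶠ i in F, ∃ x, OnCurve g σ L (mi i) x a := by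
    filter_upwards [hev, hmp] with i h3 h4
    exact (hb _ h4).exists_onCurve hg hc h4 ⟨h3.le, haL⟩
  -- The points at height `a` on the neighbouring curves converge to `(l, a)`; comparison with them
  -- shows that a limit of the `li` cannot exceed `l`.
  have hxi : ∀ᶠ i in F, OnCurve g σ L (mi i)
      (Classical.epsilon fun x => OnCurve g σ L (mi i) x a) a :=
    hex.mono fun i hi => Classical.epsilon_spec hi
  have hxt := h.onCurve.tendsto hg hm hmi tendsto_const_nhds hxi
  have hprod : Tendsto (fun i => (li i, ai i)) F (𝓝 (l, a)) := by
    refine IsCompact.tendsto_nhds_of_unique_ultrafilter (K := Icc l₁ l₂ ×ˢ Icc a₁ a₂)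
      (isCompact_Icc.prod isCompact_Icc) ?_ ?_
    · filter_upwards [hi, hmp, hmi.eventually (lt_mem_nhds (half_lt_self hm)),
        hmi.eventually (gt_mem_nhds (by linarith : m < 2 * m))] with i h3 hp h4 h5
      exact ⟨⟨(h₁.l_lt h3 hg hc hL (half_pos hm) h4).le, (h3.l_lt h₂ hg hc hL hp h5).le⟩,
        ⟨(h₁.a_lt h3 hg hc hL (half_pos hm) h4).le, (h3.a_lt h₂ hg hc hL hp h5).le⟩⟩
    · rintro U hU ⟨x, y⟩ ⟨hx, hy⟩ hUxy
      have hUx : Tendsto li U (𝓝 x) := (continuous_fst.tendsto _).comp hUxy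
      have hUy : Tendsto ai U (𝓝 y) := (continuous_snd.tendsto _).comp hUxy
      have h3 := OnCurve.of_tendsto hg (h₁.onCurve.adm.l_pos.trans_le hx.1)
        ⟨h₁.onCurve.adm.mem.1.trans_le hy.1, hy.2.trans_lt h₂.onCurve.adm.mem.2⟩ hUx
        (hmi.mono_left hU) hUy ((hi.filter_mono hU).mono fun i h => h.onCurve)
      have h4 : x ≤ l := le_of_tendsto_of_tendsto hUx (hxt.mono_left hU)
        ((hi.and hxi).filter_mono hU |>.mono fun i h => h.1.le h.2 hg)
      by_cases hya : y = a
      · subst hya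
        exact Prod.ext (h3.unique h.onCurve hg) rfl
      · exact absurd (h.lt x y h3 hya) h4.not_gt
  exact ⟨(continuous_fst.tendsto _).comp hprod, (continuous_snd.tendsto _).comp hprod⟩

end


/-! ### Limits as `μ → 0` and `μ → ∞`. -/

section

variable {g lb ab lt at' : ℝ → ℝ} {σ l m a b c L κ : ℝ}

/-- `g'` decreases on `(0, σ)`, so its limit at `0⁺` is its supremum, finite or not; it is positive
because `g'` vanishes at an interior point. -/
theorem exists_isKappa (hg : IsLogisticGrowth g σ) (L : ℝ) : ∃ κ, IsKappa g L κ := by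
  obtain ⟨p, hp, hp0⟩ := hg.exists_deriv_nonneg
  by_cases hb : BddAbove (deriv g '' Ioo 0 σ)
  · refine ⟨_, Or.inl ⟨sSup (deriv g '' Ioo 0 σ), ?_, ?_, rfl⟩⟩
    · have h2 : p / 2 ∈ Ioo 0 σ := ⟨half_pos hp.1, (half_lt_self hp.1).trans hp.2⟩
      have h1 := hg.deriv_strictAntiOn h2 hp (half_lt_self hp.1)
      rw [hp0] at h1
      exact h1.trans_le (le_csSup hb (mem_image_of_mem _ h2))
    · exact AntitoneOn.tendsto_nhdsWithin_Ioo_right (nonempty_Ioo.2 hg.sigma_pos)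
        hg.deriv_strictAntiOn.antitoneOn hb
  · refine ⟨0, Or.inr ⟨tendsto_atTop.2 fun B => ?_, rfl⟩⟩
    obtain ⟨y, ⟨x, hx, rfl⟩, hxy⟩ := not_bddAbove_iff.1 hb B
    filter_upwards [Ioo_mem_nhdsGT hx.1] with t ht
    exact hxy.le.trans
      (hg.deriv_strictAntiOn.antitoneOn ⟨ht.1, ht.2.trans hx.2⟩ hx ht.2.le)

theorem mul_deriv_le (hg : IsLogisticGrowth g σ) (ha : a ∈ Ioo 0 σ) : deriv g a * a ≤ g a := by
  have := hg.tangent ha (left_mem_Icc.2 hg.sigma_pos.le)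
  rw [hg.map_zero] at this
  linarith

theorem deriv_mul_sq_le (hg : IsLogisticGrowth g σ) (ha : a ∈ Ioo 0 σ) :
    deriv g a * a ^ 2 ≤ 2 * primG g a := by
  have h1 : ∫ t in (0:ℝ)..1, t * g a ≤ ∫ t in (0:ℝ)..1, g (a * t) :=
    intervalIntegral.integral_mono_on zero_le_one
      (Continuous.intervalIntegrable (by fun_prop) _ _)
      (hg.integrable_mul ha.1.le (left_mem_Icc.2 zero_le_one))
      fun t ht => hg.mul_le (Ioo_subset_Icc_self ha) ht
  rw [intervalIntegral.integral_mul_const, integral_id] at h1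
  rw [hg.primG_eq_mul_integral ha.1.le]
  have h2 := mul_le_mul_of_nonneg_left (mul_deriv_le hg ha) ha.1.le
  have h3 := mul_le_mul_of_nonneg_left h1 ha.1.le
  linarith

theorem le_mul_of_tendsto_deriv (hg : IsLogisticGrowth g σ) {d : ℝ}
    (hd : Tendsto (deriv g) (𝓝[>] 0) (𝓝 d)) : ∀ u ∈ Icc 0 σ, g u ≤ d * u := by
  intro u hu
  have hid : Tendsto (fun t : ℝ => t) (𝓝[>] 0) (𝓝 0) := tendsto_id.mono_left nhdsWithin_le_nhds
  have hg0 : Tendsto g (𝓝[>] 0) (𝓝 0) := by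
    have := ((hg.continuousOn 0 self_mem_Ici).mono Ioi_subset_Ici_self).tendsto
    rwa [hg.map_zero] at this
  have h := hg0.add (hd.mul (hid.const_sub u))
  rw [sub_zero, zero_add] at h
  refine ge_of_tendsto h ?_
  filter_upwards [Ioo_mem_nhdsGT hg.sigma_pos] with t ht using hg.tangent ht hu

theorem IsKappa.eventually_lt (hκ : IsKappa g L κ) (hL : 0 < L) (hl : κ < l) :
    ∀ᶠ a in 𝓝[>] 0, Real.pi ^ 2 / (4 * L ^ 2) < l * deriv g a := by
  rcases hκ with ⟨d, hd, ht, rfl⟩ | ⟨ht, rfl⟩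
  · refine (ht.const_mul l).eventually (lt_mem_nhds ?_)
    have := mul_lt_mul_of_pos_right hl hd
    refine lt_of_eq_of_lt ?_ this
    field_simp
  · exact (ht.const_mul_atTop hl).eventually_gt_atTop _

theorem IsKappa.le_of_onCurve (hκ : IsKappa g L κ) (hg : IsLogisticGrowth g σ) (hL : 0 < L)
    (hm : 0 < m) (h : OnCurve g σ L m l a) : κ ≤ l := by
  rcases hκ with ⟨d, hd, ht, rfl⟩ | ⟨ht, rfl⟩
  · have hl := h.adm.l_pos
    have h1 := h.adm.le_timeMap_of_le_mul hg hm.le hd (le_mul_of_tendsto_deriv hg ht)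
    rw [h.time] at h1
    have hld : 0 < l * d := mul_pos hl hd
    have hs := Real.sqrt_pos.2 hld
    have h2 : Real.pi / 2 ≤ L * √(l * d) := by
      rw [one_div, inv_mul_le_iff₀ hs] at h1; linarith
    have h3 : (Real.pi / 2) ^ 2 ≤ (L * √(l * d)) ^ 2 := by
      have := Real.pi_pos
      gcongr
    rw [mul_pow, Real.sq_sqrt hld.le] at h3
    rw [div_le_iff₀ (by positivity)]
    linarith
  · exact h.adm.l_pos.le

theorem IsKappa.le_of_isStart (hκ : IsKappa g L κ) (hg : IsLogisticGrowth g σ)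
    (hc : IsCStar g σ c) (hL : 0 < L) (h : IsStart g c L m l a) : 4 * κ ≤ l := by
  rcases hκ with ⟨d, hd, ht, rfl⟩ | ⟨ht, rfl⟩
  · have hl := h.l_pos
    have h1 := hc.branch_lower hg hl h.mem hd (le_mul_of_tendsto_deriv hg ht)
    rw [h.eq, h.time] at h1
    have hld : 0 < l * d := mul_pos hl hd
    have hs := Real.sqrt_pos.2 hld
    have h2 : Real.pi ≤ L * √(l * d) := by
      rw [one_div, inv_mul_le_iff₀ hs] at h1; linarith
    have h3 : Real.pi ^ 2 ≤ (L * √(l * d)) ^ 2 := by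
      have := Real.pi_pos
      gcongr
    rw [mul_pow, Real.sq_sqrt hld.le] at h3
    rw [← mul_div_assoc, div_le_iff₀ (by positivity)]
    linarith
  · linarith [h.l_pos]

theorem one_div_sqrt_mul_pi_lt {x : ℝ} (hL : 0 < L) (hx : Real.pi ^ 2 / L ^ 2 < x) :
    1 / √x * Real.pi < L := by
  have hpi := Real.pi_pos
  have hx0 : 0 < x := (by positivity : 0 < Real.pi ^ 2 / L ^ 2).trans hx
  have hs := Real.sqrt_pos.2 hx0
  rw [one_div, inv_mul_lt_iff₀ hs]
  rw [div_lt_iff₀ (by positivity)] at hx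
  refine lt_of_pow_lt_pow_left₀ 2 (by positivity) ?_
  rw [mul_pow, Real.sq_sqrt hx0.le]
  exact hx

/-- A start at height at least `y > 0` would have `l ≤ m/M(y)`, which tends to zero with `m`; the
kernel would then push the time map above `L`. -/
theorem tendsto_abar_zero (hg : IsLogisticGrowth g σ) (hc : IsCStar g σ c)
    (hb : ∀ m, 0 < m → IsStart g c L m (lb m) (ab m)) : Tendsto ab (𝓝[>] 0) (𝓝 0) := by
  refine tendsto_order.2 ⟨fun x hx => ?_, fun x hx => ?_⟩
  · filter_upwards [self_mem_nhdsWithin] with m hm using hx.trans (hb m hm).mem.1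
  · have hc0 := hc.mem.1
    set y := min x c with hy
    have hy0 : 0 < y := lt_min hx hc0
    have hM := hc.mean_pos hg ⟨hy0, min_le_right _ _⟩
    have hG := hg.primG_pos (right_mem_Ioc.2 hg.sigma_pos)
    have h1 : Tendsto (fun m : ℝ => m / (primG g y / y) * primG g σ) (𝓝[>] 0) (𝓝[>] 0) := by
      apply tendsto_nhdsWithin_of_tendsto_nhds_of_eventually_within
      · have : Continuous fun m : ℝ => m / (primG g y / y) * primG g σ := by fun_prop
        have h := this.tendsto 0
        simp only [zero_div, zero_mul] at h
        exact h.mono_left nhdsWithin_le_nhds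
      · filter_upwards [self_mem_nhdsWithin] with m hm
        exact mul_pos (div_pos hm hM) hG
    have h2 := (tendsto_kern_zero.comp h1).const_mul_atTop hy0
    filter_upwards [h2.eventually_gt_atTop L, self_mem_nhdsWithin] with m h3 hm
    have hm : 0 < m := hm
    have hs := hb m hm
    by_contra! hle
    have hya : y ≤ ab m := (min_le_left _ _).trans hle
    have h4 := (hs.adm hg hc).mul_kern_le_timeMap hg hm.le
    rw [hs.time] at h4
    have hl : lb m ≤ m / (primG g y / y) := by
      rw [hs.l_eq hg hc]
      exact div_le_div_of_nonneg_left hm.le hM ((hc.mean_strictMonoOn hg).monotoneOn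
        ⟨hy0, min_le_right _ _⟩ ⟨hs.mem.1, hs.mem.2.le⟩ hya)
    have h5 : kern (m / (primG g y / y) * primG g σ) ≤ kern (lb m * primG g σ) :=
      kern_strictAntiOn.antitoneOn (mem_Ioi.2 (mul_pos hs.l_pos hG))
        (mem_Ioi.2 (mul_pos (div_pos hm hM) hG)) (mul_le_mul_of_nonneg_right hl hG.le)
    have h6 : y * kern (m / (primG g y / y) * primG g σ) ≤ ab m * kern (lb m * primG g σ) :=
      mul_le_mul hya h5 (kern_pos (mul_pos (div_pos hm hM) hG)).le hs.mem.1.le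
    have h3 : L < y * kern (m / (primG g y / y) * primG g σ) := h3
    linarith

theorem tendsto_lbar_zero (hg : IsLogisticGrowth g σ) (hc : IsCStar g σ c) (hL : 0 < L)
    (hκ : IsKappa g L κ) (hb : ∀ m, 0 < m → IsStart g c L m (lb m) (ab m)) :
    Tendsto lb (𝓝[>] 0) (𝓝 (4 * κ)) := by
  refine tendsto_order.2 ⟨fun x hx => ?_, fun x hx => ?_⟩
  · filter_upwards [self_mem_nhdsWithin] with m hm
    exact hx.trans_le (hκ.le_of_isStart hg hc hL (hb m hm))
  · have hx0 : 0 < x := by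
      have : 0 ≤ κ := by
        rcases hκ with ⟨d, hd, -, rfl⟩ | ⟨-, rfl⟩
        · positivity
        · exact le_rfl
      linarith
    obtain ⟨b, hb1, hb2⟩ := ((hκ.eventually_lt hL (by linarith : κ < x / 4)).and
      (Ioo_mem_nhdsGT hc.mem.1)).exists
    have hbσ : b ∈ Ioo 0 σ := ⟨hb2.1, hb2.2.trans hc.mem.2⟩
    have hb0 := hb2.1
    have hM0 := tendsto_mean_zero hg hc
    have hid : Tendsto (fun a : ℝ => a) (𝓝[>] 0) (𝓝 0) := tendsto_id.mono_left nhdsWithin_le_nhds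
    -- This is the limit of the condition in `IsCStar.branch_upper` as `a → 0`; it holds because
    -- `2M(b)/b ≥ g'(b)` and `x/4 > κ`.
    have hlim : Real.pi ^ 2 / L ^ 2 < 2 * (x * ((primG g b / b - 0) / (b - 0))) := by
      have h1 := deriv_mul_sq_le hg hbσ
      have h2 : deriv g b ≤ 2 * ((primG g b / b - 0) / (b - 0)) := by
        rw [sub_zero, sub_zero, div_div, ← mul_div_assoc, le_div_iff₀ (by positivity)]
        linarith
      have h3 := mul_le_mul_of_nonneg_left h2 hx0.le
      have h4 : Real.pi ^ 2 / L ^ 2 = 4 * (Real.pi ^ 2 / (4 * L ^ 2)) := by field_simp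
      rw [h4]
      linarith
    have hpos : 0 < 2 * (x * ((primG g b / b - 0) / (b - 0))) :=
      lt_trans (by have := Real.pi_pos; positivity) hlim
    have h5 : Tendsto (fun a => 2 * (x * ((primG g b / b - primG g a / a) / (b - a)))) (𝓝[>] 0)
        (𝓝 (2 * (x * ((primG g b / b - 0) / (b - 0))))) :=
      ((((hM0.mono_right nhdsWithin_le_nhds).const_sub _).div (hid.const_sub _)
        (by simpa using hb0.ne')).const_mul x).const_mul 2
    have h6 : Tendsto (fun a => a + 1 / √(2 * (x * ((primG g b / b - primG g a / a) / (b - a)))) *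
        Real.pi) (𝓝[>] 0) (𝓝 (0 + 1 / √(2 * (x * ((primG g b / b - 0) / (b - 0)))) * Real.pi)) :=
      hid.add ((tendsto_const_nhds.div ((Real.continuous_sqrt.tendsto _).comp h5)
        (Real.sqrt_pos.2 hpos).ne').mul_const _)
    rw [zero_add] at h6
    have h7 : Tendsto ab (𝓝[>] 0) (𝓝[>] 0) :=
      tendsto_nhdsWithin_of_tendsto_nhds_of_eventually_within _ (tendsto_abar_zero hg hc hb)
        (by filter_upwards [self_mem_nhdsWithin] with m hm using (hb m hm).mem.1)
    filter_upwards [self_mem_nhdsWithin, h7.eventually (Ioo_mem_nhdsGT hb0),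
      h7.eventually (h6.eventually (gt_mem_nhds (one_div_sqrt_mul_pi_lt hL hlim)))] with m hm h8 h9
    by_contra! hle
    have hs := hb m hm
    have h10 := hc.branch_upper hg hs.l_pos hs.mem h8.2 hb2.2.le
    rw [hs.eq, hs.time] at h10
    have hslope : 0 < (primG g b / b - primG g (ab m) / ab m) / (b - ab m) :=
      div_pos (sub_pos.2 (hc.mean_strictMonoOn hg ⟨hs.mem.1, hs.mem.2.le⟩ ⟨hb0, hb2.2.le⟩ h8.2))
        (sub_pos.2 h8.2)
    have h11 : 1 / √(2 * (lb m * ((primG g b / b - primG g (ab m) / ab m) / (b - ab m)))) *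
        Real.pi ≤ 1 / √(2 * (x * ((primG g b / b - primG g (ab m) / ab m) / (b - ab m)))) *
        Real.pi := by
      have := Real.pi_pos
      have : 0 < √(2 * (x * ((primG g b / b - primG g (ab m) / ab m) / (b - ab m)))) :=
        Real.sqrt_pos.2 (by positivity)
      gcongr
    linarith

theorem tendsto_lstar_zero (hg : IsLogisticGrowth g σ) (hc : IsCStar g σ c) (hL : 0 < L)
    (hκ : IsKappa g L κ) (hb : ∀ m, 0 < m → IsStart g c L m (lb m) (ab m))
    (ht : ∀ m, 0 < m → IsTurn g σ L m (lt m) (at' m)) : Tendsto lt (𝓝[>] 0) (𝓝 κ) := by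
  refine tendsto_order.2 ⟨fun x hx => ?_, fun x hx => ?_⟩
  · filter_upwards [self_mem_nhdsWithin] with m hm
    exact hx.trans_le (hκ.le_of_onCurve hg hL hm (ht m hm).onCurve)
  · have hx0 : 0 < x := by
      have : 0 ≤ κ := by
        rcases hκ with ⟨d, hd, -, rfl⟩ | ⟨-, rfl⟩
        · positivity
        · exact le_rfl
      linarith
    have hid : Tendsto (fun a : ℝ => a) (𝓝[>] 0) (𝓝 0) := tendsto_id.mono_left nhdsWithin_le_nhds
    obtain ⟨y, hy1, hy2⟩ := exists_between hx
    have hpi := Real.pi_pos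
    have hy0 : 0 < y := by
      by_contra! hy0
      rcases hκ with ⟨d, hd, -, rfl⟩ | ⟨-, rfl⟩
      · have : 0 < Real.pi ^ 2 / (4 * d * L ^ 2) := by positivity
        linarith
      · linarith
    -- The intermediate `y` between `κ` and `x` leaves a factor `√(y/x) < 1`, which makes room for
    -- the extra term `a`.
    have hev : ∀ᶠ a in 𝓝[>] 0, a + 1 / √(x * (g a / a)) * (Real.pi / 2) < L := by
      have hq : √(y / x) < 1 := by
        rw [Real.sqrt_lt' one_pos, one_pow]; exact (div_lt_one hx0).2 hy2
      have h1 : ∀ᶠ a in 𝓝[>] 0, a < L * (1 - √(y / x)) :=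
        hid.eventually (gt_mem_nhds (mul_pos hL (sub_pos.2 hq)))
      filter_upwards [h1, hκ.eventually_lt hL hy1, Ioo_mem_nhdsGT hg.sigma_pos] with a h2 h3 h4
      have h5 : deriv g a ≤ g a / a := by
        rw [le_div_iff₀ h4.1]; exact mul_deriv_le hg h4
      have h6 := mul_le_mul_of_nonneg_left h5 hy0.le
      have h7 : Real.pi ^ 2 / L ^ 2 < 4 * (y * (g a / a)) := by
        have : Real.pi ^ 2 / L ^ 2 = 4 * (Real.pi ^ 2 / (4 * L ^ 2)) := by field_simp
        linarith
      have h8 := one_div_sqrt_mul_pi_lt hL h7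
      have hga : 0 < g a / a := div_pos (hg.pos h4.1 h4.2) h4.1
      have h9 : 1 / √(x * (g a / a)) * (Real.pi / 2) =
          √(y / x) * (1 / √(4 * (y * (g a / a))) * Real.pi) := by
        have e1 : √(4 * (y * (g a / a))) = 2 * √(y * (g a / a)) := by
          rw [Real.sqrt_mul (by norm_num), show (4:ℝ) = 2 ^ 2 by norm_num,
            Real.sqrt_sq two_pos.le]
        have e2 : √(y * (g a / a)) = √(y / x) * √(x * (g a / a)) := by
          rw [← Real.sqrt_mul (by positivity)]
          congr 1
          field_simp
        have := Real.sqrt_pos.2 (mul_pos hx0 hga)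
        have := Real.sqrt_pos.2 (div_pos hy0 hx0)
        rw [e1, e2]
        field_simp
      rw [h9]
      have h10 := mul_le_mul_of_nonneg_left h8.le (Real.sqrt_nonneg (y / x))
      linarith
    obtain ⟨a, ha1, ha2⟩ := (hev.and (Ioo_mem_nhdsGT hg.sigma_pos)).exists
    have hA := adm_zero hg hx0 ha2
    have hT := (timeMap_zero_le hg hx0 ha2).trans_lt ha1
    have hF : 0 < primF g 0 x a := by
      have := mul_pos hx0 (hg.primG_pos ⟨ha2.1, ha2.2.le⟩)
      unfold primF; linarith
    have hAe : ∀ᶠ m in 𝓝[>] 0, Adm g σ x m a ∧ 0 < primF g m x a :=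
      Adm.eventually hg hA hF tendsto_const_nhds hid tendsto_const_nhds
    have hTe := (hA.tendsto_timeMap hg tendsto_const_nhds hid tendsto_const_nhds
      (hAe.mono fun m h => h.1)).eventually (gt_mem_nhds hT)
    filter_upwards [hAe, hTe, self_mem_nhdsWithin,
      (tendsto_abar_zero hg hc hb).eventually (gt_mem_nhds ha2.1)] with m h1 h2 hm h3
    obtain ⟨l', hl'⟩ := (hb m hm).exists_onCurve hg hc hm ⟨h3.le, lt_min ha2.2
      ((h1.1.lt_timeMap hg).trans h2)⟩
    exact ((ht m hm).le hl' hg).trans_lt (hl'.lt_of_timeMap_lt hg h1.1 h2)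

/-- At `m = 0` the time map increases with the height. If it equals `L` at `(l₂, a₂)`, then for
small `m` the curve is left of `l₂` at height `a₂/2` and right of it at height `a₂`, so its turn
lies below `a₂`. -/
theorem tendsto_astar_zero (hg : IsLogisticGrowth g σ) (hc : IsCStar g σ c) (hL : 0 < L)
    (hb : ∀ m, 0 < m → IsStart g c L m (lb m) (ab m))
    (ht : ∀ m, 0 < m → IsTurn g σ L m (lt m) (at' m)) : Tendsto at' (𝓝[>] 0) (𝓝 0) := by
  refine tendsto_order.2 ⟨fun x hx => ?_, fun x hx => ?_⟩
  · filter_upwards [self_mem_nhdsWithin] with m hm using hx.trans (ht m hm).onCurve.adm.mem.1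
  · have hid : Tendsto (fun a : ℝ => a) (𝓝[>] 0) (𝓝 0) := tendsto_id.mono_left nhdsWithin_le_nhds
    obtain ⟨a₂, ha₂, ha₂'⟩ := exists_between (lt_min hx (lt_min hg.sigma_pos hL))
    have h2x : a₂ < x := ha₂'.trans_le (min_le_left _ _)
    have h2m : a₂ < min σ L := ha₂'.trans_le (min_le_right _ _)
    have h2σ : a₂ ∈ Ioo 0 σ := ⟨ha₂, h2m.trans_le (min_le_left _ _)⟩
    have hG := hg.primG_pos (right_mem_Ioc.2 hg.sigma_pos)
    obtain ⟨l₀, hl₀, hT₀⟩ : ∃ l₀, 0 < l₀ ∧ L ≤ timeMap g l₀ 0 a₂ := by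
      have h1 : Tendsto (fun l : ℝ => l * primG g σ) (𝓝[>] 0) (𝓝[>] 0) := by
        apply tendsto_nhdsWithin_of_tendsto_nhds_of_eventually_within
        · simpa using hid.mul_const (primG g σ)
        · filter_upwards [self_mem_nhdsWithin] with l hl using mul_pos hl hG
      have h2 := (tendsto_kern_zero.comp h1).const_mul_atTop ha₂
      obtain ⟨l, h3, hl⟩ := ((h2.eventually_ge_atTop L).and self_mem_nhdsWithin).exists
      exact ⟨l, hl, le_trans h3 ((adm_zero hg hl h2σ).mul_kern_le_timeMap hg le_rfl)⟩
    obtain ⟨l₂, -, h₂⟩ := (adm_zero hg hl₀ h2σ).exists_onCurve hg hT₀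
      (h2m.trans_le (min_le_right _ _))
    have hl₂ := h₂.adm.l_pos
    set a₁ := a₂ / 2 with ha₁
    have h1 : a₁ ∈ Ioo 0 σ := ⟨half_pos ha₂, (half_lt_self ha₂).trans h2σ.2⟩
    have h12 : a₁ < a₂ := half_lt_self ha₂
    have hT : timeMap g l₂ 0 a₁ < L := h₂.time ▸ timeMap_zero_lt hg hl₂ h1.1 h12 h2σ.2
    have hA := adm_zero hg hl₂ h1
    have hF : 0 < primF g 0 l₂ a₁ := by
      have := mul_pos hl₂ (hg.primG_pos ⟨h1.1, h1.2.le⟩)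
      unfold primF; linarith
    have hAe : ∀ᶠ m in 𝓝[>] 0, Adm g σ l₂ m a₁ ∧ 0 < primF g m l₂ a₁ :=
      Adm.eventually hg hA hF tendsto_const_nhds hid tendsto_const_nhds
    have hTe := (hA.tendsto_timeMap hg tendsto_const_nhds hid tendsto_const_nhds
      (hAe.mono fun m h => h.1)).eventually (gt_mem_nhds hT)
    filter_upwards [hAe, hTe, self_mem_nhdsWithin,
      (tendsto_abar_zero hg hc hb).eventually (gt_mem_nhds h1.1)] with m h3 h4 hm h5
    have hm : 0 < m := hm
    obtain ⟨m₁, hm₁⟩ := (hb m hm).exists_onCurve hg hc hm (b := a₁) ⟨h5.le, h12.trans h2m⟩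
    obtain ⟨m₂, hm₂⟩ := (hb m hm).exists_onCurve hg hc hm (b := a₂) ⟨(h5.trans h12).le, h2m⟩
    have e1 : m₁ < l₂ := hm₁.lt_of_timeMap_lt hg h3.1 h4
    have e2 : l₂ < m₂ := by
      have h6 := hm₂.adm.timeMap_lt_of_lt_m hg hm
      rw [hm₂.time] at h6
      exact h₂.lt_of_timeMap_lt hg (hm₂.adm.anti_m hm.le) h6
    refine lt_of_lt_of_le ?_ h2x.le
    by_contra! hle
    have e3 := (ht m hm).le hm₁ hg
    rcases eq_or_lt_of_le hle with he | hlt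
    · have := (ht m hm).onCurve
      rw [← he] at this
      have := this.unique hm₂ hg
      linarith
    · rcases lt_max_iff.1 (hm₂.lt_max hm₁ (ht m hm).onCurve hg ⟨h12, hlt⟩) with h | h <;> linarith

theorem tendsto_lbar_atTop (hg : IsLogisticGrowth g σ) (hc : IsCStar g σ c)
    (hb : ∀ m, 0 < m → IsStart g c L m (lb m) (ab m)) : Tendsto lb atTop atTop := by
  refine tendsto_atTop_mono' _ ?_ (tendsto_id.atTop_div_const (hg.pos hc.mem.1 hc.mem.2))
  filter_upwards [eventually_gt_atTop 0] with m hm using ((hb m hm).div_lt hg hc hm).le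

theorem tendsto_lstar_atTop (hg : IsLogisticGrowth g σ)
    (ht : ∀ m, 0 < m → IsTurn g σ L m (lt m) (at' m)) : Tendsto lt atTop atTop := by
  obtain ⟨G, hG⟩ := isCompact_Icc.exists_bound_of_continuousOn
    (hg.continuousOn.mono (Icc_subset_Ici_self : Icc 0 σ ⊆ Ici 0))
  have hG0 : 0 ≤ G := (norm_nonneg _).trans (hG 0 (left_mem_Icc.2 hg.sigma_pos.le))
  refine tendsto_atTop_mono' _ ?_ (tendsto_id.atTop_div_const (by linarith : 0 < G + 1))
  filter_upwards [eventually_gt_atTop 0] with m hm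
  have h := (ht m hm).onCurve
  have h1 := hg.pos h.adm.mem.1 h.adm.mem.2
  have h2 := (le_abs_self _).trans (hG _ (Ioo_subset_Icc_self h.adm.mem))
  exact (div_le_div_of_nonneg_left hm.le h1 (by linarith)).trans (h.lt_l hg).le

/-- At a fixed height `a < min c L` on the branch, the reaction is `m (g(a)/M(a) - 1)`, which tends
to infinity; the time map tends to `a < L`, so the start is eventually no lower than `a`. -/
theorem tendsto_abar_atTop (hg : IsLogisticGrowth g σ) (hc : IsCStar g σ c) (hL : 0 < L)
    (hb : ∀ m, 0 < m → IsStart g c L m (lb m) (ab m)) :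
    Tendsto ab atTop (𝓝 (min c L)) := by
  refine tendsto_order.2 ⟨fun x hx => ?_, fun x hx => ?_⟩
  · obtain ⟨a, ha1, ha2⟩ := exists_between (max_lt hx (lt_min hc.mem.1 hL))
    have hxa : x < a := (le_max_left _ _).trans_lt ha1
    have ha0 : 0 < a := (le_max_right _ _).trans_lt ha1
    have hac : a < c := ha2.trans_le (min_le_left _ _)
    have haL : a < L := ha2.trans_le (min_le_right _ _)
    have hM := hc.mean_pos hg ⟨ha0, hac.le⟩
    have hq : 0 < g a / (primG g a / a) - 1 := by
      rw [sub_pos, one_lt_div hM]; exact hc.mean_lt hg ⟨ha0, hac⟩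
    have h1 : Tendsto (fun m => a * (1 + Real.pi /
        √(2 * (a * (m * (g a / (primG g a / a) - 1)))))) atTop (𝓝 (a * (1 + 0))) := by
      refine (Tendsto.const_add 1 ?_).const_mul a
      refine tendsto_const_nhds.div_atTop (Real.tendsto_sqrt_atTop.comp ?_)
      exact ((tendsto_id.atTop_mul_const hq).const_mul_atTop ha0).const_mul_atTop two_pos
    rw [add_zero, mul_one] at h1
    filter_upwards [h1.eventually (gt_mem_nhds haL), eventually_gt_atTop 0] with m h2 hm
    have hs := hb m hm
    have hA := hc.adm_branch hg (l := m / (primG g a / a)) (by positivity) ⟨ha0, hac⟩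
    rw [div_mul_cancel₀ _ hM.ne'] at hA
    have h3 := hA.timeMap_le hg
    have h4 : reaction g m (m / (primG g a / a)) a = m * (g a / (primG g a / a) - 1) := by
      unfold reaction; ring
    rw [h4] at h3
    refine hxa.trans_le ?_
    by_contra! hlt
    have h5 := hc.branch_lt_of_mean hg hm hs.mem.1 hlt hac
    rw [← hs.l_eq hg hc, hs.time] at h5
    linarith
  · filter_upwards [eventually_gt_atTop 0] with m hm
    exact (lt_min (hb m hm).mem.2 (((hb m hm).onCurve hg hc).lt_L hg)).trans hx

end

theorem theorem2p1 (g : ℝ → ℝ) (σ L : ℝ) (hL : 0 < L) (hg : IsLogisticGrowth g σ) :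
    ∃ c κ : ℝ, IsCStar g σ c ∧ (∀ c', IsCStar g σ c' → c' = c) ∧ IsKappa g L κ ∧
      ∃ lamBar normBar lamStar normStar : ℝ → ℝ,
        (∀ μ : ℝ, 0 < μ →
          μ / g c < lamBar μ ∧
          IsTheta g σ μ (lamBar μ) (normBar μ) ∧
          IsSubsetShaped (bifurcationCurve g L μ)
            (lamBar μ, normBar μ) (lamStar μ, normStar μ) (min σ L)) ∧
        (StrictMonoOn lamBar (Ioi 0) ∧ ContinuousOn lamBar (Ioi 0) ∧
          StrictMonoOn normBar (Ioi 0) ∧ ContinuousOn normBar (Ioi 0) ∧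
          Tendsto lamBar (𝓝[>] 0) (𝓝 (4 * κ)) ∧ Tendsto normBar (𝓝[>] 0) (𝓝 0) ∧
          Tendsto lamBar atTop atTop ∧ Tendsto normBar atTop (𝓝 (min c L))) ∧
        (StrictMonoOn lamStar (Ioi 0) ∧ ContinuousOn lamStar (Ioi 0) ∧
          StrictMonoOn normStar (Ioi 0) ∧ ContinuousOn normStar (Ioi 0) ∧
          Tendsto lamStar (𝓝[>] 0) (𝓝 κ) ∧ Tendsto normStar (𝓝[>] 0) (𝓝 0) ∧
          Tendsto lamStar atTop atTop ∧ Tendsto normStar atTop (𝓝 (min c L))) := by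
  obtain ⟨c, hc⟩ := hg.exists_isCStar
  obtain ⟨κ, hκ⟩ := exists_isKappa hg L
  choose! lb ab hb using fun m (hm : 0 < m) => hc.exists_isStart hg hL hm
  choose! lt at' ht using fun m (hm : 0 < m) => (hb m hm).isSubsetShaped hg hc hL hm
  have htu : ∀ m, 0 < m → IsTurn g σ L m (lt m) (at' m) := fun m hm => (ht m hm).1
  have hev : ∀ m ∈ Ioi (0:ℝ), ∀ᶠ x in 𝓝[Ioi 0] m, 0 < x := fun m _ => eventually_mem_nhdsWithin
  have hid : ∀ m : ℝ, Tendsto (fun x : ℝ => x) (𝓝[Ioi 0] m) (𝓝 m) := fun m =>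
    tendsto_id.mono_left nhdsWithin_le_nhds
  have hbt := fun m (hm : m ∈ Ioi (0:ℝ)) => (hb m hm).tendsto hg hc hL hm (hid m) (li := lb)
    (ai := ab) ((hev m hm).mono fun x hx => hb x hx)
  have htt := fun m (hm : m ∈ Ioi (0:ℝ)) => (htu m hm).tendsto hg hc hL hm (hid m) (li := lt)
    (ai := at') ((hev m hm).mono fun x hx => htu x hx)
  refine ⟨c, κ, hc, fun c' hc' => hc.unique hc', hκ, lb, ab, lt, at', fun m hm =>
    ⟨(hb m hm).div_lt hg hc hm, (hb m hm).isTheta hg hc hm, (ht m hm).2.2⟩,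
    ⟨fun m hm n hn hmn => (hb m hm).l_lt (hb n hn) hg hc hmn, fun m hm => (hbt m hm).1,
      fun m hm n hn hmn => (hb m hm).a_lt (hb n hn) hg hc hmn, fun m hm => (hbt m hm).2,
      tendsto_lbar_zero hg hc hL hκ hb, tendsto_abar_zero hg hc hb,
      tendsto_lbar_atTop hg hc hb, tendsto_abar_atTop hg hc hL hb⟩,
    fun m hm n hn hmn => (htu m hm).l_lt (htu n hn) hg hc hL hm hmn, fun m hm => (htt m hm).1,
    fun m hm n hn hmn => (htu m hm).a_lt (htu n hn) hg hc hL hm hmn, fun m hm => (htt m hm).2,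
    tendsto_lstar_zero hg hc hL hκ hb htu, tendsto_astar_zero hg hc hL hb htu,
    tendsto_lstar_atTop hg htu, ?_⟩
  -- The turning height is squeezed between the starting height and `min c L`.
  refine tendsto_of_tendsto_of_tendsto_of_le_of_le' (tendsto_abar_atTop hg hc hL hb)
    tendsto_const_nhds ?_ ?_
  · filter_upwards [eventually_gt_atTop 0] with m hm using (ht m hm).2.1.le
  · filter_upwards [eventually_gt_atTop 0] with m hm
    exact le_min ((htu m hm).lt_c hg hc hL hm).le ((htu m hm).onCurve.lt_L hg).le
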